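/- Let $k \ge 3$ be an integer and let $G$ be a finite $2k$-regular graph of girth at least $2k-2$ (the girth is the length of a shortest cycle) that has two (edge-)disjoint perfect matchings. Then there is a set $\mathcal{D}$ of subgraphs of $G$ whose edge sets partition $E(G)$ such that every member of $\mathcal{D}$ is a path whose length (number of edges) is in $\{2k-1, 2k, 2k+1\}$, and the number of paths of length $2k-1$ in $\mathcal{D}$ equals the number of paths of length $2k+1$ in $\mathcal{D}$. -/

import Mathlib

namespace PathDecomp

/-- A finite graph `G` belongs to the class of `2k`-regular graphs of girth at least `2k - 2` that
admit a pair of (edge-)disjoint perfect matchings. -/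
structure InClass {V : Type*} [Fintype V] (G : SimpleGraph V) [DecidableRel G.Adj] (k : ℕ) :
    Prop where
  regular : G.IsRegularOfDegree (2 * k)
  girth : ((2 * k - 2 : ℕ) : ℕ∞) ≤ G.egirth
  matchings : ∃ M₁ M₂ : G.Subgraph, M₁.IsPerfectMatching ∧ M₂.IsPerfectMatching ∧
    Disjoint M₁.edgeSet M₂.edgeSet

/-- The subgraph `H` of `G` is a path with exactly `l` edges. -/
def IsPathOfLength {V : Type*} {G : SimpleGraph V} (H : G.Subgraph) (l : ℕ) : Prop :=
  ∃ (u v : V) (p : G.Walk u v), p.IsPath ∧ p.length = l ∧ H = p.toSubgraph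

/-- A decomposition of `G`: a set of subgraphs whose edge sets partition the edge set of `G`. -/
structure IsDecomposition {V : Type*} (G : SimpleGraph V) (D : Set G.Subgraph) : Prop where
  nonempty : ∀ H ∈ D, H.edgeSet.Nonempty
  disjoint : D.PairwiseDisjoint (fun H => H.edgeSet)
  cover : ⋃ H ∈ D, H.edgeSet = G.edgeSet

end PathDecomp

/-!
Let `m` and `σ` be the involutions given by two disjoint perfect matchings of the `2 * k`-regular
graph `G`. The edges outside of the matching `m` are first decomposed into paths of length
`2 * k - 1`, one for every edge of the matching `σ`. The edges of `m` are then added to these paths.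
As there are half as many paths as vertices, their average length is `2 * k`, and lengths from
`2 * k - 1` to `2 * k + 1` force the two extreme lengths to occur equally often
(`exists_decomposition`).

*Initial paths.* By Petersen's theorem the edges outside of both matchings are the arcs of `k - 1`
permutations (`exists_perms`). From each vertex follow `k - 3` of them one after the other, and join
the two walks obtained at the ends of each edge of `σ`. If `s` and `τ s` are the two ends of such a
walk, prolong it by `s, h s, g (h s)` and `τ s, h (τ s), g (h (τ s))`, where `h` and `g` are the two
remaining permutations. By the girth condition, a trail of length `2 * k - 1` can fail to be a path
only if it repeats a vertex close to its ends (`nodup_of_edgeDistinct`), and this happens only for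
bad vertices `s`, where `g (h (τ s)) = h s`. The trails are repaired by exchanging `h` and `g` at a
set `A` of bad vertices. With `φ = h ∘ τ`, the set `A` must not contain both of `u` and `φ u`, but it
must contain at least one of `s` and `φ s` for each bad vertex `s`. Such a set exists if all cycles
of `φ` that consist of bad vertices have length two
(`exists_bad_selection_of_longBad_eq_empty`), and this holds if `h` and `g` are changed so as to
minimize first the number of bad vertices and then the number of those on longer bad cycles
(`exists_longBad_lt`).

*Adding the second matching.* Every vertex is an end of exactly one initial path. If an edge
`x (m x)` joins the ends of two different paths, it can be added to one of them, or else each of the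
two paths contains both `x` and `m x`, and `link_split` redistributes the edges; the remaining ends
stay ends (`PathSystem.complete`). If an edge `x (m x)` joins the two ends of one path `T`, it closes
`T` to a cycle. Hall's theorem provides an injective map `π` such that an end of the path `π T` lies
on `T` (`exists_injective_meet`). The cycle of `T` can be merged with the path `π T` by
`merge_split`, or, if `T`, `π T` and `π (π T)` all close to cycles, these three cycles split into
three paths (`triple_split`); disjoint groups of these two kinds cover all such `T`
(`exists_groups`).

The splitting lemmas rest on the girth: for `k ≥ 4` the redistribution of the edges is explicit, and
an obstruction would give a closed trail that is shorter than the girth. For `k = 3` the girth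
condition only excludes triangles; here the paths have so few vertices that all ways in which two of
them can meet are enumerated, and each of them is split by an entry of a short list of templates.
-/

namespace PathDecomp

/-! ### Edge multisets of vertex lists -/

/-- The multiset of edges traversed by a list of vertices, read as a walk. -/
def pathEdges {V : Type*} : List V → Multiset (Sym2 V)
  | a :: b :: l => s(a, b) ::ₘ pathEdges (b :: l)
  | _ => 0

/-- The multiset of edges of the closed walk that runs through a list of vertices and returns to
its head. -/
def cycleEdges {V : Type*} : List V → Multiset (Sym2 V)
  | a :: l => pathEdges (a :: l ++ [a])
  | [] => 0

/-- A multiset of edges of `G` without repetition; for the edges of a walk this says that the walk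
is a trail of `G`. -/
def EdgeDistinct {V : Type*} (G : SimpleGraph V) (s : Multiset (Sym2 V)) : Prop :=
  s.Nodup ∧ ∀ e ∈ s, e ∈ G.edgeSet

section Walks

variable {V : Type*} {G : SimpleGraph V}

@[simp] theorem pathEdges_nil : pathEdges ([] : List V) = 0 := rfl
@[simp] theorem pathEdges_singleton (a : V) : pathEdges [a] = 0 := rfl
@[simp] theorem pathEdges_cons_cons (a b : V) (l : List V) :
    pathEdges (a :: b :: l) = s(a, b) ::ₘ pathEdges (b :: l) := rfl

theorem pathEdges_append_cons (l₁ : List V) (a : V) (l₂ : List V) :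
    pathEdges (l₁ ++ a :: l₂) = pathEdges (l₁ ++ [a]) + pathEdges (a :: l₂) := by
  induction l₁ with
  | nil => simp
  | cons b l ih =>
    cases l with
    | nil => simp
    | cons c l => simpa using ih

theorem pathEdges_concat_concat (l : List V) (a b : V) :
    pathEdges (l ++ [a, b]) = s(a, b) ::ₘ pathEdges (l ++ [a]) := by
  rw [pathEdges_append_cons l a [b], add_comm]
  simp

theorem pathEdges_reverse (l : List V) : pathEdges l.reverse = pathEdges l := by
  induction l with
  | nil => rfl
  | cons a l ih =>
    cases l with
    | nil => rfl
    | cons b l =>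
      have h : (a :: b :: l).reverse = l.reverse ++ [b, a] := by simp
      rw [h, pathEdges_concat_concat, pathEdges_cons_cons, ← ih, List.reverse_cons, Sym2.eq_swap]

theorem card_pathEdges (l : List V) : (pathEdges l).card = l.length - 1 := by
  induction l with
  | nil => rfl
  | cons a l ih =>
    cases l with
    | nil => rfl
    | cons b l => simp [ih]

theorem mem_of_mem_pathEdges {l : List V} {e : Sym2 V} (he : e ∈ pathEdges l) {x : V}
    (hx : x ∈ e) : x ∈ l := by
  induction l with
  | nil => simp at he
  | cons a l ih =>
    cases l with
    | nil => simp at he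
    | cons b l =>
      simp only [pathEdges_cons_cons, Multiset.mem_cons] at he
      rcases he with rfl | he
      · simp only [Sym2.mem_iff] at hx
        rcases hx with rfl | rfl <;> simp
      · exact List.mem_cons_of_mem _ (ih he)

theorem pathEdges_le_append_left (l₁ l₂ : List V) : pathEdges l₁ ≤ pathEdges (l₁ ++ l₂) := by
  cases l₂ with
  | nil => simp
  | cons a l₂ =>
    rw [pathEdges_append_cons]
    refine le_trans ?_ (Multiset.le_add_right _ _)
    rcases List.eq_nil_or_concat l₁ with rfl | ⟨l, b, rfl⟩
    · simp
    · rw [List.concat_eq_append, List.append_assoc]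
      simpa [pathEdges_concat_concat] using Multiset.le_cons_self _ _

theorem pathEdges_le_append_right (l₁ l₂ : List V) : pathEdges l₂ ≤ pathEdges (l₁ ++ l₂) := by
  rw [← pathEdges_reverse l₂, ← pathEdges_reverse (l₁ ++ l₂), List.reverse_append]
  exact pathEdges_le_append_left _ _

theorem pathEdges_le_of_infix {l₁ l₂ : List V} (h : l₁ <:+: l₂) :
    pathEdges l₁ ≤ pathEdges l₂ := by
  obtain ⟨p, q, rfl⟩ := h
  exact (pathEdges_le_append_right p l₁).trans (pathEdges_le_append_left _ q)

theorem cycleEdges_cons (a : V) (l : List V) :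
    cycleEdges (a :: l) = pathEdges (a :: l ++ [a]) := rfl

theorem cycleEdges_concat (a : V) (l : List V) :
    cycleEdges (l ++ [a]) = cycleEdges (a :: l) := by
  cases l with
  | nil => rfl
  | cons b l =>
    simp only [cycleEdges, List.cons_append, List.append_assoc, List.nil_append]
    have := pathEdges_append_cons (b :: l) a [b]
    simp only [List.cons_append] at this
    rw [this, pathEdges_cons_cons a b (l ++ [a]), add_comm]
    simp

theorem cycleEdges_append (l₁ l₂ : List V) :
    cycleEdges (l₁ ++ l₂) = cycleEdges (l₂ ++ l₁) := by
  induction l₁ generalizing l₂ with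
  | nil => simp
  | cons a l ih =>
    rw [List.cons_append, ← cycleEdges_concat, List.append_assoc, ih, List.append_assoc]
    rfl

theorem cycleEdges_cons_reverse (a : V) (l : List V) :
    cycleEdges (a :: l.reverse) = cycleEdges (a :: l) := by
  rw [cycleEdges_cons, cycleEdges_cons, ← pathEdges_reverse (a :: l ++ [a])]
  simp

/-- A cycle through a list is the path along the list plus the edge from the last vertex to the
first one. -/
theorem cycleEdges_eq (a b : V) (l : List V) :
    cycleEdges (a :: l ++ [b]) = s(b, a) ::ₘ pathEdges (a :: l ++ [b]) := by
  have := pathEdges_concat_concat (a :: l) b a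
  simp only [cycleEdges, List.cons_append, List.append_assoc, List.nil_append] at *
  exact this

theorem EdgeDistinct.mono {s t : Multiset (Sym2 V)} (h : EdgeDistinct G t) (hst : s ≤ t) :
    EdgeDistinct G s :=
  ⟨Multiset.nodup_of_le hst h.1, fun e he => h.2 e (Multiset.mem_of_le hst he)⟩

theorem EdgeDistinct.adj {s : Multiset (Sym2 V)} (h : EdgeDistinct G s) {a b : V}
    (hab : s(a, b) ∈ s) : G.Adj a b := by
  simpa using h.2 _ hab

theorem EdgeDistinct.isChain {l : List V} (h : EdgeDistinct G (pathEdges l)) :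
    l.IsChain G.Adj := by
  induction l with
  | nil => exact List.IsChain.nil
  | cons a l ih =>
    cases l with
    | nil => exact List.IsChain.singleton a
    | cons b l =>
      exact List.IsChain.cons_cons (h.adj (by simp))
        (ih (h.mono (by simpa using Multiset.le_cons_self _ _)))

/-! ### Short closed trails -/

theorem exists_eq_append_of_not_nodup {l : List V} (h : ¬ l.Nodup) :
    ∃ p x q r, l = p ++ x :: q ++ x :: r := by
  induction l with
  | nil => simp at h
  | cons a l ih =>
    by_cases hl : l.Nodup
    · have ha : a ∈ l := by
        by_contra ha
        exact h (List.nodup_cons.2 ⟨ha, hl⟩)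
      obtain ⟨q, r, rfl⟩ := List.append_of_mem ha
      exact ⟨[], a, q, r, by simp⟩
    · obtain ⟨p, x, q, r, rfl⟩ := ih hl
      exact ⟨a :: p, x, q, r, by simp⟩

theorem exists_walk_support_eq {a b : V} {l : List V} (hc : (a :: l).IsChain G.Adj)
    (hb : (a :: l).getLast? = some b) : ∃ w : G.Walk a b, w.support = a :: l := by
  induction l generalizing a with
  | nil =>
    obtain rfl : a = b := by simpa using hb
    exact ⟨.nil, rfl⟩
  | cons c l ih =>
    obtain ⟨w, hw⟩ := ih hc.of_cons (by simpa using hb)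
    exact ⟨.cons hc.rel w, by simp [hw]⟩

theorem egirth_le_length_of_nodup {a b : V} {l : List V} (hn : (a :: l ++ [b]).Nodup)
    (hc : (a :: l ++ [b]).IsChain G.Adj) (hl : l ≠ []) (hab : G.Adj b a) :
    G.egirth ≤ (l.length + 2 : ℕ) := by
  classical
  obtain ⟨w, hs⟩ := exists_walk_support_eq hc (b := b) (by simp [List.getLast?_cons])
  have hlen : w.length = l.length + 1 := by
    have := w.length_support
    rw [hs] at this
    simpa using this.symm
  have hw : w.IsPath := by
    rw [SimpleGraph.Walk.isPath_def, hs]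
    exact hn
  have hcyc : (SimpleGraph.Walk.cons hab w).IsCycle := by
    rw [SimpleGraph.Walk.cons_isCycle_iff]
    refine ⟨hw, fun hmem => ?_⟩
    have := List.length_pos_iff.2 hl
    rw [Sym2.eq_swap] at hmem
    have := hw.length_eq_one_of_mem_edges hmem
    omega
  have := SimpleGraph.egirth_le_length hcyc
  rwa [SimpleGraph.Walk.length_cons, hlen] at this

/-- A closed trail is at least as long as the girth. -/
theorem le_length_of_closed_trail {g : ℕ} (hg : (g : ℕ∞) ≤ G.egirth) (a : V) (l : List V)
    (h : EdgeDistinct G (pathEdges (a :: l ++ [a]))) : g ≤ l.length + 1 := by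
  induction hn : l.length using Nat.strong_induction_on generalizing a l with
  | _ n ih =>
    subst hn
    by_cases hnd : (a :: l).Nodup
    · rcases List.eq_nil_or_concat l with rfl | ⟨l', b, rfl⟩
      · exact absurd (h.adj (a := a) (b := a) (by simp)) (G.loopless.irrefl a)
      · rw [List.concat_eq_append] at *
        have hl' : l' ≠ [] := by
          rintro rfl
          have := h.1
          simp [Sym2.eq_swap] at this
        have hp : EdgeDistinct G (pathEdges (a :: l' ++ [b])) :=
          h.mono (by simpa using pathEdges_le_append_left (a :: l' ++ [b]) [a])
        have hba : G.Adj b a := h.adj (by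
          have := pathEdges_concat_concat (a :: l') b a
          simp only [List.cons_append, List.append_assoc, List.nil_append] at *
          rw [this]; simp)
        have := hg.trans (egirth_le_length_of_nodup (by simpa using hnd) hp.isChain hl' hba)
        have := ENat.natCast_le_natCast.1 this
        simpa using this
    · obtain ⟨p, x, q, r, hpq⟩ := exists_eq_append_of_not_nodup hnd
      have hlen : q.length < l.length := by
        have := congrArg List.length hpq
        simp at this
        omega
      have := ih q.length hlen x q (h.mono (pathEdges_le_of_infix ⟨p, r ++ [a], by
        rw [hpq]; simp⟩)) rfl
      omega

/-- Two occurrences of a vertex on a trail are at least the girth apart. -/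
theorem le_length_of_trail {g : ℕ} (hg : (g : ℕ∞) ≤ G.egirth) {p q r : List V} {x : V}
    (h : EdgeDistinct G (pathEdges (p ++ x :: q ++ x :: r))) : g ≤ q.length + 1 :=
  le_length_of_closed_trail hg x q (h.mono (pathEdges_le_of_infix ⟨p, r, by simp⟩))


/-! ### Deciding configurations of two short paths

For `k = 3` the paths are short, so that the ways in which two of them can meet form a short list.
A configuration is described by labels below `16`: the vertices of the first path are
`0, 1, …`, and the vertex number `j` of the second path has either the label of a vertex of the
first path or the new label `8 + j`. -/

/-- The edge between two labels below `16`, as a number. -/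
def edgeCode (x y : ℕ) : ℕ := if Nat.ble x y then 16 * x + y else 16 * y + x

/-- The edges of a list of labels, read as a walk. -/
def edgeCodes : List ℕ → List ℕ
  | a :: b :: l => edgeCode a b :: edgeCodes (b :: l)
  | _ => []

/-- Membership in a list of numbers, in a form that the kernel evaluates quickly. -/
def memB (a : ℕ) (l : List ℕ) : Bool := l.any (Nat.beq a)

/-- A binary digit of a number, in a form that the kernel evaluates quickly. -/
def bitB (m n : ℕ) : Bool := Nat.beq (Nat.land 1 (Nat.shiftRight m n)) 1

/-- The number whose binary digits mark the members of a list. -/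
def mask : List ℕ → ℕ
  | [] => 0
  | a :: l => Nat.lor (Nat.pow 2 a) (mask l)

/-- Whether the members of a list are distinct and not marked in `m`. -/
def nodupB : List ℕ → ℕ → Bool
  | [], _ => true
  | a :: l, m => !bitB m a && nodupB l (Nat.lor (Nat.pow 2 a) m)

/-- The number whose digits mark the pairs `(x, y)` and `(y, x)`. -/
def edgeBits (x y : ℕ) : ℕ := Nat.lor (Nat.pow 2 (16 * x + y)) (Nat.pow 2 (16 * y + x))

/-- The number whose digits mark the edges of a list of labels, read as a walk. -/
def walkBits : List ℕ → ℕ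
  | a :: b :: l => Nat.lor (edgeBits a b) (walkBits (b :: l))
  | _ => 0

/-- Whether the new edge `yx` repeats an edge marked in `M` or closes a triangle with two edges
marked in `M`. -/
def badEdge (M y x : ℕ) : Bool :=
  bitB M (16 * y + x) || !Nat.beq (Nat.land (Nat.land (Nat.shiftRight M (16 * x))
    (Nat.shiftRight M (16 * y))) 65535) 0

/-- Test `leaf` on all continuations of the path `acc` (in reverse order) by labels from the lists
`cands`, leaving out those that repeat a vertex or an edge or close a triangle; `M` marks the edges
that are present already. -/
def search (leaf : List ℕ → Bool) : List (List ℕ) → List ℕ → ℕ → Bool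
  | [], acc, _ => leaf acc.reverse
  | cs :: cands, acc, M => cs.all fun x =>
      memB x acc || badEdge M (acc.headD 0) x ||
        search leaf cands (x :: acc) (Nat.lor (edgeBits (acc.headD 0) x) M)

/-- Templates name a vertex of the first path by its position and the vertex number `j` of the
second path by `8 + j`; this looks up the label of a vertex. -/
def templateLabel (B : List ℕ) (s : ℕ) : ℕ := bif Nat.ble 8 s then B.getD (s - 8) 0 else s

/-- Whether the edges `E` are those of the two paths `P` and `Q`, where `S` holds all labels in use
and `spec` is the requirement on the two paths. -/
def splitOk (S E : List ℕ) (spec : List ℕ → List ℕ → Bool) (P Q : List ℕ) : Bool :=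
  nodupB P 0 && nodupB Q 0 && (edgeCodes P ++ edgeCodes Q).all (bitB (mask E)) &&
    nodupB (edgeCodes P ++ edgeCodes Q) 0 &&
    (P.all (bitB (mask S)) && Q.all (bitB (mask S)) &&
      Nat.ble E.length (edgeCodes P ++ edgeCodes Q).length && spec P Q)

/-- Whether one of the templates splits the edges `E` into two paths. -/
def splits (nA : ℕ) (spec : List ℕ → List ℕ → Bool) (E : List ℕ)
    (T : List (List ℕ × List ℕ)) (B : List ℕ) : Bool :=
  T.any fun t => splitOk (List.range nA ++ B) E spec (t.1.map (templateLabel B))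
    (t.2.map (templateLabel B))

/-- The possible labels of the vertices `1, …, n` of the second path. -/
def candidates (nA n : ℕ) : List (List ℕ) :=
  (List.range n).map fun j => List.range nA ++ [8 + (j + 1)]

theorem memB_iff {a : ℕ} {l : List ℕ} : memB a l = true ↔ a ∈ l := by
  simp [memB]

theorem bitB_eq (m n : ℕ) : bitB m n = m.testBit n := by
  have h : Nat.land 1 (Nat.shiftRight m n) = (m >>> n) % 2 := by
    rw [← Nat.one_and_eq_mod_two]
    rfl
  rw [bitB, h, Nat.testBit_eq_decide_div_mod_eq, Nat.shiftRight_eq_div_pow]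
  by_cases hb : m / 2 ^ n % 2 = 1
  · simp [hb]
  · have : m / 2 ^ n % 2 = 0 := by omega
    simp only [this, Nat.zero_ne_one, decide_false]
    rfl

theorem bitB_lor_pow (m a n : ℕ) :
    bitB (Nat.lor (Nat.pow 2 a) m) n = true ↔ n = a ∨ bitB m n = true := by
  have h : Nat.lor (Nat.pow 2 a) m = 2 ^ a ||| m := rfl
  rw [h, bitB_eq, bitB_eq, Nat.testBit_or, Nat.testBit_two_pow, Bool.or_eq_true,
    decide_eq_true_iff, eq_comm]

theorem bitB_zero (n : ℕ) : bitB 0 n = false := by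
  simp [bitB_eq]

theorem bitB_mask {l : List ℕ} {n : ℕ} : bitB (mask l) n = true ↔ n ∈ l := by
  induction l with
  | nil => simp [mask, bitB_zero]
  | cons a l ih => rw [mask, bitB_lor_pow, ih, List.mem_cons]

theorem nodup_of_nodupB {l : List ℕ} {m : ℕ} (h : nodupB l m = true) :
    l.Nodup ∧ ∀ a ∈ l, bitB m a = false := by
  induction l generalizing m with
  | nil => simp
  | cons a l ih =>
    rw [nodupB, Bool.and_eq_true, Bool.not_eq_true'] at h
    obtain ⟨h1, h2⟩ := ih h.2
    have h3 : ∀ b ∈ l, b ≠ a ∧ bitB m b = false := fun b hb => by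
      have h4 := h2 b hb
      rw [← Bool.not_eq_true, bitB_lor_pow, not_or, Bool.not_eq_true] at h4
      exact h4
    refine ⟨List.nodup_cons.2 ⟨fun ha => (h3 a ha).1 rfl, h1⟩, fun b hb => ?_⟩
    rcases List.mem_cons.1 hb with rfl | hb
    · exact h.1
    · exact (h3 b hb).2

theorem bitB_edgeBits_lor {x y p q M : ℕ} (hx : x < 16) (hy : y < 16) (hq : q < 16)
    (h : bitB (Nat.lor (edgeBits x y) M) (16 * p + q) = true) :
    (p = x ∧ q = y) ∨ (p = y ∧ q = x) ∨ bitB M (16 * p + q) = true := by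
  have h' : Nat.lor (edgeBits x y) M =
      Nat.lor (Nat.pow 2 (16 * x + y)) (Nat.lor (Nat.pow 2 (16 * y + x)) M) := Nat.or_assoc _ _ _
  rw [h', bitB_lor_pow, bitB_lor_pow] at h
  rcases h with h | h | h
  · exact Or.inl ⟨by omega, by omega⟩
  · exact Or.inr (Or.inl ⟨by omega, by omega⟩)
  · exact Or.inr (Or.inr h)

/-- The digits of `M` mark only edges from `s`, under an assignment of vertices to labels. -/
def Marks (v : ℕ → V) (M : ℕ) (s : Multiset (Sym2 V)) : Prop :=
  ∀ p q, p < 16 → q < 16 → bitB M (16 * p + q) = true → s(v p, v q) ∈ s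

theorem Marks.lor_edgeBits {v : ℕ → V} {M : ℕ} {s : Multiset (Sym2 V)} (h : Marks v M s) {x y : ℕ}
    (hx : x < 16) (hy : y < 16) : Marks v (Nat.lor (edgeBits x y) M) (s(v x, v y) ::ₘ s) := by
  intro p q hp hq hpq
  rcases bitB_edgeBits_lor hx hy hq hpq with ⟨rfl, rfl⟩ | ⟨rfl, rfl⟩ | h'
  · simp
  · simp [Sym2.eq_swap]
  · exact Multiset.mem_cons_of_mem (h p q hp hq h')

theorem marks_walkBits (v : ℕ → V) {l : List ℕ} (hl : ∀ x ∈ l, x < 16) :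
    Marks v (walkBits l) (pathEdges (l.map v)) := by
  induction l with
  | nil => exact fun p q _ _ h => by simp [walkBits, bitB_zero] at h
  | cons a l ih =>
    cases l with
    | nil => exact fun p q _ _ h => by simp [walkBits, bitB_zero] at h
    | cons b l =>
      have := ih fun x hx => hl x (List.mem_cons_of_mem _ hx)
      exact this.lor_edgeBits (hl a (by simp)) (hl b (by simp))

/-- The edge that a number stands for, under an assignment of vertices to labels. -/
def decodeEdge (v : ℕ → V) (c : ℕ) : Sym2 V := s(v (c / 16), v (c % 16))

theorem decodeEdge_edgeCode (v : ℕ → V) {x y : ℕ} (hx : x < 16) (hy : y < 16) :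
    decodeEdge v (edgeCode x y) = s(v x, v y) := by
  unfold edgeCode decodeEdge
  split
  · have h1 : (16 * x + y) / 16 = x := by omega
    have h2 : (16 * x + y) % 16 = y := by omega
    rw [h1, h2]
  · have h1 : (16 * y + x) / 16 = y := by omega
    have h2 : (16 * y + x) % 16 = x := by omega
    rw [h1, h2, Sym2.eq_swap]

theorem map_decodeEdge_edgeCodes (v : ℕ → V) {l : List ℕ} (hl : ∀ x ∈ l, x < 16) :
    ((edgeCodes l).map (decodeEdge v) : Multiset (Sym2 V)) = pathEdges (l.map v) := by
  induction l with
  | nil => rfl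
  | cons a l ih =>
    cases l with
    | nil => rfl
    | cons b l =>
      have ih' := ih fun x hx => hl x (List.mem_cons_of_mem _ hx)
      simp only [edgeCodes, List.map_cons, pathEdges_cons_cons] at ih' ⊢
      rw [← ih', decodeEdge_edgeCode v (hl a (by simp)) (hl b (by simp))]
      rfl

/-- A graph without triangles. -/
def TriangleFree (G : SimpleGraph V) : Prop := ∀ a b c, G.Adj a b → G.Adj b c → ¬ G.Adj c a

theorem badEdge_eq_false (htf : TriangleFree G) (v : ℕ → V) {M : ℕ} {s : Multiset (Sym2 V)}
    {x y : ℕ} (hM : Marks v M s) (hx : x < 16) (hy : y < 16)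
    (h : EdgeDistinct G (s(v y, v x) ::ₘ s)) : badEdge M y x = false := by
  rw [← Bool.not_eq_true]
  intro hb
  rw [badEdge, Bool.or_eq_true, Bool.not_eq_true', ← Bool.not_eq_true, Nat.beq_eq] at hb
  rcases hb with hb | hb
  · exact (Multiset.nodup_cons.1 h.1).1 (hM y x hy hx hb)
  · -- a common digit of the rows of `x` and `y` is the third vertex of a triangle
    have key : ∃ z, z < 16 ∧ bitB M (16 * x + z) = true ∧ bitB M (16 * y + z) = true := by
      have hb' : ((M >>> (16 * x)) &&& (M >>> (16 * y))) &&& 65535 ≠ 0 := hb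
      obtain ⟨z, hz⟩ := Nat.exists_testBit_of_ne_zero hb'
      have h1 : (65535 : ℕ) = 2 ^ 16 - 1 := by norm_num
      rw [h1, Nat.testBit_and, Nat.testBit_and, Nat.testBit_two_pow_sub_one,
        Nat.testBit_shiftRight, Nat.testBit_shiftRight] at hz
      simp only [Bool.and_eq_true, decide_eq_true_eq] at hz
      exact ⟨z, hz.2, by rw [bitB_eq]; exact hz.1.1, by rw [bitB_eq]; exact hz.1.2⟩
    obtain ⟨z, hz, h1, h2⟩ := key
    have hs : ∀ {a b : V}, s(a, b) ∈ s → G.Adj a b := fun hab =>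
      h.adj (Multiset.mem_cons_of_mem hab)
    exact htf _ _ _ (h.adj (Multiset.mem_cons_self _ _)) (hs (hM x z hx hz h1))
      (hs (hM y z hy hz h2)).symm

/-- A path that is compatible with the edges present already is not left out by the search. -/
theorem leaf_of_search (htf : TriangleFree G) (v : ℕ → V) {leaf : List ℕ → Bool}
    {cands : List (List ℕ)} {y M : ℕ} {acc rest : List ℕ} {s : Multiset (Sym2 V)}
    (hM : Marks v M s) (hlt : ∀ x ∈ acc.reverse ++ y :: rest, x < 16)
    (hnd : (acc.reverse ++ y :: rest).Nodup)
    (hc : List.Forall₂ (fun x cs => x ∈ cs) rest cands)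
    (hed : EdgeDistinct G (s + pathEdges ((y :: rest).map v)))
    (h : search leaf cands (y :: acc) M = true) : leaf (acc.reverse ++ y :: rest) = true := by
  induction hc generalizing y acc M s with
  | nil => simpa [search] using h
  | @cons x cs rest cands hx hc ih =>
    simp only [search, List.all_eq_true, List.headD_cons] at h
    have h := h x hx
    have hy16 : y < 16 := hlt y (by simp)
    have hx16 : x < 16 := hlt x (by simp)
    have hbad : badEdge M y x = false := by
      refine badEdge_eq_false htf v hM hx16 hy16 (hed.mono ?_)
      simp only [List.map_cons, pathEdges_cons_cons]
      rw [Multiset.add_cons]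
      exact Multiset.cons_le_cons _ (Multiset.le_add_right _ _)
    have hmem : memB x (y :: acc) = false := by
      rw [← Bool.not_eq_true, memB_iff]
      intro hmem
      have h1 : (acc.reverse ++ [y] ++ x :: rest).Nodup := by simpa using hnd
      exact (List.nodup_append.1 h1).2.2 x (by simpa [or_comm] using hmem) x (by simp) rfl
    rw [hbad, hmem, Bool.or_false, Bool.false_or] at h
    have := ih (y := x) (acc := y :: acc) (hM.lor_edgeBits hy16 hx16)
      (by simpa using hlt) (by simpa using hnd)
      (by
        refine hed.mono (le_of_eq ?_)
        simp only [List.map_cons, pathEdges_cons_cons]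
        rw [Multiset.add_cons, Multiset.cons_add]) h
    simpa using this

/-- A template that fits gives two paths in the graph. -/
theorem exists_split_of_splits (v : ℕ → V) {nA : ℕ} {spec : List ℕ → List ℕ → Bool}
    {E B : List ℕ} {T : List (List ℕ × List ℕ)} (hnA : nA ≤ 8) (hB : ∀ x ∈ B, x < 16)
    (hinj : Set.InjOn v {x | x < nA ∨ x ∈ B}) (h : splits nA spec E T B = true) :
    ∃ P Q : List ℕ, (P.map v).Nodup ∧ (Q.map v).Nodup ∧
      pathEdges (P.map v) + pathEdges (Q.map v) = (E.map (decodeEdge v) : Multiset (Sym2 V)) ∧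
      spec P Q = true := by
  rw [splits, List.any_eq_true] at h
  obtain ⟨t, -, h⟩ := h
  generalize t.1.map (templateLabel B) = P at h
  generalize t.2.map (templateLabel B) = Q at h
  simp only [splitOk, Bool.and_eq_true, List.all_eq_true, bitB_mask, Nat.ble_eq] at h
  obtain ⟨⟨⟨⟨hP, hQ⟩, hsub⟩, hnd⟩, ⟨⟨hPS, hQS⟩, hlen⟩, hspec⟩ := h
  replace hP := (nodup_of_nodupB hP).1
  replace hQ := (nodup_of_nodupB hQ).1
  replace hPS : ∀ x ∈ P, x < nA ∨ x ∈ B := fun x hx => by simpa using hPS x hx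
  replace hQS : ∀ x ∈ Q, x < nA ∨ x ∈ B := fun x hx => by simpa using hQS x hx
  have hperm : (edgeCodes P ++ edgeCodes Q).Perm E :=
    ((nodup_of_nodupB hnd).1.subperm hsub).perm_of_length_le hlen
  have hlt : ∀ x, x < nA ∨ x ∈ B → x < 16 := by
    rintro x (hx | hx)
    · omega
    · exact hB x hx
  refine ⟨P, Q, hP.map_on fun x hx y hy hxy => hinj (hPS x hx) (hPS y hy) hxy,
    hQ.map_on fun x hx y hy hxy => hinj (hQS x hx) (hQS y hy) hxy, ?_, hspec⟩
  rw [← map_decodeEdge_edgeCodes v fun x hx => hlt x (hPS x hx),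
    ← map_decodeEdge_edgeCodes v fun x hx => hlt x (hQS x hx), Multiset.coe_add,
    ← List.map_append]
  exact Multiset.coe_eq_coe.2 (hperm.map _)

/-- The vertices of two paths can be labelled as described at the beginning of this part: `v` maps
labels to vertices, and `L` is the list of labels of the second path. -/
theorem exists_labelling {A B : List V} (hA : A.Nodup) (hB : B.Nodup) (hAl : A.length ≤ 8)
    (hA0 : A ≠ []) : ∃ (v : ℕ → V) (L : List ℕ), A = (List.range A.length).map v ∧
      B = L.map v ∧ Set.InjOn v {x | x < A.length ∨ x ∈ L} ∧ L.Nodup ∧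
      ∀ j (h : j < L.length), L[j] < A.length ∨ L[j] = 8 + j := by
  classical
  obtain ⟨d, -⟩ := List.exists_mem_of_ne_nil A hA0
  let v : ℕ → V := fun x => if x < 8 then A.getD x d else B.getD (x - 8) d
  let f : ℕ → ℕ := fun j => if B.getD j d ∈ A then A.idxOf (B.getD j d) else 8 + j
  let L : List ℕ := (List.range B.length).map f
  have hvA : ∀ x (hx : x < A.length), v x = A[x] := fun x hx => by
    have : x < 8 := by omega
    simp [v, this, hx]
  have hvB : ∀ j (hj : j < B.length), v (8 + j) = B[j] := fun j hj => by
    simp [v, hj]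
  have hf : ∀ j (hj : j < B.length), f j < A.length ∧ v (f j) = B[j] ∨
      f j = 8 + j ∧ v (f j) = B[j] ∧ B[j] ∉ A := fun j hj => by
    by_cases hm : B[j] ∈ A
    · left
      have h1 : f j = A.idxOf B[j] := by simp [f, hj, hm]
      have h2 : A.idxOf B[j] < A.length := List.idxOf_lt_length_iff.2 hm
      rw [h1, hvA _ h2]
      exact ⟨h2, List.getElem_idxOf h2⟩
    · right
      have h1 : f j = 8 + j := by simp [f, hj, hm]
      rw [h1, hvB j hj]
      exact ⟨rfl, rfl, hm⟩
  have hinj : Set.InjOn v {x | x < A.length ∨ x ∈ L} := by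
    have key : ∀ x, x < A.length ∨ x ∈ L → (∃ h : x < A.length, v x = A[x]) ∨
        ∃ j, ∃ h : j < B.length, x = 8 + j ∧ v x = B[j] ∧ B[j] ∉ A := by
      rintro x (hx | hx)
      · exact Or.inl ⟨hx, hvA x hx⟩
      · obtain ⟨j, hj, rfl⟩ := List.mem_map.1 hx
        rw [List.mem_range] at hj
        rcases hf j hj with ⟨h1, -⟩ | h1
        · exact Or.inl ⟨h1, hvA _ h1⟩
        · exact Or.inr ⟨j, hj, h1⟩
    intro x hx y hy hxy
    rcases key x hx with ⟨hx, hx'⟩ | ⟨i, hi, hx, hx', hx''⟩ <;>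
    rcases key y hy with ⟨hy, hy'⟩ | ⟨j, hj, hy, hy', hy''⟩
    · rw [hx', hy'] at hxy
      exact (hA.getElem_inj_iff).1 hxy
    · rw [hx', hy'] at hxy
      exact absurd (hxy ▸ List.getElem_mem hx) hy''
    · rw [hx', hy'] at hxy
      exact absurd (hxy ▸ List.getElem_mem hy) hx''
    · rw [hx', hy'] at hxy
      rw [hx, hy, (hB.getElem_inj_iff).1 hxy]
  have hAeq : A = (List.range A.length).map v := by
    refine List.ext_getElem (by simp) fun i h1 h2 => ?_
    simp [hvA i h1]
  have hBeq : B = L.map v := by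
    refine List.ext_getElem (by simp [L]) fun i h1 h2 => ?_
    simp only [L, List.getElem_map, List.getElem_range]
    rcases hf i h1 with h | h
    · exact h.2.symm
    · exact h.2.1.symm
  refine ⟨v, L, hAeq, hBeq, hinj, ?_, fun j hj => ?_⟩
  · rw [hBeq] at hB
    exact hB.of_map
  · have hj' : j < B.length := by simpa [L] using hj
    simp only [L, List.getElem_map, List.getElem_range]
    rcases hf j hj' with h | h
    · exact Or.inl h.1
    · exact Or.inr h.1

theorem forall₂_candidates {y nA : ℕ} {L : List ℕ}
    (h : ∀ j (h : j < (y :: L).length), (y :: L)[j] < nA ∨ (y :: L)[j] = 8 + j) :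
    List.Forall₂ (fun x cs => x ∈ cs) L (candidates nA L.length) := by
  rw [List.forall₂_iff_get]
  refine ⟨by simp [candidates], fun i h1 h2 => ?_⟩
  have := h (i + 1) (by simpa using h1)
  simpa [candidates, add_assoc] using this


/-! ### Templates for paths of five and six edges -/

/-- Templates for two closed paths of six edges through the label `0`. -/
def closedTemplates : List (List ℕ × List ℕ) :=
  [([9, 0, 5, 4, 3, 2, 1], [1, 0, 13, 12, 11, 10, 9]),
   ([13, 0, 1, 2, 3, 4, 5], [5, 0, 9, 10, 11, 12, 13]),
   ([12, 3, 0, 9, 10, 1, 2], [2, 3, 4, 5, 0, 1, 12]),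
   ([4, 5, 0, 1, 2, 3, 10], [4, 3, 0, 13, 12, 11, 10])]

/-- Templates for a closed path of six edges and a path of five edges that starts at the label `0`. -/
def mergeTemplates : List (List ℕ × List ℕ) :=
  [([0, 1, 2, 3, 4, 5], [5, 0, 9, 10, 11, 12, 13]),
   ([1, 2, 3, 4, 5, 0], [1, 0, 9, 10, 11, 12, 13]),
   ([0, 1, 2, 3, 4, 5, 12], [5, 0, 9, 10, 11, 12]),
   ([12, 1, 2, 3, 4, 5, 0], [1, 0, 9, 10, 11, 12])]

/-- Templates for a closed path of six edges and a path of six edges whose first vertex on the closed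
path has the label `0`, sorted by the position of this vertex. -/
def absorbTemplates : List (List (List ℕ × List ℕ)) :=
  [[([14, 13, 12, 11, 10, 9, 0, 1], [1, 2, 3, 4, 5, 0]),
    ([0, 1, 2, 3, 4, 5], [5, 0, 9, 10, 11, 12, 13, 14]),
    ([13, 5, 4, 3, 2, 1, 0], [5, 0, 9, 10, 11, 12, 13]),
    ([0, 5, 4, 3, 2, 1, 13], [1, 0, 9, 10, 11, 12, 13]),
    ([12, 11, 10, 9, 0, 1, 14], [0, 5, 4, 3, 2, 1, 12]),
    ([12, 11, 10, 9, 0, 5, 14], [0, 1, 2, 3, 4, 5, 12])],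
   [([5, 4, 3, 2, 1, 0, 8], [5, 0, 10, 11, 12, 13, 14]),
    ([1, 2, 3, 4, 5, 0, 8], [1, 0, 10, 11, 12, 13, 14]),
    ([5, 0, 10, 11, 12, 13], [8, 0, 1, 2, 3, 4, 5, 13]),
    ([13, 1, 2, 3, 4, 5, 0, 8], [1, 0, 10, 11, 12, 13])],
   [([1, 0, 11, 12, 13, 14], [1, 2, 3, 4, 5, 0, 9, 8]),
    ([5, 0, 11, 12, 13, 14], [5, 4, 3, 2, 1, 0, 9, 8])],
   [([8, 9, 10, 0, 5, 4, 3, 2], [2, 1, 0, 12, 13, 14]),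
    ([4, 3, 2, 1, 0, 10, 9, 8], [4, 5, 0, 12, 13, 14]),
    ([8, 9, 10, 0, 1, 2, 5, 4], [4, 3, 2, 12, 0, 5]),
    ([12, 0, 5, 4, 3, 2, 1], [8, 9, 10, 0, 1, 13, 12])],
   [([3, 2, 1, 0, 11, 10, 9, 8], [3, 4, 5, 0, 13, 14]),
    ([3, 2, 1, 0, 5, 4], [4, 3, 13, 12, 11, 10, 9, 8]),
    ([8, 9, 10, 11, 12, 3, 2, 1], [1, 0, 5, 4, 3, 14]),
    ([14, 13, 0, 1, 2, 3], [3, 4, 5, 0, 11, 10, 9, 8])],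
   [([3, 2, 1, 0, 5, 4], [4, 3, 13, 12, 11, 10, 9, 8]),
    ([5, 0, 12, 11, 10, 9, 8], [5, 4, 3, 2, 1, 0, 14])],
   [([1, 0, 13, 12, 11, 10, 9, 8], [1, 2, 3, 4, 5, 0])]]

/-- Templates for two linked paths of five edges, sorted by the label of the first vertex of the
second path. -/
def linkTemplatesSixSix : List (List (List ℕ × List ℕ)) :=
  [[],
   [],
   [],
   [([5, 4, 3, 0, 1, 2], [2, 3, 9, 10, 11, 12, 13]),
    ([5, 4, 3, 2, 1, 0, 10], [10, 9, 3, 0, 12, 13]),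
    ([5, 4, 3, 0, 1, 2, 10], [10, 9, 3, 2, 12, 13]),
    ([10, 9, 3, 0, 12, 2, 1], [1, 0, 5, 4, 3, 2]),
    ([12, 0, 1, 2, 3, 4, 5], [0, 3, 9, 10, 11, 12])],
   [([3, 2, 1, 0, 4, 5], [3, 4, 9, 10, 11, 12, 13]),
    ([5, 4, 3, 12, 11, 10], [3, 2, 1, 0, 4, 9, 10]),
    ([5, 4, 0, 12, 11, 10, 9], [0, 1, 2, 3, 4, 9])],
   [([4, 3, 2, 1, 0, 5], [4, 5, 9, 10, 11, 12, 13]),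
    ([1, 2, 3, 4, 12, 0, 5], [1, 0, 10, 9, 5, 4]),
    ([3, 4, 10, 9, 5, 0], [3, 2, 1, 0, 12, 4, 5])]]

/-- Templates for linked paths of six and five edges, sorted by the label of the first vertex of the
second path. -/
def linkTemplatesSevenSix : List (List (List ℕ × List ℕ)) :=
  [[],
   [],
   [],
   [([6, 5, 4, 3, 0, 1, 2], [2, 3, 9, 10, 11, 12, 13]),
    ([10, 0, 1, 2, 3, 4, 5, 6], [10, 9, 3, 0, 12, 13]),
    ([10, 9, 3, 2, 12, 13], [6, 5, 4, 3, 0, 1, 2, 10]),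
    ([6, 5, 4, 3, 0, 1, 2, 12], [2, 3, 9, 10, 11, 12]),
    ([12, 11, 10, 9, 3, 0], [6, 5, 4, 3, 2, 1, 0, 12])],
   [([6, 5, 4, 0, 1, 2, 3], [3, 4, 9, 10, 11, 12, 13]),
    ([6, 5, 4, 3, 2, 1, 0, 10], [10, 9, 4, 0, 12, 13]),
    ([2, 1, 0, 12, 3, 4, 5, 6], [2, 3, 10, 9, 4, 0]),
    ([10, 0, 1, 2, 3, 4, 5], [5, 6, 9, 4, 0, 12, 13]),
    ([9, 10, 11, 6, 5, 4, 0], [9, 4, 3, 2, 1, 0, 12])],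
   [([4, 3, 2, 1, 0, 5, 6], [4, 5, 9, 10, 11, 12, 13]),
    ([1, 2, 3, 4, 12, 0, 5, 6], [1, 0, 10, 9, 5, 4]),
    ([12, 0, 1, 2, 3, 4, 5, 6], [0, 5, 9, 10, 11, 12])],
   [([6, 0, 1, 2, 3, 4, 5], [5, 6, 9, 10, 11, 12, 13]),
    ([1, 2, 3, 4, 5, 12, 0, 6], [1, 0, 10, 9, 6, 5]),
    ([4, 3, 2, 1, 0, 12, 5, 6], [4, 5, 10, 9, 6, 0])]]

/-- Templates for two linked paths of six edges, sorted by the label of the first vertex of the second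
path. -/
def linkTemplatesSevenSeven : List (List (List ℕ × List ℕ)) :=
  [[],
   [],
   [],
   [([6, 5, 4, 3, 0, 1, 2], [2, 3, 9, 10, 11, 12, 13, 14]),
    ([10, 9, 3, 2, 12, 13, 14], [6, 5, 4, 3, 0, 1, 2, 10]),
    ([14, 13, 12, 0, 3, 9, 10], [6, 5, 4, 3, 2, 1, 0, 10]),
    ([14, 13, 0, 3, 9, 10, 11], [6, 5, 4, 3, 2, 1, 0, 11]),
    ([6, 5, 4, 3, 0, 1, 2, 11], [11, 10, 9, 3, 2, 13, 14]),
    ([12, 11, 10, 9, 3, 2, 14], [6, 5, 4, 3, 0, 1, 2, 12]),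
    ([13, 0, 1, 2, 3, 4, 5, 6], [0, 3, 9, 10, 11, 12, 13]),
    ([2, 3, 9, 10, 11, 12, 13], [6, 5, 4, 3, 0, 1, 2, 13]),
    ([6, 5, 4, 3, 2, 12, 0, 1], [1, 2, 10, 9, 3, 0, 14]),
    ([0, 1, 2, 3, 9, 6, 5, 4], [4, 3, 0, 13, 12, 11, 10]),
    ([4, 3, 0, 1, 2, 5, 6], [4, 5, 9, 3, 2, 12, 13, 14]),
    ([14, 13, 12, 0, 3, 9, 5, 4], [4, 3, 2, 1, 0, 5, 6]),
    ([6, 5, 2, 1, 0, 3, 4], [2, 3, 9, 10, 11, 12, 5, 4])],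
   [([14, 13, 12, 11, 10, 9, 4, 3], [3, 2, 1, 0, 4, 5, 6]),
    ([13, 0, 1, 2, 3, 4, 5, 6], [0, 4, 9, 10, 11, 12, 13]),
    ([3, 4, 9, 10, 11, 12, 13], [6, 5, 4, 0, 1, 2, 3, 13]),
    ([14, 13, 12, 0, 4, 9, 10], [6, 5, 4, 3, 2, 1, 0, 10]),
    ([6, 5, 4, 0, 1, 2, 3, 10], [10, 9, 4, 3, 12, 13, 14]),
    ([6, 5, 4, 3, 2, 1, 0, 11], [11, 10, 9, 4, 0, 13, 14]),
    ([13, 3, 2, 1, 0, 4, 9], [9, 10, 11, 3, 4, 5, 6, 14]),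
    ([1, 2, 3, 10, 9, 4, 0, 14], [1, 0, 12, 3, 4, 5, 6]),
    ([10, 0, 1, 2, 3, 4, 9], [9, 6, 5, 4, 0, 12, 13, 14])],
   [([14, 13, 12, 11, 10, 9, 5, 4], [4, 3, 2, 1, 0, 5, 6]),
    ([13, 4, 3, 2, 1, 0, 5, 6], [4, 5, 9, 10, 11, 12, 13]),
    ([13, 12, 11, 10, 9, 5, 0], [6, 5, 4, 3, 2, 1, 0, 13]),
    ([6, 5, 0, 1, 2, 3, 4, 12], [12, 11, 10, 9, 5, 4, 14]),
    ([6, 5, 4, 3, 2, 1, 0, 12], [12, 11, 10, 9, 5, 0, 14])],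
   [([6, 0, 1, 2, 3, 4, 5], [5, 6, 9, 10, 11, 12, 13, 14]),
    ([0, 6, 9, 10, 11, 12, 13], [6, 5, 4, 3, 2, 1, 0, 13]),
    ([13, 12, 11, 10, 9, 6, 5], [6, 0, 1, 2, 3, 4, 5, 13]),
    ([12, 11, 10, 9, 6, 0, 14], [6, 5, 4, 3, 2, 1, 0, 12]),
    ([6, 0, 1, 2, 3, 4, 5, 12], [12, 11, 10, 9, 6, 5, 14]),
    ([6, 5, 13, 12, 11, 10, 9], [5, 4, 3, 2, 1, 0, 6, 9]),
    ([0, 6, 5, 12, 3, 2, 1], [1, 0, 3, 4, 5, 10, 9, 8]),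
    ([10, 9, 6, 0, 12, 13, 14], [6, 5, 4, 3, 2, 1, 0, 10]),
    ([0, 1, 9, 6, 5, 12, 3, 4], [4, 5, 1, 2, 3, 0, 6])]]

/-- Whether the number of vertices of a path lies between two bounds. -/
def lengthB (lo hi : ℕ) (P : List ℕ) : Bool := Nat.ble lo P.length && Nat.ble P.length hi

/-- Whether `x` is an end of a path. -/
def endB (x : ℕ) (P : List ℕ) : Bool := Nat.beq (P.headD 16) x || Nat.beq (P.getLastD 16) x

/-- Whether the templates split two closed paths of six edges through the label `0`. -/
def closedCheck (T : List (List ℕ × List ℕ)) : Bool :=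
  search (fun L =>
      badEdge (Nat.lor (Nat.lor (edgeBits 0 5) (walkBits (List.range 6))) (walkBits L))
        (L.getLastD 0) 0 ||
      splits 6 (fun P Q => lengthB 7 7 P && lengthB 7 7 Q)
        (edgeCode (L.getLastD 0) 0 :: (edgeCode 0 5 :: edgeCodes (List.range 6) ++ edgeCodes L))
        T L)
    (candidates 6 5) [0] (Nat.lor (edgeBits 0 5) (walkBits (List.range 6)))

/-- Whether the templates split a closed path of six edges and a path of five edges that starts at
the label `0`, so that the ends of the path become ends of different paths. -/
def mergeCheck (T : List (List ℕ × List ℕ)) : Bool :=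
  search (fun L =>
      splits 6 (fun P Q => lengthB 6 7 P && lengthB 6 7 Q && endB 0 P && endB (L.getLastD 0) Q)
        (edgeCode 0 5 :: edgeCodes (List.range 6) ++ edgeCodes L) T L)
    (candidates 6 5) [0] (Nat.lor (edgeBits 0 5) (walkBits (List.range 6)))

/-- The possible labels of the vertex number `j` of the second path, if its first vertex with the
label of a vertex of the first path is the vertex number `i`, with label `0`. -/
def firstHitLabels (i j : ℕ) : List ℕ :=
  bif Nat.beq j i then [0] else bif Nat.ble j i then [8 + j] else List.range 6 ++ [8 + j]

/-- Whether the templates split a closed path of six edges and a path of six edges whose first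
vertex on the closed path has the label `0`. -/
def absorbCheck (T : List (List (List ℕ × List ℕ))) : Bool :=
  (List.range 7).all fun i => (firstHitLabels i 0).all fun b =>
    search (fun L =>
        splits 6 (fun P Q => lengthB 6 8 P && lengthB 6 8 Q)
          (edgeCode 0 5 :: edgeCodes (List.range 6) ++ edgeCodes L) (T.getD i []) L)
      ((List.range 6).map fun j => firstHitLabels i (j + 1)) [b]
      (Nat.lor (edgeBits 0 5) (walkBits (List.range 6)))

/-- Whether the templates split two paths with `nA` and `nB + 1` vertices and the edge between
their first vertices, where each path contains the first vertex of the other one; the flags say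
whether the last vertex of a path must remain an end. -/
def linkCheck (nA nB : ℕ) (fa fb : Bool) (T : List (List (List ℕ × List ℕ))) : Bool :=
  (List.range nA).all fun b => badEdge (walkBits (List.range nA)) 0 b ||
    search (fun L => !memB 0 L || (fa && Nat.beq b (nA - 1)) || (fb && Nat.beq (L.getLastD 0) 0) ||
        (fa && fb && Nat.beq (L.getLastD 0) (nA - 1)) ||
        splits nA (fun P Q => lengthB 6 8 P && lengthB 6 8 Q &&
            (!fa || endB (nA - 1) P && lengthB 6 7 P) &&
            (!fb || endB (L.getLastD 0) Q && lengthB 6 7 Q))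
          (edgeCode 0 b :: edgeCodes (List.range nA) ++ edgeCodes L) (T.getD b []) L)
      (candidates nA nB) [b] (Nat.lor (edgeBits 0 b) (walkBits (List.range nA)))

theorem closedCheck_eq : closedCheck closedTemplates = true := by decide +kernel
theorem mergeCheck_eq : mergeCheck mergeTemplates = true := by decide +kernel
theorem absorbCheck_eq : absorbCheck absorbTemplates = true := by decide +kernel
theorem linkCheck_six_six (fa fb : Bool) : linkCheck 6 5 fa fb linkTemplatesSixSix = true := by
  revert fa fb; decide +kernel
theorem linkCheck_seven_six (fb : Bool) : linkCheck 7 5 false fb linkTemplatesSevenSix = true := by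
  revert fb; decide +kernel
theorem linkCheck_seven_seven : linkCheck 7 6 false false linkTemplatesSevenSeven = true := by
  decide +kernel


/-! ### Splitting short paths -/

/-- The vertex `x` is the first or the last one of a list. -/
def IsEnd (x : V) (l : List V) : Prop := l.head? = some x ∨ l.getLast? = some x

theorem isEnd_of_endB (v : ℕ → V) {x : ℕ} {P : List ℕ} (hP : P ≠ []) (h : endB x P = true) :
    IsEnd (v x) (P.map v) := by
  rw [endB, Bool.or_eq_true, Nat.beq_eq, Nat.beq_eq] at h
  rcases h with h | h
  · left
    cases P with
    | nil => exact absurd rfl hP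
    | cons a l => simpa using congrArg v h
  · right
    rw [List.getLastD_eq_getLast?, List.getLast?_eq_some_getLast hP, Option.getD_some] at h
    rw [List.getLast?_map, List.getLast?_eq_some_getLast hP, h]
    rfl

theorem lengthB_iff {lo hi : ℕ} {P : List ℕ} :
    lengthB lo hi P = true ↔ lo ≤ P.length ∧ P.length ≤ hi := by
  simp [lengthB]

theorem Marks.lor {v : ℕ → V} {M M' : ℕ} {s s' : Multiset (Sym2 V)} (h : Marks v M s)
    (h' : Marks v M' s') : Marks v (Nat.lor M M') (s + s') := by
  intro p q hp hq hpq
  have : Nat.lor M M' = M ||| M' := rfl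
  rw [this, bitB_eq, Nat.testBit_or, Bool.or_eq_true, ← bitB_eq, ← bitB_eq] at hpq
  rw [Multiset.mem_add]
  exact hpq.imp (h p q hp hq) (h' p q hp hq)

theorem lt_sixteen_of_label {n : ℕ} {L : List ℕ} (hn : n ≤ 8) (hL : L.length ≤ 8)
    (h : ∀ j (h : j < L.length), L[j] < n ∨ L[j] = 8 + j) : ∀ x ∈ L, x < 16 := by
  intro x hx
  obtain ⟨j, hj, rfl⟩ := List.getElem_of_mem hx
  have := h j hj
  omega

theorem cycleEdges_map_range_six (v : ℕ → V) :
    cycleEdges ((List.range 6).map v) = s(v 0, v 5) ::ₘ pathEdges ((List.range 6).map v) := by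
  have := cycleEdges_eq (v 0) (v 5) [v 1, v 2, v 3, v 4]
  rw [Sym2.eq_swap] at this
  exact this

theorem marks_cycle (v : ℕ → V) :
    Marks v (Nat.lor (edgeBits 0 5) (walkBits (List.range 6)))
      (cycleEdges ((List.range 6).map v)) := by
  rw [cycleEdges_map_range_six]
  exact (marks_walkBits v (by simp; omega)).lor_edgeBits (by norm_num) (by norm_num)

theorem map_decodeEdge_cycle (v : ℕ → V) {L : List ℕ} (hL : ∀ x ∈ L, x < 16) :
    ((edgeCode 0 5 :: edgeCodes (List.range 6) ++ edgeCodes L).map (decodeEdge v) :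
      Multiset (Sym2 V)) = cycleEdges ((List.range 6).map v) + pathEdges (L.map v) := by
  rw [cycleEdges_map_range_six, List.map_append, ← Multiset.coe_add,
    map_decodeEdge_edgeCodes v hL, List.map_cons, ← Multiset.cons_coe,
    map_decodeEdge_edgeCodes v (by simp; omega),
    decodeEdge_edgeCode v (by norm_num) (by norm_num)]

theorem getLast?_map_cons (v : ℕ → V) (y : ℕ) (L : List ℕ) :
    ((y :: L).map v).getLast? = some (v ((y :: L).getLastD 0)) := by
  rw [List.getLast?_map, List.getLast?_eq_some_getLast (by simp),
    List.getLastD_eq_getLast?, List.getLast?_eq_some_getLast (by simp)]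
  rfl

/-- Two closed paths of six edges with a common vertex split into two paths of six edges. -/
theorem closed_split_six (htf : TriangleFree G) {x : V} {Z Z' : List V} (hZ : (x :: Z).Nodup)
    (hZ' : (x :: Z').Nodup) (hZl : Z.length = 5) (hZl' : Z'.length = 5)
    (h : EdgeDistinct G (cycleEdges (x :: Z) + cycleEdges (x :: Z'))) :
    ∃ P Q : List V, P.Nodup ∧ Q.Nodup ∧
      pathEdges P + pathEdges Q = cycleEdges (x :: Z) + cycleEdges (x :: Z') ∧
      P.length = 7 ∧ Q.length = 7 := by
  obtain ⟨v, L, hA, hB, hinj, hL, hlab⟩ :=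
    exists_labelling hZ hZ' (by simp [hZl]) (by simp)
  have hZl6 : (x :: Z).length = 6 := by simp [hZl]
  rw [hZl6] at hA hlab hinj
  have hLl : L.length = 6 := by
    have := congrArg List.length hB
    simpa [hZl'] using this.symm
  obtain ⟨y, L, rfl⟩ := List.exists_cons_of_length_eq_add_one hLl
  have hlt := lt_sixteen_of_label (n := 6) (by norm_num) (by omega) hlab
  have hy : y = 0 := by
    refine hinj (Or.inr (by simp)) (Or.inl (by norm_num)) ?_
    have h1 : x = v 0 := by simpa [List.range_succ_eq_map] using congrArg List.head? hA
    have h2 : x = v y := by simpa using congrArg List.head? hB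
    rw [← h1, ← h2]
  subst hy
  have hlast := getLast?_map_cons v 0 L
  have hcyc : cycleEdges (x :: Z') =
      s(v ((0 :: L).getLastD 0), v 0) ::ₘ pathEdges ((0 :: L).map v) := by
    rw [hB]
    rcases List.eq_nil_or_concat L with rfl | ⟨L, z, rfl⟩
    · simp at hLl
    · have := cycleEdges_eq (v 0) (v z) (L.map v)
      simpa [List.getLastD_eq_getLast?, List.getLast?_cons] using this
  rw [hcyc, hA] at h ⊢
  have hc := closedCheck_eq
  rw [closedCheck] at hc
  have hleaf := leaf_of_search htf v (acc := []) (marks_cycle v) (by simpa using hlt)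
    (by simpa using hL) (by
      have := forall₂_candidates hlab
      rwa [show L.length = 5 by simpa using hLl] at this)
    (h.mono (by gcongr; exact Multiset.le_cons_self _ _)) hc
  simp only [List.reverse_nil, List.nil_append] at hleaf
  have hbad : badEdge (Nat.lor (Nat.lor (edgeBits 0 5) (walkBits (List.range 6)))
      (walkBits (0 :: L))) ((0 :: L).getLastD 0) 0 = false := by
    refine badEdge_eq_false htf v ((marks_cycle v).lor (marks_walkBits v hlt)) (by norm_num)
      (hlt _ ?_) (h.mono (by rw [Multiset.add_cons]))
    rw [List.getLastD_eq_getLast?, List.getLast?_eq_some_getLast (by simp), Option.getD_some]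
    exact List.getLast_mem _
  rw [hbad, Bool.false_or] at hleaf
  obtain ⟨P, Q, hP, hQ, hPQ, hspec⟩ := exists_split_of_splits v (by norm_num) hlt hinj hleaf
  rw [Bool.and_eq_true, lengthB_iff, lengthB_iff] at hspec
  refine ⟨P.map v, Q.map v, hP, hQ, ?_, by simp; omega, by simp; omega⟩
  rw [hPQ, List.map_cons, ← Multiset.cons_coe, map_decodeEdge_cycle v hlt, Multiset.add_cons,
    decodeEdge_edgeCode v _ (by norm_num)]
  refine hlt _ ?_
  rw [List.getLastD_eq_getLast?, List.getLast?_eq_some_getLast (by simp), Option.getD_some]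
  exact List.getLast_mem _

/-- A closed path of six edges and a path of five edges that starts on it split into two paths,
where the ends of the path become ends of different paths. -/
theorem merge_split_six (htf : TriangleFree G) {x γ : V} {Z B : List V} (hZ : (x :: Z).Nodup)
    (hB : (x :: B).Nodup) (hZl : Z.length = 5) (hBl : B.length = 5)
    (hγ : (x :: B).getLast? = some γ)
    (h : EdgeDistinct G (cycleEdges (x :: Z) + pathEdges (x :: B))) :
    ∃ P Q : List V, P.Nodup ∧ Q.Nodup ∧
      pathEdges P + pathEdges Q = cycleEdges (x :: Z) + pathEdges (x :: B) ∧
      (6 ≤ P.length ∧ P.length ≤ 7) ∧ (6 ≤ Q.length ∧ Q.length ≤ 7) ∧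
      IsEnd x P ∧ IsEnd γ Q := by
  obtain ⟨v, L, hA, hB', hinj, hL, hlab⟩ :=
    exists_labelling hZ hB (by simp [hZl]) (by simp)
  have hZl6 : (x :: Z).length = 6 := by simp [hZl]
  rw [hZl6] at hA hlab hinj
  have hLl : L.length = 6 := by
    have := congrArg List.length hB'
    simpa [hBl] using this.symm
  obtain ⟨y, L, rfl⟩ := List.exists_cons_of_length_eq_add_one hLl
  have hlt := lt_sixteen_of_label (n := 6) (by norm_num) (by omega) hlab
  have h1 : x = v 0 := by simpa [List.range_succ_eq_map] using congrArg List.head? hA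
  have hy : y = 0 := by
    refine hinj (Or.inr (by simp)) (Or.inl (by norm_num)) ?_
    have h2 : x = v y := by simpa using congrArg List.head? hB'
    rw [← h1, ← h2]
  subst hy
  have hlast := getLast?_map_cons v 0 L
  rw [hB'] at hγ h ⊢
  rw [hA] at h ⊢
  have hc := mergeCheck_eq
  rw [mergeCheck] at hc
  have hleaf := leaf_of_search htf v (acc := []) (marks_cycle v) (by simpa using hlt)
    (by simpa using hL) (by
      have := forall₂_candidates hlab
      rwa [show L.length = 5 by simpa using hLl] at this) h hc
  simp only [List.reverse_nil, List.nil_append] at hleaf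
  obtain ⟨P, Q, hP, hQ, hPQ, hspec⟩ := exists_split_of_splits v (by norm_num) hlt hinj hleaf
  simp only [Bool.and_eq_true, lengthB_iff] at hspec
  obtain ⟨⟨⟨hPl, hQl⟩, hPe⟩, hQe⟩ := hspec
  refine ⟨P.map v, Q.map v, hP, hQ, ?_, by simpa using hPl, by simpa using hQl, ?_, ?_⟩
  · rw [hPQ, map_decodeEdge_cycle v hlt]
  · rw [h1]
    exact isEnd_of_endB v (List.ne_nil_of_length_pos (by omega)) hPe
  · rw [hlast] at hγ
    rw [← Option.some.inj hγ]
    exact isEnd_of_endB v (List.ne_nil_of_length_pos (by omega)) hQe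

/-- A closed path of six edges and a path of six edges that meets it split into two paths. -/
theorem absorb_split_six (htf : TriangleFree G) {x : V} {Z B₁ B₂ : List V} (hZ : (x :: Z).Nodup)
    (hB : (B₁ ++ x :: B₂).Nodup) (hZl : Z.length = 5) (hBl : (B₁ ++ x :: B₂).length = 7)
    (hfirst : ∀ y ∈ B₁, y ∉ x :: Z)
    (h : EdgeDistinct G (cycleEdges (x :: Z) + pathEdges (B₁ ++ x :: B₂))) :
    ∃ P Q : List V, P.Nodup ∧ Q.Nodup ∧
      pathEdges P + pathEdges Q = cycleEdges (x :: Z) + pathEdges (B₁ ++ x :: B₂) ∧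
      (6 ≤ P.length ∧ P.length ≤ 8) ∧ (6 ≤ Q.length ∧ Q.length ≤ 8) := by
  obtain ⟨v, L, hA, hB', hinj, hL, hlab⟩ :=
    exists_labelling hZ hB (by simp [hZl]) (by simp)
  have hZl6 : (x :: Z).length = 6 := by simp [hZl]
  rw [hZl6] at hA hlab hinj
  have hLl : L.length = 7 := by
    have := congrArg List.length hB'
    rw [hBl] at this
    simpa using this.symm
  have hlt := lt_sixteen_of_label (n := 6) (by norm_num) (by omega) hlab
  have h1 : x = v 0 := by simpa [List.range_succ_eq_map] using congrArg List.head? hA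
  have hi7 : B₁.length < 7 := by rw [← hBl]; simp
  have hvget : ∀ j (hj : j < L.length), v L[j] =
      (B₁ ++ x :: B₂)[j]'(by rw [hBl, ← hLl]; exact hj) := by
    intro j hj
    simp [hB']
  have hmemlab : ∀ j (hj : j < L.length), L[j] ∈ firstHitLabels B₁.length j := by
    intro j hj
    have hL' := hlab j hj
    unfold firstHitLabels
    rcases lt_trichotomy j B₁.length with hlt' | heq | hgt
    · have e1 : Nat.beq j B₁.length = false := by
        rw [← Bool.not_eq_true, Nat.beq_eq]; omega
      have e2 : Nat.ble j B₁.length = true := by rw [Nat.ble_eq]; omega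
      rw [e1, e2, cond_false, cond_true, List.mem_singleton]
      refine hL'.resolve_left fun hlt6 => ?_
      refine hfirst B₁[j] (List.getElem_mem hlt') ?_
      have h3 := hvget j hj
      rw [List.getElem_append_left hlt'] at h3
      rw [hA, ← h3]
      exact List.mem_map.2 ⟨_, List.mem_range.2 hlt6, rfl⟩
    · have e1 : Nat.beq j B₁.length = true := by rw [Nat.beq_eq, heq]
      rw [e1, cond_true, List.mem_singleton]
      refine hinj (Or.inr (List.getElem_mem hj)) (Or.inl (by norm_num)) ?_
      rw [hvget j hj, ← h1, List.getElem_append_right (by omega)]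
      simp [heq]
    · have e1 : Nat.beq j B₁.length = false := by
        rw [← Bool.not_eq_true, Nat.beq_eq]; omega
      have e2 : Nat.ble j B₁.length = false := by
        rw [← Bool.not_eq_true, Nat.ble_eq]; omega
      rw [e1, e2, cond_false, cond_false, List.mem_append, List.mem_range, List.mem_singleton]
      exact hL'
  obtain ⟨y, L, rfl⟩ := List.exists_cons_of_length_eq_add_one hLl
  rw [hB', hA] at h ⊢
  have hc := absorbCheck_eq
  rw [absorbCheck, List.all_eq_true] at hc
  have hc := hc B₁.length (List.mem_range.2 hi7)
  rw [List.all_eq_true] at hc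
  have hc := hc y (hmemlab 0 (by simp))
  have hleaf := leaf_of_search htf v (acc := []) (marks_cycle v) (by simpa using hlt)
    (by simpa using hL) (by
      rw [List.forall₂_iff_get]
      refine ⟨by simpa using hLl, fun i hi1 hi2 => ?_⟩
      have := hmemlab (i + 1) (by simpa using hi1)
      simpa using this) h hc
  simp only [List.reverse_nil, List.nil_append] at hleaf
  obtain ⟨P, Q, hP, hQ, hPQ, hspec⟩ := exists_split_of_splits v (by norm_num) hlt hinj hleaf
  simp only [Bool.and_eq_true, lengthB_iff] at hspec
  refine ⟨P.map v, Q.map v, hP, hQ, ?_, by simpa using hspec.1, by simpa using hspec.2⟩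
  rw [hPQ, map_decodeEdge_cycle v hlt]

/-- If a template has been found for every way in which paths with `nA` and `nB + 1` vertices can be
linked, then any two such paths and the edge between their first vertices split. The flags `fa` and
`fb` say whether the last vertices are to remain ends. -/
theorem link_split_of_check (htf : TriangleFree G) {nA nB : ℕ} {fa fb : Bool}
    {T : List (List (List ℕ × List ℕ))} (hc : linkCheck nA nB fa fb T = true) (hnA0 : 0 < nA)
    (hnA : nA ≤ 8) (hnB : nB < 8) {a b α β : V} {A B : List V} (hA : (a :: A).Nodup)
    (hB : (b :: B).Nodup) (hAl : (a :: A).length = nA) (hBl : B.length = nB)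
    (hab : a ∈ b :: B) (hba : b ∈ a :: A)
    (hα : (a :: A).getLast? = some α) (hβ : (b :: B).getLast? = some β)
    (hfa : fa = true → α ≠ b) (hfb : fb = true → β ≠ a)
    (hfab : fa = true → fb = true → α ≠ β)
    (h : EdgeDistinct G (s(a, b) ::ₘ (pathEdges (a :: A) + pathEdges (b :: B)))) :
    ∃ P Q : List V, P.Nodup ∧ Q.Nodup ∧
      pathEdges P + pathEdges Q = s(a, b) ::ₘ (pathEdges (a :: A) + pathEdges (b :: B)) ∧
      (6 ≤ P.length ∧ P.length ≤ 8) ∧ (6 ≤ Q.length ∧ Q.length ≤ 8) ∧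
      (fa = true → IsEnd α P ∧ P.length ≤ 7) ∧ (fb = true → IsEnd β Q ∧ Q.length ≤ 7) := by
  obtain ⟨v, L, hA', hB', hinj, hL, hlab⟩ := exists_labelling hA hB (by omega) (by simp)
  rw [hAl] at hA' hlab hinj
  have hLl : L.length = nB + 1 := by
    have := congrArg List.length hB'
    simpa [hBl] using this.symm
  obtain ⟨y, L, rfl⟩ := List.exists_cons_of_length_eq_add_one hLl
  have hlt := lt_sixteen_of_label hnA (by omega) hlab
  have hltA : ∀ x ∈ List.range nA, x < 16 := fun x hx => by
    rw [List.mem_range] at hx; omega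
  have ha : a = v 0 := by
    obtain ⟨n, rfl⟩ : ∃ n, nA = n + 1 := ⟨nA - 1, by omega⟩
    simpa [List.range_succ_eq_map] using congrArg List.head? hA'
  have hb : b = v y := by simpa using congrArg List.head? hB'
  have hyA : y < nA := by
    rw [hA'] at hba
    obtain ⟨i, hi, hiv⟩ := List.mem_map.1 hba
    rw [List.mem_range] at hi
    rwa [← hinj (Or.inl hi) (Or.inr (by simp)) (hiv.trans hb)]
  have hy16 : y < 16 := hlt y (by simp)
  have h0L : memB 0 (y :: L) = true := by
    rw [memB_iff]
    rw [hB'] at hab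
    obtain ⟨i, hi, hiv⟩ := List.mem_map.1 hab
    rwa [← hinj (Or.inr hi) (Or.inl hnA0) (hiv.trans ha)]
  have hαv : α = v (nA - 1) := by
    rw [hA'] at hα
    rw [List.getLast?_map, List.getLast?_range, if_neg (by omega)] at hα
    simpa using hα.symm
  have hβv : β = v ((y :: L).getLastD 0) := by
    rw [hB', getLast?_map_cons] at hβ
    exact (Option.some.inj hβ).symm
  rw [hA', hB', ha, hb] at h ⊢
  have hM : Marks v (Nat.lor (edgeBits 0 y) (walkBits (List.range nA)))
      (s(v 0, v y) ::ₘ pathEdges ((List.range nA).map v)) :=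
    (marks_walkBits v hltA).lor_edgeBits (by norm_num) hy16
  rw [linkCheck, List.all_eq_true] at hc
  have hc := hc y (List.mem_range.2 hyA)
  have hbad : badEdge (walkBits (List.range nA)) 0 y = false := by
    refine badEdge_eq_false htf v (marks_walkBits v hltA) hy16 (by norm_num) (h.mono ?_)
    exact Multiset.cons_le_cons _ (Multiset.le_add_right _ _)
  rw [hbad, Bool.false_or] at hc
  have hleaf := leaf_of_search htf v (acc := []) hM (by simpa using hlt)
    (by simpa using hL) (by
      have := forall₂_candidates hlab
      rwa [show L.length = nB by simpa using hLl] at this)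
    (by rwa [Multiset.cons_add]) hc
  simp only [List.reverse_nil, List.nil_append, h0L, Bool.not_true, Bool.false_or] at hleaf
  have e1 : (fa && Nat.beq y (nA - 1)) = false := by
    rw [← Bool.not_eq_true, Bool.and_eq_true, Nat.beq_eq]
    rintro ⟨h1, h2⟩
    exact hfa h1 (by rw [hαv, hb, h2])
  have e2 : (fb && Nat.beq ((y :: L).getLastD 0) 0) = false := by
    rw [← Bool.not_eq_true, Bool.and_eq_true, Nat.beq_eq]
    rintro ⟨h1, h2⟩
    exact hfb h1 (by rw [hβv, ha, h2])
  have e3 : (fa && fb && Nat.beq ((y :: L).getLastD 0) (nA - 1)) = false := by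
    rw [← Bool.not_eq_true, Bool.and_eq_true, Bool.and_eq_true, Nat.beq_eq]
    rintro ⟨⟨h1, h1'⟩, h2⟩
    exact hfab h1 h1' (by rw [hβv, hαv, h2])
  rw [e1, e2, e3, Bool.false_or, Bool.false_or, Bool.false_or] at hleaf
  obtain ⟨P, Q, hP, hQ, hPQ, hspec⟩ := exists_split_of_splits v hnA hlt hinj hleaf
  simp only [Bool.and_eq_true, Bool.or_eq_true, Bool.not_eq_true', lengthB_iff] at hspec
  obtain ⟨⟨⟨hPl, hQl⟩, hPe⟩, hQe⟩ := hspec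
  refine ⟨P.map v, Q.map v, hP, hQ, ?_, by simpa using hPl, by simpa using hQl,
    fun hf => ?_, fun hf => ?_⟩
  · rw [hPQ, List.map_append, ← Multiset.coe_add, map_decodeEdge_edgeCodes v hlt, List.map_cons,
      ← Multiset.cons_coe, map_decodeEdge_edgeCodes v hltA,
      decodeEdge_edgeCode v (by norm_num) hy16, Multiset.cons_add]
  · rw [hf] at hPe
    have := hPe.resolve_left (by simp)
    rw [hαv]
    exact ⟨isEnd_of_endB v (List.ne_nil_of_length_pos (by omega)) this.1, by simpa using this.2.2⟩
  · rw [hf] at hQe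
    have := hQe.resolve_left (by simp)
    rw [hβv]
    exact ⟨isEnd_of_endB v (List.ne_nil_of_length_pos (by omega)) this.1, by simpa using this.2.2⟩

/-- Two paths of five or six edges, each of which contains the first vertex `a` or `b` of the other
one, and the edge `ab` split into two paths. A path of five edges may keep its last vertex as an
end. -/
theorem link_split_six (htf : TriangleFree G) (fa fb : Bool) {a b α β : V} {A B : List V}
    (hA : (a :: A).Nodup) (hB : (b :: B).Nodup) (hAl : A.length = 5 ∨ A.length = 6 ∧ fa = false)
    (hBl : B.length = 5 ∨ B.length = 6 ∧ fb = false)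
    (hab : a ∈ b :: B) (hba : b ∈ a :: A)
    (hα : (a :: A).getLast? = some α) (hβ : (b :: B).getLast? = some β)
    (hfa : fa = true → α ≠ b) (hfb : fb = true → β ≠ a)
    (hfab : fa = true → fb = true → α ≠ β)
    (h : EdgeDistinct G (s(a, b) ::ₘ (pathEdges (a :: A) + pathEdges (b :: B)))) :
    ∃ P Q : List V, P.Nodup ∧ Q.Nodup ∧
      pathEdges P + pathEdges Q = s(a, b) ::ₘ (pathEdges (a :: A) + pathEdges (b :: B)) ∧
      (6 ≤ P.length ∧ P.length ≤ 8) ∧ (6 ≤ Q.length ∧ Q.length ≤ 8) ∧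
      (fa = true → IsEnd α P ∧ P.length ≤ 7) ∧ (fb = true → IsEnd β Q ∧ Q.length ≤ 7) := by
  rcases hAl with hAl | ⟨hAl, rfl⟩ <;> rcases hBl with hBl | ⟨hBl, rfl⟩
  · exact link_split_of_check htf (linkCheck_six_six fa fb) (by norm_num) (by norm_num)
      (by norm_num) hA hB (by simp [hAl]) hBl hab hba hα hβ hfa hfb hfab h
  · have h' : EdgeDistinct G (s(b, a) ::ₘ (pathEdges (b :: B) + pathEdges (a :: A))) := by
      rwa [Sym2.eq_swap, add_comm]
    obtain ⟨P, Q, hP, hQ, hPQ, hPl, hQl, hPe, hQe⟩ :=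
      link_split_of_check htf (linkCheck_seven_six fa) (by norm_num) (by norm_num)
      (by norm_num) hB hA (by simp [hBl]) hAl hba hab hβ hα hfb hfa
      (fun h1 h2 => (hfab h2 h1).symm) h'
    refine ⟨Q, P, hQ, hP, ?_, hQl, hPl, hQe, hPe⟩
    rw [add_comm, hPQ, Sym2.eq_swap, add_comm]
  · exact link_split_of_check htf (linkCheck_seven_six fb) (by norm_num) (by norm_num)
      (by norm_num) hA hB (by simp [hAl]) hBl hab hba hα hβ hfa hfb hfab h
  · exact link_split_of_check htf linkCheck_seven_seven (by norm_num) (by norm_num)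
      (by norm_num) hA hB (by simp [hAl]) hBl hab hba hα hβ hfa hfb hfab h


/-! ### Splitting in graphs of larger girth -/

theorem triangleFree_of_egirth (hg : ((4 : ℕ) : ℕ∞) ≤ G.egirth) : TriangleFree G := by
  intro a b c hab hbc hca
  have h : EdgeDistinct G (pathEdges (a :: [b, c] ++ [a])) := by
    constructor
    · have h1 := hab.ne
      have h2 := hbc.ne
      have h3 := hca.ne
      simp [h1, h2, h3, h1.symm, h3.symm]
    · simp [hab, hbc, hca]
  have := le_length_of_closed_trail hg a [b, c] h
  simp at this

/-- The edge `xz` of a cycle is moved to a path that starts in `x`. -/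
theorem merge_split_aux {x z : V} {Z B : List V}
    (hZ : (x :: z :: Z).Nodup) (hB : (x :: B).Nodup) (hzB : z ∉ x :: B) :
    (z :: Z ++ [x]).Nodup ∧ (z :: x :: B).Nodup ∧
      pathEdges (z :: Z ++ [x]) + pathEdges (z :: x :: B) =
        cycleEdges (x :: z :: Z) + pathEdges (x :: B) := by
  refine ⟨?_, List.nodup_cons.2 ⟨hzB, hB⟩, ?_⟩
  · have := (List.perm_append_singleton x (z :: Z)).nodup_iff.2 hZ
    simpa using this
  · rw [cycleEdges_cons]
    simp only [List.cons_append, pathEdges_cons_cons, Multiset.add_cons, Multiset.cons_add]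
    rw [Sym2.eq_swap]

/-- For `k ≥ 4`, a path of length `2 * k - 1` that starts in a vertex `x` of a cycle does not contain
both neighbours of `x` on the cycle, as they would divide the path into short closed trails. -/
theorem merge_split_not_mem {k : ℕ} (hk : 4 ≤ k) (hg : ((2 * k - 2 : ℕ) : ℕ∞) ≤ G.egirth)
    {x y z : V} {Z p q r : List V}
    (hl : (p ++ y :: q ++ z :: r).length = 2 * k - 1)
    (h : EdgeDistinct G (cycleEdges (x :: y :: Z ++ [z]) +
      pathEdges (x :: (p ++ y :: q ++ z :: r)))) : False := by
  have hc : cycleEdges (x :: y :: Z ++ [z]) =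
      s(z, x) ::ₘ s(x, y) ::ₘ pathEdges (y :: Z ++ [z]) := by
    rw [cycleEdges_eq]
    rfl
  have h1 := le_length_of_closed_trail hg x (p ++ [y]) (h.mono (by
    have e : x :: (p ++ [y]) ++ [x] = (x :: p) ++ [y, x] := by simp
    rw [e, pathEdges_concat_concat, hc, Sym2.eq_swap, Multiset.cons_swap, Multiset.cons_add]
    refine Multiset.cons_le_cons _ (le_trans (pathEdges_le_of_infix ?_)
      (Multiset.le_add_left _ _))
    exact ⟨[], q ++ z :: r, by simp⟩))
  have h2 := le_length_of_closed_trail hg y (q ++ [z, x]) (h.mono (by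
    have e : y :: (q ++ [z, x]) ++ [y] = (y :: q ++ [z]) ++ [x, y] := by simp
    have e' : (y :: q ++ [z]) ++ [x] = (y :: q) ++ [z, x] := by simp
    rw [e, pathEdges_concat_concat, e', pathEdges_concat_concat, hc, Multiset.cons_swap,
      Multiset.cons_add, Multiset.cons_add]
    refine Multiset.cons_le_cons _ (Multiset.cons_le_cons _ (le_trans (pathEdges_le_of_infix ?_)
      (Multiset.le_add_left _ _)))
    exact ⟨x :: p, r, by simp⟩))
  simp at h1 h2 hl
  omega

theorem exists_append_of_mem_of_mem {x y : V} {l : List V} (hx : x ∈ l) (hy : y ∈ l)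
    (hxy : x ≠ y) : (∃ p q r, l = p ++ x :: q ++ y :: r) ∨ ∃ p q r, l = p ++ y :: q ++ x :: r := by
  obtain ⟨p, r, rfl⟩ := List.append_of_mem hx
  simp only [List.mem_append, List.mem_cons] at hy
  rcases hy with hy | hy | hy
  · obtain ⟨p', q, rfl⟩ := List.append_of_mem hy
    exact Or.inr ⟨p', q, r, by simp⟩
  · exact absurd hy.symm hxy
  · obtain ⟨q, r', rfl⟩ := List.append_of_mem hy
    exact Or.inl ⟨p, q, r', by simp⟩

/-- A cycle of length `2 * k` and a path of length `2 * k - 1` that starts on it split into two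
paths, where the ends of the path become ends of different paths. For `k ≥ 4` an edge of the cycle
at the first vertex of the path is moved to the path. -/
theorem merge_split {k : ℕ} (hk : 3 ≤ k) (hg : ((2 * k - 2 : ℕ) : ℕ∞) ≤ G.egirth) {x γ : V}
    {Z B : List V} (hZ : (x :: Z).Nodup) (hB : (x :: B).Nodup) (hZl : Z.length = 2 * k - 1)
    (hBl : B.length = 2 * k - 1) (hγ : (x :: B).getLast? = some γ)
    (h : EdgeDistinct G (cycleEdges (x :: Z) + pathEdges (x :: B))) :
    ∃ P Q : List V, P.Nodup ∧ Q.Nodup ∧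
      pathEdges P + pathEdges Q = cycleEdges (x :: Z) + pathEdges (x :: B) ∧
      (2 * k ≤ P.length ∧ P.length ≤ 2 * k + 1) ∧ (2 * k ≤ Q.length ∧ Q.length ≤ 2 * k + 1) ∧
      IsEnd x P ∧ IsEnd γ Q := by
  rcases hk.eq_or_lt with rfl | hk
  · exact merge_split_six (triangleFree_of_egirth hg) hZ hB hZl hBl hγ h
  have key : ∀ {z : V} {Z : List V}, (x :: z :: Z).Nodup → (z :: Z).length = 2 * k - 1 →
      z ∉ x :: B → ∃ P Q : List V, P.Nodup ∧ Q.Nodup ∧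
      pathEdges P + pathEdges Q = cycleEdges (x :: z :: Z) + pathEdges (x :: B) ∧
      (2 * k ≤ P.length ∧ P.length ≤ 2 * k + 1) ∧ (2 * k ≤ Q.length ∧ Q.length ≤ 2 * k + 1) ∧
      IsEnd x P ∧ IsEnd γ Q := by
    intro z Z hZ hZl hz
    obtain ⟨h1, h2, h3⟩ := merge_split_aux hZ hB hz
    refine ⟨_, _, h1, h2, h3, ?_, ?_, Or.inr (by simp [List.getLast?_cons]),
      Or.inr (by rw [List.getLast?_cons, hγ]; rfl)⟩
    · simp at hZl ⊢; omega
    · simp; omega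
  obtain ⟨y, Z, rfl⟩ := List.exists_cons_of_length_eq_add_one
    (show Z.length = (2 * k - 2) + 1 by omega)
  rcases List.eq_nil_or_concat Z with rfl | ⟨Z, z, rfl⟩
  · simp at hZl; omega
  rw [List.concat_eq_append] at *
  by_cases hy : y ∈ x :: B
  · by_cases hz : z ∈ x :: B
    · exfalso
      have hne : y ≠ z := by
        rintro rfl; simp at hZ
      have hy' : y ∈ B := (List.mem_cons.1 hy).resolve_left (by rintro rfl; simp at hZ)
      have hz' : z ∈ B := (List.mem_cons.1 hz).resolve_left (by rintro rfl; simp at hZ)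
      rcases exists_append_of_mem_of_mem hy' hz' hne with ⟨p, q, r, rfl⟩ | ⟨p, q, r, rfl⟩
      · exact merge_split_not_mem hk hg hBl h
      · refine merge_split_not_mem hk hg (x := x) (Z := Z.reverse) hBl ?_
        have := cycleEdges_cons_reverse x (y :: (Z ++ [z]))
        rw [← this] at h
        simpa using h
    · have e := cycleEdges_cons_reverse x (y :: (Z ++ [z]))
      have e' : (y :: (Z ++ [z])).reverse = z :: (Z.reverse ++ [y]) := by simp
      have hZ' : (x :: (y :: (Z ++ [z])).reverse).Nodup := by
        rw [List.nodup_cons, List.mem_reverse, List.nodup_reverse, ← List.nodup_cons]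
        exact hZ
      rw [← e]
      rw [e'] at hZ' ⊢
      exact key hZ' (by simpa using hZl) hz
  · exact key hZ hZl hy

/-- For `k ≥ 4`, a cycle of length `2 * k` through a vertex `x` does not contain the other end of a
further edge at `x`, which would be a chord. -/
theorem closed_split_not_mem {k : ℕ} (hk : 4 ≤ k) (hg : ((2 * k - 2 : ℕ) : ℕ∞) ≤ G.egirth)
    {x y : V} {Z Z' : List V} (hZ : (x :: y :: Z).Nodup) (hl : Z'.length = 2 * k - 1)
    (h : EdgeDistinct G (cycleEdges (x :: y :: Z) + cycleEdges (x :: Z'))) : y ∉ x :: Z' := by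
  intro hy
  have hy' : y ∈ Z' := (List.mem_cons.1 hy).resolve_left (by rintro rfl; simp at hZ)
  obtain ⟨p, q, rfl⟩ := List.append_of_mem hy'
  have hc : s(x, y) ∈ cycleEdges (x :: y :: Z) := by
    rw [cycleEdges_cons]; simp
  obtain ⟨t, ht⟩ := Multiset.exists_cons_of_mem hc
  rw [ht] at h
  have h1 := le_length_of_closed_trail hg x (p ++ [y]) (h.mono (by
    have e : x :: (p ++ [y]) ++ [x] = (x :: p) ++ [y, x] := by simp
    rw [e, pathEdges_concat_concat, Sym2.eq_swap, Multiset.cons_add]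
    refine Multiset.cons_le_cons _ (le_trans (pathEdges_le_of_infix ?_)
      (Multiset.le_add_left _ _))
    exact ⟨[], q ++ [x], by simp⟩))
  have h2 := le_length_of_closed_trail hg y (q ++ [x]) (h.mono (by
    have e : y :: (q ++ [x]) ++ [y] = (y :: q) ++ [x, y] := by simp
    rw [e, pathEdges_concat_concat, Multiset.cons_add]
    refine Multiset.cons_le_cons _ (le_trans (pathEdges_le_of_infix ?_)
      (Multiset.le_add_left _ _))
    exact ⟨x :: p, [], by simp⟩))
  simp at h1 h2 hl
  omega

/-- Two cycles of length `2 * k` with a common vertex split into two paths of length `2 * k`. For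
`k ≥ 4` the cycles exchange an edge at the common vertex. -/
theorem closed_split {k : ℕ} (hk : 3 ≤ k) (hg : ((2 * k - 2 : ℕ) : ℕ∞) ≤ G.egirth) {x : V}
    {Z Z' : List V} (hZ : (x :: Z).Nodup) (hZ' : (x :: Z').Nodup) (hZl : Z.length = 2 * k - 1)
    (hZl' : Z'.length = 2 * k - 1)
    (h : EdgeDistinct G (cycleEdges (x :: Z) + cycleEdges (x :: Z'))) :
    ∃ P Q : List V, P.Nodup ∧ Q.Nodup ∧
      pathEdges P + pathEdges Q = cycleEdges (x :: Z) + cycleEdges (x :: Z') ∧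
      P.length = 2 * k + 1 ∧ Q.length = 2 * k + 1 := by
  rcases hk.eq_or_lt with rfl | hk
  · exact closed_split_six (triangleFree_of_egirth hg) hZ hZ' hZl hZl' h
  obtain ⟨y, Z, rfl⟩ := List.exists_cons_of_length_eq_add_one
    (show Z.length = (2 * k - 2) + 1 by omega)
  obtain ⟨w, Z', rfl⟩ := List.exists_cons_of_length_eq_add_one
    (show Z'.length = (2 * k - 2) + 1 by omega)
  have hy := closed_split_not_mem hk hg hZ hZl' h
  have hw := closed_split_not_mem hk hg hZ' hZl (by rwa [add_comm])
  have hnd : ∀ {a c : V} {L : List V}, (x :: a :: L).Nodup → c ∉ x :: a :: L →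
      (a :: L ++ [x, c]).Nodup := by
    intro a c L h1 h2
    have h3 : (c :: x :: a :: L).Nodup := List.nodup_cons.2 ⟨h2, h1⟩
    refine (List.Perm.nodup_iff ?_).2 h3
    exact List.perm_append_comm.trans ((List.Perm.swap c x _))
  refine ⟨y :: Z ++ [x, w], w :: Z' ++ [x, y], hnd hZ hw, hnd hZ' hy, ?_, ?_, ?_⟩
  · rw [pathEdges_concat_concat, pathEdges_concat_concat, cycleEdges_cons, cycleEdges_cons]
    simp only [List.cons_append, pathEdges_cons_cons, Multiset.add_cons, Multiset.cons_add]
    rw [Multiset.cons_swap]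
  · simp at hZl ⊢; omega
  · simp at hZl' ⊢; omega

/-- A path is cut at its first vertex `x` on a cycle, and the two parts are prolonged by the two arcs
of the cycle from `x` to `z`. -/
theorem absorb_split_aux {x z : V} {S T B₁ B₂ : List V} (hZ : (x :: (S ++ z :: T)).Nodup)
    (hB : (B₁ ++ x :: B₂).Nodup) (hfirst : ∀ y ∈ B₁, y ∉ x :: (S ++ z :: T))
    (hfree : ∀ y ∈ S ++ [z], y ∉ B₂) :
    (B₁ ++ x :: (z :: T).reverse).Nodup ∧ ((S ++ [z]).reverse ++ x :: B₂).Nodup ∧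
      pathEdges (B₁ ++ x :: (z :: T).reverse) + pathEdges ((S ++ [z]).reverse ++ x :: B₂) =
        cycleEdges (x :: (S ++ z :: T)) + pathEdges (B₁ ++ x :: B₂) := by
  refine ⟨?_, ?_, ?_⟩
  · rw [List.nodup_append] at hB ⊢
    refine ⟨hB.1, ?_, ?_⟩
    · rw [List.nodup_cons, List.mem_reverse, List.nodup_reverse, ← List.nodup_cons]
      exact hZ.sublist (List.Sublist.cons_cons _ (List.sublist_append_right _ _))
    · rintro a ha b hb rfl
      refine hfirst a ha ?_
      simp only [List.mem_cons, List.mem_reverse, List.mem_append] at hb ⊢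
      tauto
  · rw [List.nodup_append, List.nodup_reverse]
    refine ⟨?_, (List.nodup_append.1 hB).2.1, ?_⟩
    · have : (S ++ [z]).Sublist (S ++ z :: T) :=
        (List.Sublist.cons_cons z (List.nil_sublist T)).append_left S
      exact (List.nodup_cons.1 hZ).2.sublist this
    · rintro a ha b hb rfl
      rw [List.mem_reverse] at ha
      rcases List.mem_cons.1 hb with rfl | hb
      · refine (List.nodup_cons.1 hZ).1 ?_
        simp only [List.mem_append, List.mem_cons, List.not_mem_nil, or_false] at ha ⊢
        tauto
      · exact hfree a ha hb
  · rw [pathEdges_append_cons B₁ x (z :: T).reverse, pathEdges_append_cons B₁ x B₂,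
      pathEdges_append_cons _ x B₂, cycleEdges_cons]
    have e1 : x :: (S ++ z :: T) ++ [x] = (x :: S) ++ z :: (T ++ [x]) := by simp
    have e2 : pathEdges (x :: (z :: T).reverse) = pathEdges (z :: (T ++ [x])) := by
      rw [← pathEdges_reverse]; simp
    have e3 : pathEdges ((S ++ [z]).reverse ++ [x]) = pathEdges (x :: S ++ [z]) := by
      rw [← pathEdges_reverse]; simp
    rw [e1, e2, e3, pathEdges_append_cons (x :: S) z (T ++ [x])]
    abel

/-- If a path that passes through the vertex `x` of a cycle meets the cycle again in `y` and then in
`z`, where `y` and `z` lie on different sides of `x`, then two closed trails arise, which bounds the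
distances of these vertices from below. -/
theorem absorb_split_not_mem {k : ℕ} (hg : ((2 * k - 2 : ℕ) : ℕ∞) ≤ G.egirth)
    {x y z : V} {S M T B₁ C D E : List V}
    (h : EdgeDistinct G (cycleEdges (x :: (S ++ y :: M ++ z :: T)) +
      pathEdges (B₁ ++ x :: (C ++ y :: D ++ z :: E)))) :
    2 * k - 2 ≤ C.length + S.length + 2 ∧ 2 * k - 2 ≤ D.length + T.length + S.length + 3 := by
  have hc : cycleEdges (x :: (S ++ y :: M ++ z :: T)) =
      pathEdges (x :: S ++ [y]) + pathEdges (y :: M ++ [z]) + pathEdges (z :: T ++ [x]) := by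
    rw [cycleEdges_cons]
    have e : x :: (S ++ y :: M ++ z :: T) ++ [x] = (x :: S ++ y :: M) ++ z :: (T ++ [x]) := by simp
    have e' : (x :: S ++ y :: M) ++ [z] = (x :: S) ++ y :: (M ++ [z]) := by simp
    rw [e, pathEdges_append_cons, e', pathEdges_append_cons]
    simp
  have hp : pathEdges (x :: C ++ [y]) + pathEdges (y :: D ++ [z]) ≤
      pathEdges (B₁ ++ x :: (C ++ y :: D ++ z :: E)) := by
    have e : pathEdges (x :: C ++ [y]) + pathEdges (y :: D ++ [z]) =
        pathEdges (x :: C ++ y :: (D ++ [z])) :=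
      (pathEdges_append_cons (x :: C) y (D ++ [z])).symm
    rw [e]
    exact pathEdges_le_of_infix ⟨B₁, E, by simp⟩
  have h' := h.mono (add_le_add (le_of_eq hc.symm) hp)
  constructor
  · have := le_length_of_closed_trail hg x (C ++ y :: S.reverse) (h'.mono (by
      have e : x :: (C ++ y :: S.reverse) ++ [x] = (x :: C) ++ y :: (S.reverse ++ [x]) := by simp
      have e' : pathEdges (y :: (S.reverse ++ [x])) = pathEdges (x :: S ++ [y]) := by
        rw [← pathEdges_reverse]; simp
      rw [e, pathEdges_append_cons, e', add_comm]
      exact add_le_add ((Multiset.le_add_right _ _).trans (Multiset.le_add_right _ _))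
        (Multiset.le_add_right _ _)))
    simp at this
    omega
  · have := le_length_of_closed_trail hg y (D ++ z :: T ++ x :: S) (h'.mono (by
      have e : y :: (D ++ z :: T ++ x :: S) ++ [y] =
        (y :: D) ++ z :: (T ++ x :: S ++ [y]) := by simp
      have e' : z :: (T ++ x :: S ++ [y]) = (z :: T) ++ x :: (S ++ [y]) := by simp
      rw [e, pathEdges_append_cons, e', pathEdges_append_cons (z :: T),
        add_comm (pathEdges (y :: D ++ [z]))]
      refine add_le_add ?_ (Multiset.le_add_left _ _)
      rw [add_comm, List.cons_append]
      exact add_le_add (Multiset.le_add_right _ _) le_rfl))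
    simp at this
    omega

/-- A cycle of length `2 * k` and a path of length `2 * k` that meets it split into two paths, if
the first vertex `x` of the path on the cycle is at least as close to its end as the last one. For
`k ≥ 4` the path is cut at `x`, and the two parts are completed by the two arcs from `x` to a vertex
that is about as far from `x` as the first vertex of the path. -/
theorem absorb_split {k : ℕ} (hk : 3 ≤ k) (hg : ((2 * k - 2 : ℕ) : ℕ∞) ≤ G.egirth) {x : V}
    {Z B₁ B₂ : List V} (hZ : (x :: Z).Nodup) (hB : (B₁ ++ x :: B₂).Nodup)
    (hZl : Z.length = 2 * k - 1) (hBl : (B₁ ++ x :: B₂).length = 2 * k + 1)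
    (hfirst : ∀ y ∈ B₁, y ∉ x :: Z) (hle : B₁.length ≤ B₂.length)
    (hnear : ∀ y C D, B₂ = C ++ y :: D → y ∈ Z → B₁.length ≤ D.length)
    (h : EdgeDistinct G (cycleEdges (x :: Z) + pathEdges (B₁ ++ x :: B₂))) :
    ∃ P Q : List V, P.Nodup ∧ Q.Nodup ∧
      pathEdges P + pathEdges Q = cycleEdges (x :: Z) + pathEdges (B₁ ++ x :: B₂) ∧
      (2 * k ≤ P.length ∧ P.length ≤ 2 * k + 2) ∧ (2 * k ≤ Q.length ∧ Q.length ≤ 2 * k + 2) := by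
  rcases hk.eq_or_lt with rfl | hk
  · exact absorb_split_six (triangleFree_of_egirth hg) hZ hB hZl hBl hfirst h
  have key : ∀ {Z S T : List V} {z : V}, Z = S ++ z :: T → (x :: Z).Nodup →
      Z.length = 2 * k - 1 → S.length = max 1 B₁.length - 1 → (∀ y ∈ B₁, y ∉ x :: Z) →
      (∀ y ∈ S ++ [z], y ∉ B₂) → ∃ P Q : List V, P.Nodup ∧ Q.Nodup ∧
        pathEdges P + pathEdges Q = cycleEdges (x :: Z) + pathEdges (B₁ ++ x :: B₂) ∧
        (2 * k ≤ P.length ∧ P.length ≤ 2 * k + 2) ∧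
        (2 * k ≤ Q.length ∧ Q.length ≤ 2 * k + 2) := by
    rintro Z S T z rfl hZ hZl hS hfirst hfree
    obtain ⟨h1, h2, h3⟩ := absorb_split_aux hZ hB hfirst hfree
    refine ⟨_, _, h1, h2, h3, ?_, ?_⟩
    · simp at hZl hBl ⊢; omega
    · simp at hZl hBl ⊢; omega
  have hsplit : ∀ {n : ℕ} {l : List V}, n < l.length → ∃ S z T, l = S ++ z :: T ∧ S.length = n :=
    fun {n l} hn => ⟨l.take n, l[n], l.drop (n + 1), by
      rw [← List.drop_eq_getElem_cons hn, List.take_append_drop], by simp; omega⟩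
  have hB₁ : B₁.length ≤ k := by simp at hBl; omega
  obtain ⟨S, z, T, hZ1, hS⟩ := hsplit (n := max 1 B₁.length - 1) (l := Z) (by omega)
  obtain ⟨S', z', T', hZ2, hS'⟩ := hsplit (n := max 1 B₁.length - 1) (l := Z.reverse)
    (by rw [List.length_reverse]; omega)
  by_cases hf : ∀ y ∈ S ++ [z], y ∉ B₂
  · exact key hZ1 hZ hZl hS hfirst hf
  by_cases hf' : ∀ y ∈ S' ++ [z'], y ∉ B₂
  · rw [← cycleEdges_cons_reverse]
    refine key hZ2 ?_ (by simpa using hZl) hS' (by simpa using hfirst) hf'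
    rw [List.nodup_cons, List.mem_reverse, List.nodup_reverse, ← List.nodup_cons]
    exact hZ
  -- both arcs are blocked: this gives two closed trails that are too short
  exfalso
  push Not at hf hf'
  obtain ⟨y, hy, hyB⟩ := hf
  obtain ⟨y', hy', hyB'⟩ := hf'
  have hcut : ∀ {y z : V} {S T L : List V}, L = S ++ z :: T → y ∈ S ++ [z] →
      ∃ p q, L = p ++ y :: q ∧ p.length ≤ S.length := by
    rintro y z S T L rfl hy
    obtain ⟨p, q, hpq⟩ := List.append_of_mem hy
    refine ⟨p, q ++ T, ?_, ?_⟩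
    · rw [← List.cons_append, ← List.append_assoc, ← hpq]; simp
    · have := congrArg List.length hpq
      simp at this; omega
  obtain ⟨p, q, hp, hpl⟩ := hcut hZ1 hy
  obtain ⟨p', q', hp', hpl'⟩ := hcut hZ2 hy'
  have hZ3 : Z = q'.reverse ++ y' :: p'.reverse := by
    rw [← List.reverse_reverse Z, hp']; simp
  have hB₁' : B₁.length + 1 ≤ k := by
    obtain ⟨C, D, hCD⟩ := List.append_of_mem hyB
    have := hnear y C D hCD (by rw [hp]; simp)
    rw [hCD] at hBl
    simp at hBl; omega
  have hlen := congrArg List.length hp'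
  rw [List.length_reverse] at hlen
  simp at hlen
  obtain ⟨M, hM⟩ : ∃ M, q'.reverse = p ++ y :: M := by
    have hlt : p.length < q'.reverse.length := by rw [List.length_reverse]; omega
    rcases List.append_eq_append_iff.1 (hZ3.symm.trans hp) with ⟨a, ha, -⟩ | ⟨a, ha, ha'⟩
    · rw [ha] at hlt; simp at hlt
    · cases a with
      | nil => rw [ha] at hlt; simp at hlt
      | cons b M =>
        obtain rfl : y = b := (List.cons.inj ha').1
        exact ⟨M, ha⟩
  rw [hM] at hZ3
  have hne : y ≠ y' := by
    rintro rfl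
    rw [hZ3] at hZ
    simp [List.nodup_append] at hZ
  rcases exists_append_of_mem_of_mem hyB hyB' hne with ⟨C, D, E, rfl⟩ | ⟨C, D, E, rfl⟩
  · have hE := hnear y' (C ++ y :: D) E (by simp) (by rw [hZ3]; simp)
    rw [hZ3] at h
    obtain ⟨h1, h2⟩ := absorb_split_not_mem hg h
    simp at h1 h2 hBl
    omega
  · have hE := hnear y (C ++ y' :: D) E (by simp) (by rw [hp]; simp)
    rw [← cycleEdges_cons_reverse, hZ3] at h
    have e : (p ++ y :: M ++ y' :: p'.reverse).reverse =
        p' ++ y' :: M.reverse ++ y :: p.reverse := by simp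
    rw [e] at h
    obtain ⟨h1, h2⟩ := absorb_split_not_mem hg h
    simp at h1 h2 hBl
    omega

/-- Two paths with `2 * k` or `2 * k + 1` vertices, each of which contains the first vertex `a` or
`b` of the other one, and the edge `ab` split into two paths. A path with `2 * k` vertices may keep
its last vertex as an end. For `k ≥ 4`, if `x` precedes `b` on the first path, then the edge `xb` of
this path is exchanged for `ab`, and `xb` is moved to the second path. -/
theorem link_split {k : ℕ} (hk : 3 ≤ k) (hg : ((2 * k - 2 : ℕ) : ℕ∞) ≤ G.egirth)
    (fa fb : Bool) {a b α β : V} {A B : List V}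
    (hA : (a :: A).Nodup) (hB : (b :: B).Nodup)
    (hAl : A.length = 2 * k - 1 ∨ A.length = 2 * k ∧ fa = false)
    (hBl : B.length = 2 * k - 1 ∨ B.length = 2 * k ∧ fb = false)
    (hab : a ∈ b :: B) (hba : b ∈ a :: A)
    (hα : (a :: A).getLast? = some α) (hβ : (b :: B).getLast? = some β)
    (hfa : fa = true → α ≠ b) (hfb : fb = true → β ≠ a)
    (hfab : fa = true → fb = true → α ≠ β)
    (h : EdgeDistinct G (s(a, b) ::ₘ (pathEdges (a :: A) + pathEdges (b :: B)))) :
    ∃ P Q : List V, P.Nodup ∧ Q.Nodup ∧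
      pathEdges P + pathEdges Q = s(a, b) ::ₘ (pathEdges (a :: A) + pathEdges (b :: B)) ∧
      (2 * k ≤ P.length ∧ P.length ≤ 2 * k + 2) ∧ (2 * k ≤ Q.length ∧ Q.length ≤ 2 * k + 2) ∧
      (fa = true → IsEnd α P ∧ P.length ≤ 2 * k + 1) ∧
      (fb = true → IsEnd β Q ∧ Q.length ≤ 2 * k + 1) := by
  rcases hk.eq_or_lt with rfl | hk
  · exact link_split_six (triangleFree_of_egirth hg) fa fb hA hB hAl hBl hab hba hα hβ hfa hfb
      hfab h
  have hne : a ≠ b := (h.adj (Multiset.mem_cons_self _ _)).ne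
  obtain ⟨S, T, rfl⟩ := List.append_of_mem ((List.mem_cons.1 hba).resolve_left hne.symm)
  obtain ⟨p, q, rfl⟩ := List.append_of_mem ((List.mem_cons.1 hab).resolve_left hne)
  rcases List.eq_nil_or_concat S with rfl | ⟨S, x, rfl⟩
  · have := h.1
    simp at this
  rw [List.concat_eq_append] at *
  have hAe : pathEdges (a :: (S ++ [x] ++ b :: T)) =
      s(x, b) ::ₘ (pathEdges (a :: S ++ [x]) + pathEdges (b :: T)) := by
    have e : a :: (S ++ [x] ++ b :: T) = (a :: S) ++ x :: b :: T := by simp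
    rw [e, pathEdges_append_cons (a :: S) x (b :: T), pathEdges_cons_cons, Multiset.add_cons]
  rw [hAe] at h ⊢
  -- otherwise `x` and `a` are close to each other on the second path
  have hx : x ∉ b :: (p ++ a :: q) := by
    intro hx
    have hxb : x ≠ b := by
      rintro rfl; simp [List.nodup_append] at hA
    have hxa : x ≠ a := by
      rintro rfl; simp at hA
    have h1 : ∀ {y : V} {C D : List V}, p ++ a :: q = C ++ y :: D →
        s(y, b) ∈ s(a, b) ::ₘ s(x, b) ::ₘ (0 : Multiset (Sym2 V)) → 2 * k - 2 ≤ C.length + 2 := by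
      intro y C D hCD hy
      have := le_length_of_closed_trail hg b (C ++ [y]) (h.mono (by
        have e : b :: (C ++ [y]) ++ [b] = (b :: C) ++ [y, b] := by simp
        rw [e, pathEdges_concat_concat, Multiset.cons_add]
        have h2 : pathEdges (b :: C ++ [y]) ≤ pathEdges (b :: (p ++ a :: q)) :=
          pathEdges_le_of_infix ⟨[], D, by rw [hCD]; simp⟩
        have h3 : {s(y, b)} ≤ s(a, b) ::ₘ s(x, b) ::ₘ (0 : Multiset (Sym2 V)) :=
          Multiset.singleton_le.2 hy
        calc _ = {s(y, b)} + pathEdges (b :: C ++ [y]) := (Multiset.singleton_add _ _).symm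
          _ ≤ (s(a, b) ::ₘ s(x, b) ::ₘ 0) + (pathEdges (a :: S ++ [x]) + pathEdges (b :: T) +
              pathEdges (b :: (p ++ a :: q))) :=
            add_le_add h3 (h2.trans (Multiset.le_add_left _ _))
          _ = _ := by simp))
      simpa using this
    have h2 : ∀ {y z : V} {C D E : List V}, p ++ a :: q = C ++ y :: D ++ z :: E →
        s(z, b) ::ₘ s(b, y) ::ₘ (0 : Multiset (Sym2 V)) = s(a, b) ::ₘ s(x, b) ::ₘ 0 →
        2 * k - 2 ≤ D.length + 3 := by
      intro y z C D E hCD hy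
      have := le_length_of_closed_trail hg y (D ++ [z, b]) (h.mono (by
        have e : y :: (D ++ [z, b]) ++ [y] = (y :: D ++ [z]) ++ [b, y] := by simp
        have e' : (y :: D ++ [z]) ++ [b] = (y :: D) ++ [z, b] := by simp
        have h2 : pathEdges (y :: D ++ [z]) ≤ pathEdges (b :: (p ++ a :: q)) :=
          pathEdges_le_of_infix ⟨b :: C, E, by rw [hCD]; simp⟩
        rw [e, pathEdges_concat_concat, e', pathEdges_concat_concat, Multiset.cons_swap]
        calc _ = (s(z, b) ::ₘ s(b, y) ::ₘ 0) + pathEdges (y :: D ++ [z]) := by simp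
          _ ≤ (s(a, b) ::ₘ s(x, b) ::ₘ 0) + (pathEdges (a :: S ++ [x]) + pathEdges (b :: T) +
              pathEdges (b :: (p ++ a :: q))) :=
            add_le_add hy.le (h2.trans (Multiset.le_add_left _ _))
          _ = _ := by simp))
      simpa using this
    have hxB : x ∈ p ++ a :: q := (List.mem_cons.1 hx).resolve_left hxb
    rcases exists_append_of_mem_of_mem (x := a) (y := x) (l := p ++ a :: q) (by simp) hxB
      hxa.symm with ⟨C, D, E, hl⟩ | ⟨C, D, E, hl⟩
    · have h3 := h1 (y := a) (C := C) (D := D ++ x :: E) (by rw [hl]; simp) (by simp)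
      have h4 := h2 hl (by rw [Multiset.cons_swap, Sym2.eq_swap])
      rw [hl] at hBl
      simp at hBl; omega
    · have h3 := h1 (y := x) (C := C) (D := D ++ a :: E) (by rw [hl]; simp) (by simp)
      have h4 := h2 hl (by rw [Sym2.eq_swap (a := b)])
      rw [hl] at hBl
      simp at hBl; omega
  refine ⟨(a :: S ++ [x]).reverse ++ b :: T, x :: b :: (p ++ a :: q), ?_,
    List.nodup_cons.2 ⟨hx, hB⟩, ?_, ?_, ?_, fun hf => ?_, fun hf => ⟨Or.inr ?_, ?_⟩⟩
  · have e : a :: (S ++ [x] ++ b :: T) = (a :: S ++ [x]) ++ b :: T := by simp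
    rw [e] at hA
    exact (((List.reverse_perm _).append_right _).nodup_iff).2 hA
  · have e : (a :: S ++ [x]).reverse ++ b :: T = (x :: S.reverse) ++ a :: b :: T := by simp
    have e' : pathEdges (x :: S.reverse ++ [a]) = pathEdges (a :: S ++ [x]) := by
      rw [← pathEdges_reverse]; simp
    rw [e, pathEdges_append_cons (x :: S.reverse) a (b :: T), e', pathEdges_cons_cons,
      pathEdges_cons_cons x b]
    simp only [Multiset.add_cons, Multiset.cons_add]
    rw [Multiset.cons_swap]
  · simp at hAl ⊢; omega
  · simp at hBl ⊢; omega
  · have hαT : (b :: T).getLast? = some α := by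
      have e : a :: (S ++ [x] ++ b :: T) = (a :: S ++ [x]) ++ b :: T := by simp
      rw [e, List.getLast?_append_of_ne_nil _ (by simp)] at hα
      exact hα
    refine ⟨Or.inr (by rw [List.getLast?_append_of_ne_nil _ (by simp), hαT]), ?_⟩
    rw [hf] at hAl
    simp at hAl ⊢; omega
  · rw [List.getLast?_cons, hβ]; rfl
  · rw [hf] at hBl
    simp at hBl ⊢; omega

end Walks


/-! ### Systems of paths with live ends -/

section Ends

variable {V : Type*}

theorem isEnd_reverse {x : V} {l : List V} : IsEnd x l.reverse ↔ IsEnd x l := by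
  simp [IsEnd, or_comm]

/-- A path can be traversed from either of its ends. -/
theorem IsEnd.exists_cons {x : V} {l : List V} (h : IsEnd x l) : ∃ A, pathEdges (x :: A) =
    pathEdges l ∧ (x :: A).Perm l ∧ ∀ y, IsEnd y (x :: A) ↔ IsEnd y l := by
  have key : ∀ {l : List V}, l.head? = some x → ∃ A, l = x :: A := by
    intro l h
    cases l with
    | nil => simp at h
    | cons y A => exact ⟨A, by simpa using h⟩
  rcases h with h | h
  · obtain ⟨A, rfl⟩ := key h
    exact ⟨A, rfl, List.Perm.refl _, fun y => Iff.rfl⟩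
  · obtain ⟨A, hA⟩ := key (l := l.reverse) (by simpa using h)
    exact ⟨A, by rw [← hA, pathEdges_reverse], by rw [← hA]; exact List.reverse_perm l,
      fun y => by rw [← hA, isEnd_reverse]⟩

theorem IsEnd.mem {x : V} {l : List V} (h : IsEnd x l) : x ∈ l :=
  h.elim List.mem_of_head? List.mem_of_getLast?

theorem IsEnd.getLast?_eq {x y : V} {A : List V} (h : IsEnd y (x :: A)) (hxy : y ≠ x) :
    (x :: A).getLast? = some y :=
  h.resolve_left fun h' => hxy (by simpa using h'.symm)

theorem IsEnd.cons {x y z : V} {A : List V} (h : IsEnd y (x :: A)) (hxy : y ≠ x) :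
    IsEnd y (z :: x :: A) :=
  Or.inr (by rw [List.getLast?_cons, h.getLast?_eq hxy]; rfl)

theorem edgeDistinct_edgeFinset [Fintype V] {G : SimpleGraph V} [DecidableRel G.Adj] :
    EdgeDistinct G G.edgeFinset.val :=
  ⟨G.edgeFinset.nodup, fun e he => by simpa using he⟩

end Ends

section Sums

variable {V ι : Type*} [Fintype ι] [DecidableEq ι]

theorem sum_pathEdges_add {l l' : ι → List V} (J : Finset ι) (h : ∀ i ∉ J, l' i = l i) :
    ∑ i, pathEdges (l' i) + ∑ i ∈ J, pathEdges (l i) =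
      ∑ i, pathEdges (l i) + ∑ i ∈ J, pathEdges (l' i) := by
  have h' : ∑ i ∈ Jᶜ, pathEdges (l' i) = ∑ i ∈ Jᶜ, pathEdges (l i) :=
    Finset.sum_congr rfl fun i hi => by rw [h i (Finset.mem_compl.1 hi)]
  rw [← Finset.sum_add_sum_compl J fun i => pathEdges (l' i),
    ← Finset.sum_add_sum_compl J fun i => pathEdges (l i), h']
  abel

end Sums

section MatchEdges

variable {V : Type*} [DecidableEq V] {m : V → V}

/-- The edges `x (m x)` at the vertices `x` of `L`, for a fixed-point-free involution `m`. -/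
def matchEdges (m : V → V) (L : Finset V) : Multiset (Sym2 V) := (L.image fun x => s(x, m x)).val

theorem matchEdges_empty : matchEdges m ∅ = 0 := rfl

theorem matchEdges_eq_cons (hm : ∀ x, m (m x) = x) {L : Finset V} {a : V} (ha : a ∈ L) :
    matchEdges m L = s(a, m a) ::ₘ matchEdges m (L \ {a, m a}) := by
  have h : L.image (fun x => s(x, m x)) =
      insert s(a, m a) ((L \ {a, m a}).image fun x => s(x, m x)) := by
    ext e
    simp only [Finset.mem_image, Finset.mem_insert, Finset.mem_sdiff, Finset.mem_singleton]
    constructor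
    · rintro ⟨x, hx, rfl⟩
      by_cases hxa : x = a ∨ x = m a
      · rcases hxa with rfl | rfl
        · exact Or.inl rfl
        · left; rw [hm, Sym2.eq_swap]
      · exact Or.inr ⟨x, ⟨hx, hxa⟩, rfl⟩
    · rintro (rfl | ⟨x, hx, rfl⟩)
      · exact ⟨a, ha, rfl⟩
      · exact ⟨x, hx.1, rfl⟩
  rw [matchEdges, h, Finset.insert_val_of_notMem]
  · rfl
  · simp only [Finset.mem_image, Finset.mem_sdiff, Finset.mem_insert, Finset.mem_singleton,
      not_exists, not_and, and_imp, not_or]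
    intro x _ hxa hxm h
    rcases Sym2.eq_iff.1 h with h | h
    · exact hxa h.1
    · exact hxm h.1

end MatchEdges

section States

variable {V ι : Type*} [Fintype V] [DecidableEq V] [Fintype ι] [DecidableEq ι]
  {G : SimpleGraph V} [DecidableRel G.Adj] {k : ℕ} {m : V → V}

/-- A system of paths `l i` that covers all edges of `G` except those edges `x (m x)` of a perfect
matching for which `x` is *live*, that is, belongs to `L`. A live vertex `x` is an end of the path
number `p x`, and this path is short enough to be prolonged at all its live ends. -/
structure PathSystem (G : SimpleGraph V) [DecidableRel G.Adj] (k : ℕ) (m : V → V)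
    (l : ι → List V) (L : Finset V) (p : V → ι) : Prop where
  nodup : ∀ i, (l i).Nodup
  le_length : ∀ i, 2 * k ≤ (l i).length
  length_le : ∀ i, (l i).length + (L.filter fun x => p x = i).card ≤ 2 * k + 2
  isEnd : ∀ x ∈ L, IsEnd x (l (p x))
  matched : ∀ x ∈ L, m x ∈ L
  edges : ∑ i, pathEdges (l i) + matchEdges m L = G.edgeFinset.val

variable {l : ι → List V} {L : Finset V} {p : V → ι}

/-- The paths that end in two live vertices `a` and `m a` are replaced by two paths `P` and `Q` that
contain the edge `a (m a)` in addition. -/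
theorem PathSystem.replace (h : PathSystem G k m l L p) (hm : ∀ x, m (m x) = x) {a : V}
    (ha : a ∈ L) (hp : p (m a) ≠ p a) {P Q : List V} (hP : P.Nodup) (hQ : Q.Nodup)
    (hPQ : pathEdges P + pathEdges Q =
      s(a, m a) ::ₘ (pathEdges (l (p a)) + pathEdges (l (p (m a)))))
    (hPl : 2 * k ≤ P.length ∧ P.length ≤ 2 * k + 2) (hQl : 2 * k ≤ Q.length ∧ Q.length ≤ 2 * k + 2)
    (hPe : ∀ x ∈ L \ {a, m a}, p x = p a → IsEnd x P ∧ P.length ≤ 2 * k + 1)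
    (hQe : ∀ x ∈ L \ {a, m a}, p x = p (m a) → IsEnd x Q ∧ Q.length ≤ 2 * k + 1) :
    ∃ l' : ι → List V, PathSystem G k m l' (L \ {a, m a}) p := by
  -- at most one further live vertex is an end of each of the two paths
  have hother : ∀ b ∈ ({a, m a} : Finset V),
      ((L \ {a, m a}).filter fun x => p x = p b).card ≤ 1 := by
    intro b hb
    have hbL : b ∈ L := by
      rcases Finset.mem_insert.1 hb with rfl | hb
      · exact ha
      · rw [Finset.mem_singleton.1 hb]; exact h.matched a ha
    have h1 := h.length_le (p b)
    have h2 := h.le_length (p b)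
    have h3 : ((L \ {a, m a}).filter fun x => p x = p b).card <
        (L.filter fun x => p x = p b).card := by
      refine Finset.card_lt_card ⟨Finset.filter_subset_filter _ Finset.sdiff_subset, fun hs => ?_⟩
      have := hs (Finset.mem_filter.2 ⟨hbL, rfl⟩)
      exact (Finset.mem_sdiff.1 (Finset.mem_filter.1 this).1).2 hb
    omega
  have hbound : ∀ {b : V} {R : List V}, b ∈ ({a, m a} : Finset V) → R.length ≤ 2 * k + 2 →
      (∀ x ∈ L \ {a, m a}, p x = p b → IsEnd x R ∧ R.length ≤ 2 * k + 1) →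
      R.length + ((L \ {a, m a}).filter fun x => p x = p b).card ≤ 2 * k + 2 := by
    intro b R hb hR he
    have h1 := hother b hb
    rcases Finset.eq_empty_or_nonempty ((L \ {a, m a}).filter fun x => p x = p b) with h2 | ⟨x, hx⟩
    · rw [h2]; simpa using hR
    · have := (he x (Finset.mem_filter.1 hx).1 (Finset.mem_filter.1 hx).2).2
      omega
  let l' : ι → List V := fun i => if i = p a then P else if i = p (m a) then Q else l i
  have hla : l' (p a) = P := by simp [l']
  have hlb : l' (p (m a)) = Q := by simp [l', hp]
  have hlo : ∀ i, i ≠ p a → i ≠ p (m a) → l' i = l i := fun i h1 h2 => by simp [l', h1, h2]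
  have hcases : ∀ {C : ι → Prop}, C (p a) → C (p (m a)) →
      (∀ i, i ≠ p a → i ≠ p (m a) → C i) → ∀ i, C i := by
    intro C h1 h2 h3 i
    by_cases hi : i = p a
    · rwa [hi]
    · by_cases hi' : i = p (m a)
      · rwa [hi']
      · exact h3 i hi hi'
  refine ⟨l', hcases (by rwa [hla]) (by rwa [hlb]) fun i h1 h2 => by
    rw [hlo i h1 h2]; exact h.nodup i, hcases (by rw [hla]; exact hPl.1) (by rw [hlb]; exact hQl.1)
    fun i h1 h2 => by rw [hlo i h1 h2]; exact h.le_length i, ?_, fun x hx => ?_, fun x hx => ?_, ?_⟩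
  · refine hcases ?_ ?_ fun i h1 h2 => ?_
    · rw [hla]; exact hbound (by simp) hPl.2 hPe
    · rw [hlb]; exact hbound (by simp) hQl.2 hQe
    · rw [hlo i h1 h2]
      refine le_trans (Nat.add_le_add_left (Finset.card_le_card ?_) _) (h.length_le i)
      exact Finset.filter_subset_filter _ Finset.sdiff_subset
  · by_cases h1 : p x = p a
    · rw [h1, hla]; exact (hPe x hx h1).1
    · by_cases h2 : p x = p (m a)
      · rw [h2, hlb]; exact (hQe x hx h2).1
      · rw [hlo _ h1 h2]; exact h.isEnd x (Finset.mem_sdiff.1 hx).1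
  · simp only [Finset.mem_sdiff, Finset.mem_insert, Finset.mem_singleton, not_or] at hx ⊢
    refine ⟨h.matched x hx.1, fun h1 => hx.2.2 ?_, fun h1 => hx.2.1 ?_⟩
    · rw [← h1, hm]
    · rw [← hm x, h1, hm]
  · have h1 := sum_pathEdges_add {p a, p (m a)} (l := l) (l' := l') fun i hi => by
      simp only [Finset.mem_insert, Finset.mem_singleton, not_or] at hi
      exact hlo i hi.1 hi.2
    rw [Finset.sum_pair hp.symm, Finset.sum_pair hp.symm, hla, hlb, hPQ] at h1
    rw [← h.edges, matchEdges_eq_cons hm ha]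
    have h2 : ∑ i, pathEdges (l' i) = s(a, m a) ::ₘ ∑ i, pathEdges (l i) := by
      rw [Multiset.add_cons, ← Multiset.cons_add] at h1
      exact add_right_cancel h1
    rw [h2, Multiset.add_cons, Multiset.cons_add]

/-- If no missing matching edge is a loop, that is, joins the two ends of one path, then all missing
matching edges can be added to the paths. -/
theorem PathSystem.complete (hk : 3 ≤ k) (hg : ((2 * k - 2 : ℕ) : ℕ∞) ≤ G.egirth)
    (hm : ∀ x, m (m x) = x) (h : PathSystem G k m l L p)
    (hloop : ∀ x ∈ L, p (m x) ≠ p x) : ∃ l' : ι → List V, PathSystem G k m l' ∅ p := by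
  induction hn : L.card using Nat.strong_induction_on generalizing l L with
  | _ n ih =>
  subst hn
  rcases L.eq_empty_or_nonempty with rfl | ⟨a, ha⟩
  · exact ⟨l, h⟩
  suffices hs : ∃ l' : ι → List V, PathSystem G k m l' (L \ {a, m a}) p by
    obtain ⟨l', hl'⟩ := hs
    refine ih _ (Finset.card_lt_card ⟨Finset.sdiff_subset, fun hs => ?_⟩) hl'
      (fun x hx => hloop x (Finset.mem_sdiff.1 hx).1) rfl
    have := hs ha
    simp at this
  have hb := h.matched a ha
  have hp := hloop a ha
  have hother : ∀ {b x : V}, b ∈ L → x ∈ L → x ≠ b → p x = p b → (l (p b)).length = 2 * k := by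
    intro b x hb hx hxb hpx
    have h1 := h.length_le (p b)
    have h2 := h.le_length (p b)
    have h3 : 2 ≤ (L.filter fun x => p x = p b).card := by
      have : ({x, b} : Finset V) ⊆ L.filter fun x => p x = p b := by
        intro y hy
        rcases Finset.mem_insert.1 hy with rfl | hy
        · exact Finset.mem_filter.2 ⟨hx, hpx⟩
        · rw [Finset.mem_singleton.1 hy]; exact Finset.mem_filter.2 ⟨hb, rfl⟩
      calc 2 = ({x, b} : Finset V).card := (Finset.card_pair hxb).symm
        _ ≤ _ := Finset.card_le_card this
    omega
  have hlen : ∀ {b : V}, b ∈ L → (l (p b)).length ≤ 2 * k + 1 := by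
    intro b hb
    have h1 := h.length_le (p b)
    have h3 : 0 < (L.filter fun x => p x = p b).card :=
      Finset.card_pos.2 ⟨b, Finset.mem_filter.2 ⟨hb, rfl⟩⟩
    omega
  have hmem : ∀ {x : V}, x ∈ L \ {a, m a} → x ∈ L ∧ x ≠ a ∧ x ≠ m a := fun hx => by
    simpa [not_or] using hx
  obtain ⟨A, hAe, hAp, hAend⟩ := (h.isEnd a ha).exists_cons
  obtain ⟨B, hBe, hBp, hBend⟩ := (h.isEnd _ hb).exists_cons
  have hAl : A.length + 1 = (l (p a)).length := by simpa using hAp.length_eq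
  have hBl : B.length + 1 = (l (p (m a))).length := by simpa using hBp.length_eq
  have hA0 := h.le_length (p a)
  have hB0 := h.le_length (p (m a))
  have hA1 := hlen ha
  have hB1 := hlen hb
  -- the edge `a (m a)` prolongs one of the two paths, unless each of them contains both vertices
  by_cases hba : m a ∈ l (p a)
  swap
  · refine h.replace hm ha hp (P := m a :: a :: A) (Q := l (p (m a)))
      (List.nodup_cons.2 ⟨fun h' => hba (hAp.mem_iff.1 h'), hAp.nodup_iff.2 (h.nodup _)⟩)
      (h.nodup _) ?_ (by simp; omega) (by omega) (fun x hx hpx => ?_) fun x hx hpx => ?_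
    · rw [pathEdges_cons_cons, hAe, Multiset.cons_add, Sym2.eq_swap]
    · obtain ⟨h1, h2, h3⟩ := hmem hx
      refine ⟨((hAend x).2 (hpx ▸ h.isEnd x h1)).cons h2, ?_⟩
      have := hother ha h1 h2 hpx
      simp; omega
    · obtain ⟨h1, h2, h3⟩ := hmem hx
      exact ⟨hpx ▸ h.isEnd x h1, by omega⟩
  by_cases hab : a ∈ l (p (m a))
  swap
  · refine h.replace hm ha hp (P := l (p a)) (Q := a :: m a :: B) (h.nodup _)
      (List.nodup_cons.2 ⟨fun h' => hab (hBp.mem_iff.1 h'), hBp.nodup_iff.2 (h.nodup _)⟩)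
      ?_ (by omega) (by simp; omega) (fun x hx hpx => ?_) fun x hx hpx => ?_
    · rw [pathEdges_cons_cons, hBe, Multiset.add_cons]
    · obtain ⟨h1, h2, h3⟩ := hmem hx
      exact ⟨hpx ▸ h.isEnd x h1, by omega⟩
    · obtain ⟨h1, h2, h3⟩ := hmem hx
      refine ⟨((hBend x).2 (hpx ▸ h.isEnd x h1)).cons h3, ?_⟩
      have := hother hb h1 h3 hpx
      simp; omega
  classical
  have hα := List.getLast?_eq_some_getLast (show a :: A ≠ [] by simp)
  have hβ := List.getLast?_eq_some_getLast (show m a :: B ≠ [] by simp)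
  generalize (a :: A).getLast _ = α at hα
  generalize (m a :: B).getLast _ = β at hβ
  have hαx : ∀ {x : V}, x ∈ L \ {a, m a} → p x = p a → x = α := fun {x} hx hpx => by
    obtain ⟨h1, h2, h3⟩ := hmem hx
    have := ((hAend x).2 (hpx ▸ h.isEnd x h1)).getLast?_eq h2
    rw [hα] at this
    exact (Option.some.inj this).symm
  have hβx : ∀ {x : V}, x ∈ L \ {a, m a} → p x = p (m a) → x = β := fun {x} hx hpx => by
    obtain ⟨h1, h2, h3⟩ := hmem hx
    have := ((hBend x).2 (hpx ▸ h.isEnd x h1)).getLast?_eq h3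
    rw [hβ] at this
    exact (Option.some.inj this).symm
  have hfα : ∀ x ∈ L \ {a, m a}, p x = p a → α ∈ L \ {a, m a} ∧ p α = p a := fun x hx hpx => by
    rw [← hαx hx hpx]; exact ⟨hx, hpx⟩
  have hfβ : ∀ x ∈ L \ {a, m a}, p x = p (m a) → β ∈ L \ {a, m a} ∧ p β = p (m a) :=
    fun x hx hpx => by rw [← hβx hx hpx]; exact ⟨hx, hpx⟩
  have hed : EdgeDistinct G (s(a, m a) ::ₘ (pathEdges (a :: A) + pathEdges (m a :: B))) := by
    refine edgeDistinct_edgeFinset.mono ?_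
    rw [← h.edges, matchEdges_eq_cons hm ha, Multiset.add_cons, hAe, hBe]
    refine Multiset.cons_le_cons _ (le_trans ?_ (Multiset.le_add_right _ _))
    rw [← Finset.sum_pair (f := fun i => pathEdges (l i)) hp.symm]
    exact Finset.sum_le_sum_of_subset (Finset.subset_univ _)
  obtain ⟨P, Q, hP, hQ, hPQ, hPl, hQl, hPe, hQe⟩ := link_split hk hg
    (decide (α ∈ L \ {a, m a} ∧ p α = p a)) (decide (β ∈ L \ {a, m a} ∧ p β = p (m a)))
    (hAp.nodup_iff.2 (h.nodup _)) (hBp.nodup_iff.2 (h.nodup _))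
    (by
      by_cases hf : α ∈ L \ {a, m a} ∧ p α = p a
      · left
        have := hother ha (hmem hf.1).1 (hmem hf.1).2.1 hf.2
        omega
      · rw [decide_eq_false hf]
        simp only [and_true]
        omega)
    (by
      by_cases hf : β ∈ L \ {a, m a} ∧ p β = p (m a)
      · left
        have := hother hb (hmem hf.1).1 (hmem hf.1).2.2 hf.2
        omega
      · rw [decide_eq_false hf]
        simp only [and_true]
        omega)
    (hBp.mem_iff.2 hab) (hAp.mem_iff.2 hba) hα hβ
    (fun hf => (hmem (of_decide_eq_true hf).1).2.2) (fun hf => (hmem (of_decide_eq_true hf).1).2.1)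
    (fun hf hf' h' => hp (by
      rw [← (of_decide_eq_true hf').2, ← (of_decide_eq_true hf).2, h'])) hed
  rw [hAe, hBe] at hPQ
  refine h.replace hm ha hp hP hQ hPQ hPl hQl (fun x hx hpx => ?_) fun x hx hpx => ?_
  · rw [hαx hx hpx]
    exact hPe (decide_eq_true (hfα x hx hpx))
  · rw [hβx hx hpx]
    exact hQe (decide_eq_true (hfβ x hx hpx))

end States


/-! ### Splitting cycles and paths that meet -/

section Cycles

variable {V : Type*} {G : SimpleGraph V} {k : ℕ}

/-- A cycle can be read from any of its vertices. -/
theorem exists_cycleEdges_cons {x : V} {Z : List V} (hx : x ∈ Z) :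
    ∃ Z', (x :: Z').Perm Z ∧ cycleEdges (x :: Z') = cycleEdges Z := by
  obtain ⟨p, q, rfl⟩ := List.append_of_mem hx
  refine ⟨q ++ p, ?_, ?_⟩
  · rw [← List.cons_append]
    exact List.perm_append_comm
  · rw [← List.cons_append, cycleEdges_append]

theorem closed_split_of_mem (hk : 3 ≤ k) (hg : ((2 * k - 2 : ℕ) : ℕ∞) ≤ G.egirth) {x : V}
    {Z Z' : List V} (hZ : Z.Nodup) (hZ' : Z'.Nodup) (hZl : Z.length = 2 * k)
    (hZl' : Z'.length = 2 * k) (hx : x ∈ Z) (hx' : x ∈ Z')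
    (h : EdgeDistinct G (cycleEdges Z + cycleEdges Z')) :
    ∃ P Q : List V, P.Nodup ∧ Q.Nodup ∧
      pathEdges P + pathEdges Q = cycleEdges Z + cycleEdges Z' ∧
      P.length = 2 * k + 1 ∧ Q.length = 2 * k + 1 := by
  obtain ⟨W, hW, hWe⟩ := exists_cycleEdges_cons hx
  obtain ⟨W', hW', hWe'⟩ := exists_cycleEdges_cons hx'
  have h1 := hW.length_eq
  have h2 := hW'.length_eq
  rw [← hWe, ← hWe'] at h ⊢
  simp only [List.length_cons] at h1 h2
  exact closed_split hk hg (hW.nodup_iff.2 hZ) (hW'.nodup_iff.2 hZ') (by omega) (by omega) h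

theorem exists_first_mem {Z B : List V} (h : ∃ x ∈ B, x ∈ Z) :
    ∃ B₁ x B₂, B = B₁ ++ x :: B₂ ∧ x ∈ Z ∧ ∀ y ∈ B₁, y ∉ Z := by
  classical
  induction B with
  | nil => simp at h
  | cons a B ih =>
    by_cases ha : a ∈ Z
    · exact ⟨[], a, B, rfl, ha, by simp⟩
    · obtain ⟨x, hx, hxZ⟩ := h
      have hxB : x ∈ B := (List.mem_cons.1 hx).resolve_left (by rintro rfl; exact ha hxZ)
      obtain ⟨B₁, y, B₂, rfl, hy, hB₁⟩ := ih ⟨x, hxB, hxZ⟩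
      refine ⟨a :: B₁, y, B₂, rfl, hy, fun z hz => ?_⟩
      rcases List.mem_cons.1 hz with rfl | hz
      · exact ha
      · exact hB₁ z hz

theorem mem_right_of_length_lt {y : V} {p q r s : List V} (h : p ++ y :: q = r ++ s)
    (hl : q.length < s.length) : y ∈ s := by
  rcases List.append_eq_append_iff.1 h with ⟨a, -, ha⟩ | ⟨a, -, ha⟩
  · cases a with
    | nil => rw [List.nil_append] at ha; rw [← ha]; simp
    | cons b a =>
      have := congrArg List.length ha
      simp at this; omega
  · rw [ha]; simp

theorem absorb_split_of_mem (hk : 3 ≤ k) (hg : ((2 * k - 2 : ℕ) : ℕ∞) ≤ G.egirth)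
    {Z B : List V} (hZ : Z.Nodup) (hB : B.Nodup) (hZl : Z.length = 2 * k)
    (hBl : B.length = 2 * k + 1) (hmeet : ∃ x ∈ B, x ∈ Z)
    (h : EdgeDistinct G (cycleEdges Z + pathEdges B)) :
    ∃ P Q : List V, P.Nodup ∧ Q.Nodup ∧
      pathEdges P + pathEdges Q = cycleEdges Z + pathEdges B ∧
      (2 * k ≤ P.length ∧ P.length ≤ 2 * k + 2) ∧ (2 * k ≤ Q.length ∧ Q.length ≤ 2 * k + 2) := by
  obtain ⟨B₁, x, B₂, hB12, hx, hfirst⟩ := exists_first_mem hmeet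
  obtain ⟨C₁, y, C₂, hC12, hy, hlast⟩ := exists_first_mem (Z := Z) (B := B.reverse)
    (by simpa using hmeet)
  -- the path is read from the end that is nearer to the cycle
  have key : ∀ {B B₁ B₂ C₁ C₂ : List V} {x y : V}, B.Nodup → B.length = 2 * k + 1 →
      EdgeDistinct G (cycleEdges Z + pathEdges B) →
      B = B₁ ++ x :: B₂ → B.reverse = C₁ ++ y :: C₂ → x ∈ Z → (∀ y ∈ B₁, y ∉ Z) →
      (∀ y ∈ C₁, y ∉ Z) → B₁.length ≤ C₁.length → ∃ P Q : List V, P.Nodup ∧ Q.Nodup ∧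
      pathEdges P + pathEdges Q = cycleEdges Z + pathEdges B ∧
      (2 * k ≤ P.length ∧ P.length ≤ 2 * k + 2) ∧
      (2 * k ≤ Q.length ∧ Q.length ≤ 2 * k + 2) := by
    rintro B B₁ B₂ C₁ C₂ x y hB hBl h rfl hC hx hfirst hlast hle
    have hC' : B₁ ++ x :: B₂ = (C₂.reverse ++ [y]) ++ C₁.reverse := by
      rw [← List.reverse_reverse (B₁ ++ x :: B₂), hC]; simp
    have hafter : ∀ z p q, p ++ z :: q = B₁ ++ x :: B₂ → z ∈ Z → B₁.length ≤ q.length := by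
      intro z p q hpq hz
      by_contra hlt
      refine hlast z ?_ hz
      rw [← List.mem_reverse]
      exact mem_right_of_length_lt (hpq.trans hC') (by rw [List.length_reverse]; omega)
    obtain ⟨W, hW, hWe⟩ := exists_cycleEdges_cons hx
    have h1 := hW.length_eq
    simp only [List.length_cons] at h1
    rw [← hWe] at h ⊢
    refine absorb_split hk hg (hW.nodup_iff.2 hZ) hB (by omega) hBl
      (fun z hz hzW => hfirst z hz (hW.mem_iff.1 hzW)) (hafter x B₁ B₂ rfl hx) ?_ h
    rintro z C D rfl hzW
    exact hafter z (B₁ ++ x :: C) D (by simp) (hW.mem_iff.1 (List.mem_cons_of_mem _ hzW))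
  rcases le_total B₁.length C₁.length with hle | hle
  · exact key hB hBl h hB12 hC12 hx hfirst hlast hle
  · have := key (B := B.reverse) (List.nodup_reverse.2 hB) (by simpa using hBl)
      (by rwa [pathEdges_reverse]) hC12 (by rw [List.reverse_reverse]; exact hB12) hy hlast
      hfirst hle
    rwa [pathEdges_reverse] at this

theorem exists_mem_cycleEdges {x : V} {Z : List V} (hx : x ∈ Z) : ∃ e ∈ cycleEdges Z, x ∈ e := by
  obtain ⟨W, -, hWe⟩ := exists_cycleEdges_cons hx
  rw [← hWe]
  cases W with
  | nil => exact ⟨s(x, x), by simp [cycleEdges], by simp⟩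
  | cons y W => exact ⟨s(x, y), by simp [cycleEdges], by simp⟩

/-- Three cycles of length `2 * k`, of which the first and the third one meet the second one, split
into three paths. -/
theorem triple_split (hk : 3 ≤ k) (hg : ((2 * k - 2 : ℕ) : ℕ∞) ≤ G.egirth) {x y : V}
    {Z₁ Z₂ Z₃ : List V} (hZ₁ : Z₁.Nodup) (hZ₂ : Z₂.Nodup) (hZ₃ : Z₃.Nodup)
    (hl₁ : Z₁.length = 2 * k) (hl₂ : Z₂.length = 2 * k) (hl₃ : Z₃.length = 2 * k)
    (hx₁ : x ∈ Z₁) (hx₂ : x ∈ Z₂) (hy₂ : y ∈ Z₂) (hy₃ : y ∈ Z₃)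
    (h : EdgeDistinct G (cycleEdges Z₁ + cycleEdges Z₂ + cycleEdges Z₃)) :
    ∃ P Q R : List V, P.Nodup ∧ Q.Nodup ∧ R.Nodup ∧
      pathEdges P + pathEdges Q + pathEdges R = cycleEdges Z₁ + cycleEdges Z₂ + cycleEdges Z₃ ∧
      (2 * k ≤ P.length ∧ P.length ≤ 2 * k + 2) ∧ (2 * k ≤ Q.length ∧ Q.length ≤ 2 * k + 2) ∧
      (2 * k ≤ R.length ∧ R.length ≤ 2 * k + 2) := by
  obtain ⟨P, Q, hP, hQ, hPQ, hPl, hQl⟩ := closed_split_of_mem hk hg hZ₁ hZ₂ hl₁ hl₂ hx₁ hx₂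
    (h.mono (Multiset.le_add_right _ _))
  rw [← hPQ] at h ⊢
  obtain ⟨e, he, hye⟩ := exists_mem_cycleEdges hy₂
  have he' : e ∈ pathEdges P + pathEdges Q := by
    rw [hPQ]; exact Multiset.mem_add.2 (Or.inr he)
  have key : ∀ {P Q : List V}, P.Nodup → Q.Nodup → P.length = 2 * k + 1 →
      Q.length = 2 * k + 1 → e ∈ pathEdges Q →
      EdgeDistinct G (pathEdges P + pathEdges Q + cycleEdges Z₃) →
      ∃ P' Q' R : List V, P'.Nodup ∧ Q'.Nodup ∧ R.Nodup ∧
      pathEdges P' + pathEdges Q' + pathEdges R = pathEdges P + pathEdges Q + cycleEdges Z₃ ∧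
      (2 * k ≤ P'.length ∧ P'.length ≤ 2 * k + 2) ∧
      (2 * k ≤ Q'.length ∧ Q'.length ≤ 2 * k + 2) ∧
      (2 * k ≤ R.length ∧ R.length ≤ 2 * k + 2) := by
    intro P Q hP hQ hPl hQl he h
    obtain ⟨Q', R, hQ', hR, hQR, hQl', hRl⟩ := absorb_split_of_mem hk hg hZ₃ hQ hl₃ hQl
      ⟨y, mem_of_mem_pathEdges he hye, hy₃⟩ (h.mono (by
        rw [add_assoc, add_comm (pathEdges Q)]; exact Multiset.le_add_left _ _))
    refine ⟨P, Q', R, hP, hQ', hR, ?_, by omega, hQl', hRl⟩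
    rw [add_assoc, hQR, add_assoc, add_comm (pathEdges Q)]
  rcases Multiset.mem_add.1 he' with he' | he'
  · rw [add_comm (pathEdges P)] at h ⊢
    exact key hQ hP hQl hPl he' h
  · exact key hP hQ hPl hQl he' h

end Cycles

/-! ### Grouping loops -/

/-- For an injective map `π`, finitely many elements `T` with `π T ≠ T` can be covered by disjoint
groups of the form `T, π T` or `T, π T, π (π T)`, where all members of the groups of the second form
are among the given elements. -/
theorem exists_groups {ι : Type*} [DecidableEq ι] {π : ι → ι} (hπ : Function.Injective π)
    (U : Finset ι) (hne : ∀ T ∈ U, π T ≠ T) : ∃ Γ : List (List ι), Γ.flatten.Nodup ∧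
      (∀ g ∈ Γ, (∃ T ∈ U, g = [T, π T]) ∨
        ∃ T, T ∈ U ∧ π T ∈ U ∧ π (π T) ∈ U ∧ g = [T, π T, π (π T)]) ∧
      ∀ T ∈ U, T ∈ Γ.flatten := by
  induction U using Finset.induction_on with
  | empty => exact ⟨[], by simp⟩
  | insert T U hT ih =>
    obtain ⟨Γ, hnd, hform, hcov⟩ := ih fun S hS => hne S (Finset.mem_insert_of_mem hS)
    have hmono : ∀ {Γ : List (List ι)}, (∀ g ∈ Γ, (∃ T ∈ U, g = [T, π T]) ∨
        ∃ T, T ∈ U ∧ π T ∈ U ∧ π (π T) ∈ U ∧ g = [T, π T, π (π T)]) →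
        ∀ g ∈ Γ, (∃ S ∈ insert T U, g = [S, π S]) ∨ ∃ S, S ∈ insert T U ∧ π S ∈ insert T U ∧
          π (π S) ∈ insert T U ∧ g = [S, π S, π (π S)] := by
      intro Γ hform g hg
      rcases hform g hg with ⟨S, hS, rfl⟩ | ⟨S, h1, h2, h3, rfl⟩
      · exact Or.inl ⟨S, Finset.mem_insert_of_mem hS, rfl⟩
      · exact Or.inr ⟨S, Finset.mem_insert_of_mem h1, Finset.mem_insert_of_mem h2,
          Finset.mem_insert_of_mem h3, rfl⟩
    have hTT := hne T (Finset.mem_insert_self _ _)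
    have hTins : T ∈ insert T U := Finset.mem_insert_self _ _
    -- a new element `T` forms a group with `π T`, which may have to be taken out of its group
    by_cases hTΓ : T ∈ Γ.flatten
    · refine ⟨Γ, hnd, hmono hform, fun S hS => ?_⟩
      rcases Finset.mem_insert.1 hS with rfl | hS
      · exact hTΓ
      · exact hcov S hS
    by_cases hπT : π T ∈ Γ.flatten
    swap
    · refine ⟨[T, π T] :: Γ, ?_, ?_, ?_⟩
      · simp only [List.flatten_cons, List.cons_append, List.nil_append, List.nodup_cons,
          List.mem_cons, not_or]
        exact ⟨⟨hTT.symm, hTΓ⟩, hπT, hnd⟩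
      · intro g hg
        rcases List.mem_cons.1 hg with rfl | hg
        · exact Or.inl ⟨T, hTins, rfl⟩
        · exact hmono hform g hg
      · intro S hS
        rcases Finset.mem_insert.1 hS with rfl | hS
        · simp
        · exact by simpa using Or.inr (Or.inr (by simpa using hcov S hS))
    obtain ⟨g, hg, hπg⟩ := List.mem_flatten.1 hπT
    obtain ⟨Γ', hΓ'⟩ : ∃ Γ', Γ.Perm (g :: Γ') := ⟨_, List.perm_cons_erase hg⟩
    have hflat := hΓ'.flatten
    have hnd' := hflat.nodup_iff.1 hnd
    have hTg : T ∉ (g :: Γ').flatten := fun h => hTΓ (hflat.mem_iff.2 h)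
    have hform' : ∀ g ∈ Γ', _ := fun g hg =>
      hmono hform g (hΓ'.mem_iff.2 (List.mem_cons_of_mem _ hg))
    have hcov' : ∀ S ∈ insert T U, S = T ∨ S ∈ g ∨ S ∈ Γ'.flatten := by
      intro S hS
      rcases Finset.mem_insert.1 hS with rfl | hS
      · exact Or.inl rfl
      · right
        have := hflat.mem_iff.1 (hcov S hS)
        rwa [List.flatten_cons, List.mem_append] at this
    rcases hmono hform g hg with ⟨S, hS, rfl⟩ | ⟨S, h1, h2, h3, rfl⟩
    · have hST : π T = S := by
        simp only [List.mem_cons, List.not_mem_nil, or_false] at hπg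
        refine hπg.resolve_right fun h' => hTg ?_
        rw [hπ h']; simp
      subst hST
      by_cases hSU : π (π T) ∈ insert T U
      · refine ⟨[T, π T, π (π T)] :: Γ', ?_, ?_, ?_⟩
        · simpa using ⟨by simpa using hTg, by simpa using hnd'⟩
        · intro g hg
          rcases List.mem_cons.1 hg with rfl | hg
          · exact Or.inr ⟨T, hTins, hS, hSU, rfl⟩
          · exact hform' g hg
        · intro S hS
          have := hcov' S hS
          simp only [List.mem_cons, List.not_mem_nil, or_false] at this
          simp only [List.flatten_cons, List.mem_append, List.mem_cons, List.not_mem_nil, or_false]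
          tauto
      · refine ⟨[T, π T] :: Γ', ?_, ?_, ?_⟩
        · have h4 : (T :: ([π T, π (π T)] :: Γ').flatten).Nodup := List.nodup_cons.2 ⟨hTg, hnd'⟩
          refine h4.sublist ?_
          simp only [List.flatten_cons, List.cons_append, List.nil_append]
          exact ((List.sublist_cons_self _ _).cons_cons _).cons_cons _
        · intro g hg
          rcases List.mem_cons.1 hg with rfl | hg
          · exact Or.inl ⟨T, hTins, rfl⟩
          · exact hform' g hg
        · intro S hS'
          have := hcov' S hS'
          simp only [List.mem_cons, List.not_mem_nil, or_false] at this
          simp only [List.flatten_cons, List.mem_append, List.mem_cons, List.not_mem_nil, or_false]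
          have h5 : S ≠ π (π T) := by rintro rfl; exact hSU hS'
          tauto
    · have hST : π T = S := by
        simp only [List.mem_cons, List.not_mem_nil, or_false] at hπg
        rcases hπg with h' | h' | h'
        · exact h'
        · exact absurd (by rw [hπ h']; simp) hTg
        · exact absurd (by rw [hπ h']; simp) hTg
      subst hST
      refine ⟨[T, π T] :: [π (π T), π (π (π T))] :: Γ', ?_, ?_, ?_⟩
      · simpa using ⟨by simpa using hTg, by simpa using hnd'⟩
      · intro g hg
        rcases List.mem_cons.1 hg with rfl | hg
        · exact Or.inl ⟨T, hTins, rfl⟩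
        · rcases List.mem_cons.1 hg with rfl | hg
          · exact Or.inl ⟨_, h2, rfl⟩
          · exact hform' g hg
      · intro S hS
        have := hcov' S hS
        simp only [List.mem_cons, List.not_mem_nil, or_false] at this
        simp only [List.flatten_cons, List.mem_append, List.mem_cons, List.not_mem_nil, or_false]
        tauto


/-! ### Elimination of loops -/

section MatchEdges

variable {V : Type*} [DecidableEq V] {m : V → V}

theorem matchEdges_eq_add {L D : Finset V} (hD : ∀ x ∈ D, m x ∈ D)
    (h : D ⊆ L) : matchEdges m L = matchEdges m D + matchEdges m (L \ D) := by
  have hdis : Disjoint (D.image fun x => s(x, m x)) ((L \ D).image fun x => s(x, m x)) := by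
    rw [Finset.disjoint_left]
    simp only [Finset.mem_image, Finset.mem_sdiff]
    rintro _ ⟨x, hx, rfl⟩ ⟨y, hy, hxy⟩
    rcases Sym2.eq_iff.1 hxy with ⟨h1, -⟩ | ⟨h1, -⟩
    · exact hy.2 (h1 ▸ hx)
    · exact hy.2 (h1 ▸ hD x hx)
  rw [matchEdges, matchEdges, matchEdges, ← Finset.disjUnion_val _ _ hdis]
  · congr 1
    rw [Finset.disjUnion_eq_union, ← Finset.image_union, Finset.union_sdiff_of_subset h]

theorem matchEdges_pair (hm : ∀ x, m (m x) = x) (a : V) : matchEdges m {a, m a} = {s(a, m a)} := by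
  rw [matchEdges_eq_cons hm (Finset.mem_insert_self a _), Finset.sdiff_self, matchEdges_empty]
  rfl

end MatchEdges

section Ends

variable {V : Type*}

/-- A loop: the two ends of a path are joined by the matching edge, which closes the path to a
cycle. -/
theorem cycleEdges_of_ends {a b : V} {A : List V} (hab : a ≠ b) (ha : IsEnd a A) (hb : IsEnd b A) :
    cycleEdges A = s(a, b) ::ₘ pathEdges A := by
  have key : ∀ {a b : V} {A : List V}, a ≠ b → A.head? = some a → A.getLast? = some b →
      cycleEdges A = s(a, b) ::ₘ pathEdges A := by
    intro a b A hab ha hb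
    obtain ⟨A, rfl⟩ := List.head?_eq_some_iff.1 ha
    rcases List.eq_nil_or_concat A with rfl | ⟨B, c, rfl⟩
    · exact absurd (by simpa using hb) hab
    · rw [List.concat_eq_append, ← List.cons_append] at hb ⊢
      obtain rfl : c = b := by
        rw [List.getLast?_append] at hb
        simpa using hb
      rw [cycleEdges_eq, Sym2.eq_swap]
  rcases ha with ha | ha <;> rcases hb with hb | hb
  · exact absurd (Option.some.inj (ha.symm.trans hb)) hab
  · exact key hab ha hb
  · rw [Sym2.eq_swap]
    exact key hab.symm hb ha
  · exact absurd (Option.some.inj (ha.symm.trans hb)) hab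

theorem IsEnd.eq_or_eq {a b x : V} {A : List V} (hab : a ≠ b) (ha : IsEnd a A) (hb : IsEnd b A)
    (hx : IsEnd x A) : x = a ∨ x = b := by
  simp only [IsEnd] at ha hb hx
  rcases ha with ha | ha <;> rcases hb with hb | hb <;> rcases hx with hx | hx <;>
    rw [ha] at * <;> simp_all

end Ends


theorem card_ends_le {V ι : Type*} [Fintype V] [DecidableEq ι] {l₀ : ι → List V} {p₀ : V → ι}
    (hend : ∀ x i, IsEnd x (l₀ i) ↔ p₀ x = i) (i : ι) :
    (Finset.univ.filter fun x => p₀ x = i).card ≤ 2 := by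
  by_contra hcon
  obtain ⟨a, b, c, ha, hb, hc, hab, hac, hbc⟩ := Finset.two_lt_card_iff.1 (not_le.1 hcon)
  simp only [Finset.mem_filter, Finset.mem_univ, true_and, ← hend] at ha hb hc
  rcases IsEnd.eq_or_eq hab ha hb hc with h | h
  · exact hac h.symm
  · exact hbc h.symm

theorem two_le_countP_pathEdges {V : Type*} [DecidableEq V] {c : V} {A : List V} (hc : c ∈ A)
    (he : ¬ IsEnd c A) :
    2 ≤ (pathEdges A).countP (fun e => c ∈ e) := by
  obtain ⟨p, q, rfl⟩ := List.append_of_mem hc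
  rcases List.eq_nil_or_concat p with rfl | ⟨p, u, rfl⟩
  · exact absurd (Or.inl rfl) he
  cases q with
  | nil => exact absurd (Or.inr (by simp)) he
  | cons v q =>
    have h1 : pathEdges [u, c, v] ≤ pathEdges (p.concat u ++ c :: v :: q) :=
      pathEdges_le_of_infix ⟨p, q, by simp⟩
    refine le_trans ?_ (Multiset.countP_le_of_le _ h1)
    rw [show pathEdges [u, c, v] = s(u, c) ::ₘ s(c, v) ::ₘ 0 from rfl,
      Multiset.countP_cons_of_pos (p := fun e => c ∈ e) _ (Sym2.mem_mk_right u c),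
      Multiset.countP_cons_of_pos (p := fun e => c ∈ e) _ (Sym2.mem_mk_left c v)]
    omega

section Loops

variable {V ι : Type*} [Fintype V] [DecidableEq V] [Fintype ι] [DecidableEq ι]
  {G : SimpleGraph V} [DecidableRel G.Adj] {k : ℕ} {m : V → V}

variable {l₀ : ι → List V} {p₀ : V → ι}

/-- A stage in the elimination of loops: the paths with numbers in `S` have been treated, the other
ones are still the original paths `l₀ i`. No loop remains among the treated paths. The map `p₀`
assigns to every vertex the number of the original path that ends there. -/
structure LoopFree (G : SimpleGraph V) [DecidableRel G.Adj] (k : ℕ) (m : V → V) (l₀ : ι → List V)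
    (p₀ : V → ι) (S : Finset ι) (l : ι → List V) (L : Finset V) (p : V → ι) : Prop where
  sys : PathSystem G k m l L p
  eq_of_notMem : ∀ i ∉ S, l i = l₀ i
  live : ∀ x, p₀ x ∉ S → x ∈ L ∧ p x = p₀ x
  mem : ∀ x ∈ L, p₀ x ∈ S → p x ∈ S
  ne : ∀ x ∈ L, p₀ x ∈ S → p (m x) ≠ p x

variable {S : Finset ι} {l : ι → List V} {L : Finset V} {p : V → ι}

/-- A set `J` of further paths is treated. The vertices of `D` cease to be live. -/
theorem LoopFree.union (h : LoopFree G k m l₀ p₀ S l L p) (hm : ∀ x, m (m x) = x) {J : Finset ι}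
    (hJ : Disjoint J S) {D : Finset V} (hD : ∀ x ∈ D, m x ∈ D) (hDJ : ∀ x ∈ D, p₀ x ∈ J)
    {l' : ι → List V} {p' : V → ι} (hl' : ∀ i ∉ J, l' i = l i) (hp' : ∀ x, p₀ x ∉ J → p' x = p x)
    (hx : ∀ x ∉ D, p₀ x ∈ J → p' x ∈ J ∧ IsEnd x (l' (p' x)) ∧
      (p₀ (m x) ∈ J → p' (m x) ≠ p' x))
    (hnd : ∀ i ∈ J, (l' i).Nodup) (hle : ∀ i ∈ J, 2 * k ≤ (l' i).length)
    (hlen : ∀ i ∈ J, (l' i).length +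
      (Finset.univ.filter fun x => x ∉ D ∧ p₀ x ∈ J ∧ p' x = i).card ≤ 2 * k + 2)
    (he : ∑ i ∈ J, pathEdges (l' i) = ∑ i ∈ J, pathEdges (l₀ i) + matchEdges m D) :
    LoopFree G k m l₀ p₀ (S ∪ J) l' (L \ D) p' := by
  have hJS : ∀ i ∈ J, i ∉ S := fun i hi => Finset.disjoint_left.1 hJ hi
  have hpJ : ∀ x ∈ L, p₀ x ∉ J → p x ∉ J := by
    intro x hx hxJ hpx
    by_cases hS : p₀ x ∈ S
    · exact hJS _ hpx (h.mem x hx hS)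
    · rw [(h.live x hS).2] at hpx; exact hxJ hpx
  have hmD : ∀ x, x ∉ D → m x ∉ D := fun x hx hmx => hx (by rw [← hm x]; exact hD _ hmx)
  have hDL : D ⊆ L := fun x hx => (h.live x (hJS _ (hDJ x hx))).1
  have hnotD : ∀ x, p₀ x ∉ J → x ∉ D := fun x hx hxD => hx (hDJ x hxD)
  have hcase : ∀ x ∈ L, p₀ x ∈ J → m x ∈ L → x ∉ D → p' (m x) ≠ p' x := by
    intro x hxL hxJ hmxL hxD
    by_cases hmJ : p₀ (m x) ∈ J
    · exact (hx x hxD hxJ).2.2 hmJ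
    · rw [hp' _ hmJ]
      intro h'
      exact hpJ _ hmxL hmJ (h' ▸ (hx x hxD hxJ).1)
  refine ⟨⟨fun i => ?_, fun i => ?_, fun i => ?_, fun x hxL => ?_, fun x hxL => ?_, ?_⟩,
    fun i hi => ?_, fun x hxS => ?_, fun x hxL hxS => ?_, fun x hxL hxS => ?_⟩
  · by_cases hi : i ∈ J
    · exact hnd i hi
    · rw [hl' i hi]; exact h.sys.nodup i
  · by_cases hi : i ∈ J
    · exact hle i hi
    · rw [hl' i hi]; exact h.sys.le_length i
  · by_cases hi : i ∈ J
    · refine le_trans (Nat.add_le_add_left (Finset.card_le_card fun x hxf => ?_) _) (hlen i hi)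
      simp only [Finset.mem_filter, Finset.mem_sdiff, Finset.mem_univ, true_and] at hxf ⊢
      refine ⟨hxf.1.2, ?_, hxf.2⟩
      by_contra hxJ
      rw [hp' x hxJ] at hxf
      exact hpJ x hxf.1.1 hxJ (hxf.2 ▸ hi)
    · rw [hl' i hi]
      refine le_trans (Nat.add_le_add_left (Finset.card_le_card fun x hxf => ?_) _)
        (h.sys.length_le i)
      simp only [Finset.mem_filter, Finset.mem_sdiff] at hxf ⊢
      refine ⟨hxf.1.1, ?_⟩
      by_cases hxJ : p₀ x ∈ J
      · exact absurd (hxf.2 ▸ (hx x hxf.1.2 hxJ).1) hi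
      · rw [← hp' x hxJ]; exact hxf.2
  · rw [Finset.mem_sdiff] at hxL
    by_cases hxJ : p₀ x ∈ J
    · exact (hx x hxL.2 hxJ).2.1
    · rw [hp' x hxJ, hl' _ (hpJ x hxL.1 hxJ)]
      exact h.sys.isEnd x hxL.1
  · rw [Finset.mem_sdiff] at hxL ⊢
    exact ⟨h.sys.matched x hxL.1, hmD x hxL.2⟩
  · have h1 := sum_pathEdges_add J (l := l) (l' := l') hl'
    have h2 : ∑ i ∈ J, pathEdges (l i) = ∑ i ∈ J, pathEdges (l₀ i) :=
      Finset.sum_congr rfl fun i hi => by rw [h.eq_of_notMem i (hJS i hi)]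
    rw [he, h2, ← add_assoc, add_right_comm] at h1
    rw [← h.sys.edges, matchEdges_eq_add hD hDL, ← add_assoc, add_right_cancel h1]
  · simp only [Finset.mem_union, not_or] at hi
    rw [hl' i hi.2, h.eq_of_notMem i hi.1]
  · simp only [Finset.mem_union, not_or] at hxS
    rw [hp' x hxS.2, Finset.mem_sdiff]
    exact ⟨⟨(h.live x hxS.1).1, hnotD x hxS.2⟩, (h.live x hxS.1).2⟩
  · rw [Finset.mem_sdiff] at hxL
    rw [Finset.mem_union]
    by_cases hxJ : p₀ x ∈ J
    · exact Or.inr (hx x hxL.2 hxJ).1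
    · rw [hp' x hxJ]
      exact Or.inl (h.mem x hxL.1 ((Finset.mem_union.1 hxS).resolve_right hxJ))
  · rw [Finset.mem_sdiff] at hxL
    have hmxL := h.sys.matched x hxL.1
    by_cases hxJ : p₀ x ∈ J
    · exact hcase x hxL.1 hxJ hmxL hxL.2
    · by_cases hmJ : p₀ (m x) ∈ J
      · have := hcase (m x) hmxL hmJ (by rw [hm]; exact hxL.1) (hmD x hxL.2)
        rw [hm] at this
        exact this.symm
      · rw [hp' x hxJ, hp' _ hmJ]
        exact h.ne x hxL.1 ((Finset.mem_union.1 hxS).resolve_right hxJ)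

/-- The cycle that belongs to a loop is merged with a path that ends on it. -/
theorem LoopFree.pair (hk : 3 ≤ k) (hg : ((2 * k - 2 : ℕ) : ℕ∞) ≤ G.egirth)
    (hm : ∀ x, m (m x) = x) (hm' : ∀ x, m x ≠ x) (hnd : ∀ i, (l₀ i).Nodup)
    (hlen : ∀ i, (l₀ i).length = 2 * k) (hend : ∀ x i, IsEnd x (l₀ i) ↔ p₀ x = i)
    (hE : ∑ i, pathEdges (l₀ i) + matchEdges m Finset.univ = G.edgeFinset.val)
    (h : LoopFree G k m l₀ p₀ S l L p) {T U : ι} (hTU : T ≠ U) (hT : T ∉ S) (hU : U ∉ S)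
    (hloop : ∃ a, p₀ a = T ∧ p₀ (m a) = T) (hmeet : ∃ c, p₀ c = U ∧ c ∈ l₀ T) :
    ∃ l' L' p', LoopFree G k m l₀ p₀ (S ∪ {T, U}) l' L' p' := by
  obtain ⟨a, haT, hmaT⟩ := hloop
  obtain ⟨c, hcU, hcT⟩ := hmeet
  have hcyc := cycleEdges_of_ends (hm' a).symm ((hend a T).2 haT) ((hend _ T).2 hmaT)
  obtain ⟨Z, hZp, hZe⟩ := exists_cycleEdges_cons hcT
  obtain ⟨B, hBe, hBp, hBend⟩ := ((hend c U).2 hcU).exists_cons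
  have hZl : Z.length + 1 = 2 * k := by rw [← hlen T, ← hZp.length_eq]; rfl
  have hBl : B.length + 1 = 2 * k := by rw [← hlen U, ← hBp.length_eq]; rfl
  have hγ := List.getLast?_eq_some_getLast (show c :: B ≠ [] by simp)
  generalize (c :: B).getLast _ = γ at hγ
  have hγU : p₀ γ = U := (hend γ U).1 ((hBend γ).1 (Or.inr hγ))
  have hBnd : (c :: B).Nodup := hBp.nodup_iff.2 (hnd U)
  have hcγ : c ≠ γ := by
    rintro rfl
    have hB : B ≠ [] := by rintro rfl; simp at hBl; omega
    rw [List.getLast?_cons, List.getLast?_eq_some_getLast hB] at hγ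
    have := List.getLast_mem hB
    rw [show B.getLast hB = c from Option.some.inj hγ] at this
    exact (List.nodup_cons.1 hBnd).1 this
  have hedge : cycleEdges (c :: Z) + pathEdges (c :: B) = pathEdges (l₀ T) + pathEdges (l₀ U) +
      matchEdges m {a, m a} := by
    rw [hZe, hBe, hcyc, matchEdges_pair hm, Multiset.cons_add, ← Multiset.singleton_add, add_comm]
  have hed : EdgeDistinct G (cycleEdges (c :: Z) + pathEdges (c :: B)) := by
    refine edgeDistinct_edgeFinset.mono ?_
    have hDm : ∀ x ∈ ({a, m a} : Finset V), m x ∈ ({a, m a} : Finset V) := by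
      intro x hx
      rcases Finset.mem_insert.1 hx with rfl | hx
      · simp
      · rw [Finset.mem_singleton.1 hx, hm]; simp
    rw [hedge, ← hE, matchEdges_eq_add hDm (Finset.subset_univ _)]
    refine add_le_add ?_ (Multiset.le_add_right _ _)
    rw [← Finset.sum_pair (f := fun i => pathEdges (l₀ i)) hTU]
    exact Finset.sum_le_sum_of_subset (Finset.subset_univ _)
  obtain ⟨P, Q, hP, hQ, hPQ, hPl, hQl, hcP, hγQ⟩ := merge_split hk hg
    (hZp.nodup_iff.2 (hnd T)) hBnd (by omega) (by omega) hγ hed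
  have hendU : ∀ x, p₀ x = U → x = c ∨ x = γ := fun x hx =>
    IsEnd.eq_or_eq hcγ ((hend c U).2 hcU) ((hend γ U).2 hγU) ((hend x U).2 hx)
  have hendT : ∀ x, p₀ x = T → x = a ∨ x = m a := fun x hx =>
    IsEnd.eq_or_eq (hm' a).symm ((hend a T).2 haT) ((hend _ T).2 hmaT) ((hend x T).2 hx)
  have hlive : ∀ x ∉ ({a, m a} : Finset V), p₀ x ∈ ({T, U} : Finset ι) → x = c ∨ x = γ := by
    intro x hxD hx
    rcases Finset.mem_insert.1 hx with hx | hx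
    · exact absurd (by simpa using hendT x hx) hxD
    · exact hendU x (Finset.mem_singleton.1 hx)
  have hpγ : p γ = U := by rw [(h.live γ (hγU ▸ hU)).2, hγU]
  have hp'c : Function.update p c T c = T := Function.update_self ..
  have hp'γ : Function.update p c T γ = U := by rw [Function.update_of_ne hcγ.symm, hpγ]
  let l' : ι → List V := fun i => if i = T then P else if i = U then Q else l i
  have hl'T : l' T = P := by simp [l']
  have hl'U : l' U = Q := by simp [l', hTU.symm]
  refine ⟨l', _, Function.update p c T, h.union hm (J := {T, U}) (D := {a, m a}) ?_ ?_ ?_ ?_ ?_ ?_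
    ?_ ?_ ?_ ?_⟩
  · simp [hT, hU]
  · intro x hx
    rcases Finset.mem_insert.1 hx with rfl | hx
    · simp
    · rw [Finset.mem_singleton.1 hx, hm]; simp
  · simp [haT, hmaT]
  · intro i hi
    simp only [Finset.mem_insert, Finset.mem_singleton, not_or] at hi
    simp [l', hi.1, hi.2]
  · intro x hx
    refine Function.update_of_ne ?_ _ _
    rintro rfl
    exact hx (by simp [hcU])
  · intro x hxD hx
    have hmxD : p₀ (m x) ∈ ({T, U} : Finset ι) → m x = c ∨ m x = γ := fun hmx =>
      hlive _ (fun hmem => hxD (by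
        rw [← hm x]
        rcases Finset.mem_insert.1 hmem with h1 | h1
        · rw [h1]; simp
        · rw [Finset.mem_singleton.1 h1, hm]; simp)) hmx
    rcases hlive x hxD hx with rfl | rfl
    · rw [hp'c, hl'T]
      refine ⟨by simp, hcP, fun hmx => ?_⟩
      rw [(hmxD hmx).resolve_left (hm' _), hp'γ]
      exact hTU.symm
    · rw [hp'γ, hl'U]
      refine ⟨by simp, hγQ, fun hmx => ?_⟩
      rw [(hmxD hmx).resolve_right (hm' _), hp'c]
      exact hTU
  · simp [hl'T, hl'U, hP, hQ]
  · simp [hl'T, hl'U, hPl.1, hQl.1]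
  · have hcard : ∀ {i : ι} {y : V}, (∀ x ∉ ({a, m a} : Finset V), p₀ x ∈ ({T, U} : Finset ι) →
        Function.update p c T x = i → x = y) → (Finset.univ.filter fun x => x ∉ ({a, m a} : Finset V)
          ∧ p₀ x ∈ ({T, U} : Finset ι) ∧ Function.update p c T x = i).card ≤ 1 := by
      intro i y hy
      rw [← Finset.card_singleton y]
      refine Finset.card_le_card fun x hx => ?_
      rw [Finset.mem_filter] at hx
      exact Finset.mem_singleton.2 (hy x hx.2.1 hx.2.2.1 hx.2.2.2)
    intro i hi
    rcases Finset.mem_insert.1 hi with rfl | hi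
    · rw [hl'T]
      have := hcard (i := i) (y := c) fun x h1 h2 h3 => (hlive x h1 h2).resolve_right (by
        rintro rfl; rw [hp'γ] at h3; exact hTU h3.symm)
      omega
    · rw [Finset.mem_singleton.1 hi, hl'U]
      have := hcard (i := U) (y := γ) fun x h1 h2 h3 => (hlive x h1 h2).resolve_left (by
        rintro rfl; rw [hp'c] at h3; exact hTU h3)
      omega
  · rw [Finset.sum_pair hTU, Finset.sum_pair hTU, hl'T, hl'U, hPQ, hedge]

/-- Three loops, of which the first and the third one meet the second one, are dissolved. -/
theorem LoopFree.triple (hk : 3 ≤ k) (hg : ((2 * k - 2 : ℕ) : ℕ∞) ≤ G.egirth)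
    (hm : ∀ x, m (m x) = x) (hm' : ∀ x, m x ≠ x) (hnd : ∀ i, (l₀ i).Nodup)
    (hlen : ∀ i, (l₀ i).length = 2 * k) (hend : ∀ x i, IsEnd x (l₀ i) ↔ p₀ x = i)
    (hE : ∑ i, pathEdges (l₀ i) + matchEdges m Finset.univ = G.edgeFinset.val)
    (h : LoopFree G k m l₀ p₀ S l L p) {T U W : ι} (hTU : T ≠ U) (hTW : T ≠ W) (hUW : U ≠ W)
    (hT : T ∉ S) (hU : U ∉ S) (hW : W ∉ S) (hT' : ∃ a, p₀ a = T ∧ p₀ (m a) = T)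
    (hU' : ∃ a, p₀ a = U ∧ p₀ (m a) = U) (hW' : ∃ a, p₀ a = W ∧ p₀ (m a) = W)
    (hmeet : ∃ c, c ∈ l₀ T ∧ c ∈ l₀ U) (hmeet' : ∃ c, c ∈ l₀ U ∧ c ∈ l₀ W) :
    ∃ l' L' p', LoopFree G k m l₀ p₀ (S ∪ {T, U, W}) l' L' p' := by
  obtain ⟨a, haT, hmaT⟩ := hT'
  obtain ⟨b, hbU, hmbU⟩ := hU'
  obtain ⟨d, hdW, hmdW⟩ := hW'
  obtain ⟨x, hxT, hxU⟩ := hmeet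
  obtain ⟨y, hyU, hyW⟩ := hmeet'
  have hDm : ∀ i, (∃ a, p₀ a = i ∧ p₀ (m a) = i) → ∀ x, p₀ x = i → p₀ (m x) = i := by
    rintro i ⟨a, ha, hma⟩ x hx
    rcases IsEnd.eq_or_eq (hm' a).symm ((hend a i).2 ha) ((hend _ i).2 hma) ((hend x i).2 hx)
      with rfl | rfl
    · exact hma
    · rwa [hm]
  let D : Finset V := Finset.univ.filter fun x => p₀ x ∈ ({T, U, W} : Finset ι)
  have hDD : ∀ x ∈ D, m x ∈ D := by
    intro x hx
    simp only [D, Finset.mem_filter, Finset.mem_univ, true_and, Finset.mem_insert,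
      Finset.mem_singleton] at hx ⊢
    exact hx.imp (hDm T ⟨a, haT, hmaT⟩ x) (Or.imp (hDm U ⟨b, hbU, hmbU⟩ x) (hDm W ⟨d, hdW, hmdW⟩ x))
  have hpair : ∀ {i : ι} {a : V}, p₀ a = i → p₀ (m a) = i → ∀ x, p₀ x = i ↔ x = a ∨ x = m a := by
    intro i a ha hma x
    refine ⟨fun hx => IsEnd.eq_or_eq (hm' a).symm ((hend a i).2 ha) ((hend _ i).2 hma)
      ((hend x i).2 hx), ?_⟩
    rintro (rfl | rfl) <;> assumption
  have hDe : matchEdges m D = {s(a, m a)} + {s(b, m b)} + {s(d, m d)} := by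
    have haD : a ∈ D := by simp [D, haT]
    have hbD : b ∈ D \ {a, m a} := by
      simp only [Finset.mem_sdiff, Finset.mem_insert, Finset.mem_singleton, ← hpair haT hmaT]
      exact ⟨by simp [D, hbU], hbU ▸ hTU.symm⟩
    have hdD : d ∈ (D \ {a, m a}) \ {b, m b} := by
      simp only [Finset.mem_sdiff, Finset.mem_insert, Finset.mem_singleton, ← hpair haT hmaT,
        ← hpair hbU hmbU]
      exact ⟨⟨by simp [D, hdW], hdW ▸ hTW.symm⟩, hdW ▸ hUW.symm⟩
    have hrest : ((D \ {a, m a}) \ {b, m b}) \ {d, m d} = ∅ := by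
      ext x
      simp only [Finset.mem_sdiff, Finset.mem_insert, Finset.mem_singleton, ← hpair haT hmaT,
        ← hpair hbU hmbU, ← hpair hdW hmdW, D, Finset.mem_filter, Finset.mem_univ, true_and,
        Finset.notMem_empty, iff_false]
      tauto
    rw [matchEdges_eq_cons hm haD, matchEdges_eq_cons hm hbD, matchEdges_eq_cons hm hdD, hrest,
      matchEdges_empty, ← Multiset.singleton_add, ← Multiset.singleton_add, ← Multiset.singleton_add,
      add_zero, add_assoc]
  have hcT := cycleEdges_of_ends (hm' a).symm ((hend a T).2 haT) ((hend _ T).2 hmaT)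
  have hcU := cycleEdges_of_ends (hm' b).symm ((hend b U).2 hbU) ((hend _ U).2 hmbU)
  have hcW := cycleEdges_of_ends (hm' d).symm ((hend d W).2 hdW) ((hend _ W).2 hmdW)
  have hsum : ∀ f : ι → Multiset (Sym2 V), ∑ i ∈ {T, U, W}, f i = f T + f U + f W := by
    intro f
    rw [Finset.sum_insert (by simp [hTU, hTW]), Finset.sum_pair hUW, add_assoc]
  have hedge : cycleEdges (l₀ T) + cycleEdges (l₀ U) + cycleEdges (l₀ W) =
      ∑ i ∈ {T, U, W}, pathEdges (l₀ i) + matchEdges m D := by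
    rw [hcT, hcU, hcW, hDe, hsum, ← Multiset.singleton_add, ← Multiset.singleton_add,
      ← Multiset.singleton_add]
    abel
  have hed : EdgeDistinct G (cycleEdges (l₀ T) + cycleEdges (l₀ U) + cycleEdges (l₀ W)) := by
    refine edgeDistinct_edgeFinset.mono ?_
    rw [hedge, ← hE, matchEdges_eq_add hDD (Finset.subset_univ _)]
    exact add_le_add (Finset.sum_le_sum_of_subset (Finset.subset_univ _))
      (Multiset.le_add_right _ _)
  obtain ⟨P, Q, R, hP, hQ, hR, hPQR, hPl, hQl, hRl⟩ := triple_split hk hg (hnd T) (hnd U) (hnd W)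
    (hlen T) (hlen U) (hlen W) hxT hxU hyU hyW hed
  let l' : ι → List V := fun i => if i = T then P else if i = U then Q else if i = W then R else l i
  have hl'T : l' T = P := by simp [l']
  have hl'U : l' U = Q := by simp [l', hTU.symm]
  have hl'W : l' W = R := by simp [l', hTW.symm, hUW.symm]
  refine ⟨l', _, p, h.union hm (J := {T, U, W}) (D := D) ?_ hDD ?_ ?_ (fun _ _ => rfl) ?_
    ?_ ?_ ?_ ?_⟩
  · simp [hT, hU, hW]
  · exact fun x hx => (Finset.mem_filter.1 hx).2
  · intro i hi
    simp only [Finset.mem_insert, Finset.mem_singleton, not_or] at hi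
    simp [l', hi.1, hi.2]
  · exact fun x hx hx' => absurd (Finset.mem_filter.2 ⟨Finset.mem_univ x, hx'⟩) hx
  · simp [hl'T, hl'U, hl'W, hP, hQ, hR]
  · simp [hl'T, hl'U, hl'W, hPl.1, hQl.1, hRl.1]
  · intro i hi
    have h0 : (Finset.univ.filter fun x => x ∉ D ∧ p₀ x ∈ ({T, U, W} : Finset ι) ∧ p x = i) = ∅ :=
      Finset.filter_eq_empty_iff.2 fun x _ hx =>
        hx.1 (Finset.mem_filter.2 ⟨Finset.mem_univ _, hx.2.1⟩)
    rw [h0, Finset.card_empty, add_zero]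
    simp only [Finset.mem_insert, Finset.mem_singleton] at hi
    rcases hi with rfl | rfl | rfl
    · rw [hl'T]; exact hPl.2
    · rw [hl'U]; exact hQl.2
    · rw [hl'W]; exact hRl.2
  · rw [hsum (fun i => pathEdges (l' i)), hl'T, hl'U, hl'W, hPQR, hedge]

theorem countP_mem_edgeFinset (v : V) :
    G.edgeFinset.val.countP (fun e => v ∈ e) = G.degree v := by
  rw [← G.card_incidenceFinset_eq_degree, G.incidenceFinset_eq_filter, Finset.card,
    Finset.filter_val, Multiset.countP_eq_card_filter]

/-- Every path can be assigned an end of another path that lies on it, such that the ends assigned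
to different paths belong to different paths. This is Hall's theorem: a path has `2 * k - 2` interior
vertices, a vertex lies in the interior of at most `k - 1` paths, and a path has only two ends. -/
theorem exists_injective_meet (hk : 3 ≤ k) (hreg : G.IsRegularOfDegree (2 * k))
    (hnd : ∀ i, (l₀ i).Nodup) (hlen : ∀ i, (l₀ i).length = 2 * k)
    (hend : ∀ x i, IsEnd x (l₀ i) ↔ p₀ x = i)
    (hE : ∑ i, pathEdges (l₀ i) + matchEdges m Finset.univ = G.edgeFinset.val) :
    ∃ π : ι → ι, Function.Injective π ∧ ∀ i, π i ≠ i ∧ ∃ c, p₀ c = π i ∧ c ∈ l₀ i := by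
  let A : ι → Finset V := fun i => (l₀ i).toFinset.filter fun c => p₀ c ≠ i
  have hA : ∀ i, 2 * k - 2 ≤ (A i).card := by
    intro i
    have h1 := Finset.card_filter_add_card_filter_not (s := (l₀ i).toFinset) (fun c => p₀ c = i)
    rw [List.toFinset_card_of_nodup (hnd i), hlen] at h1
    have h2 := card_ends_le hend i
    have h3 : ((l₀ i).toFinset.filter fun c => p₀ c = i).card ≤
        (Finset.univ.filter fun x => p₀ x = i).card :=
      Finset.card_le_card (Finset.filter_subset_filter _ (Finset.subset_univ _))
    simp only [A, ne_eq]
    omega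
  have hcount : ∀ c, (Finset.univ.filter fun i => c ∈ A i).card ≤ k - 1 := by
    intro c
    have h1 : G.edgeFinset.val.countP (fun e => c ∈ e) = 2 * k := by
      rw [countP_mem_edgeFinset]; exact hreg c
    rw [← hE, Multiset.countP_add] at h1
    have h2 : 0 < (matchEdges m Finset.univ).countP (fun e => c ∈ e) :=
      Multiset.countP_pos.2 ⟨s(c, m c),
        Finset.mem_image_of_mem (fun x => s(x, m x)) (Finset.mem_univ c), by simp⟩
    have h3 : (∑ i, pathEdges (l₀ i)).countP (fun e => c ∈ e) =
        ∑ i, (pathEdges (l₀ i)).countP (fun e => c ∈ e) :=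
      map_sum (Multiset.countPAddMonoidHom fun e : Sym2 V => c ∈ e) _ _
    have h4 : 2 * (Finset.univ.filter fun i => c ∈ A i).card ≤
        ∑ i, (pathEdges (l₀ i)).countP (fun e => c ∈ e) := by
      rw [mul_comm, ← smul_eq_mul, ← Finset.sum_const]
      refine le_trans (Finset.sum_le_sum fun i hi => ?_)
        (Finset.sum_le_sum_of_subset (Finset.subset_univ _))
      simp only [A, Finset.mem_filter, List.mem_toFinset, Finset.mem_univ, true_and] at hi
      exact two_le_countP_pathEdges hi.1 fun h => hi.2 ((hend c i).1 h)
    omega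
  obtain ⟨π, hπ, hπA⟩ := (Finset.all_card_le_biUnion_card_iff_exists_injective
    fun i => (A i).image p₀).1 fun s => by
      set N := s.biUnion fun i => (A i).image p₀
      let t := Finset.univ.filter fun c => p₀ c ∈ N
      have h1 : s.card * (2 * k - 2) ≤ t.card * (k - 1) := by
        refine Finset.card_mul_le_card_mul (fun i c => c ∈ A i) (fun i hi => ?_) fun c _ => ?_
        · refine le_trans (hA i) (Finset.card_le_card fun c hc => ?_)
          rw [Finset.mem_bipartiteAbove]
          exact ⟨Finset.mem_filter.2 ⟨Finset.mem_univ _, Finset.mem_biUnion.2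
            ⟨i, hi, Finset.mem_image_of_mem _ hc⟩⟩, hc⟩
        · refine le_trans (Finset.card_le_card fun i hi => ?_) (hcount c)
          rw [Finset.mem_bipartiteBelow] at hi
          exact Finset.mem_filter.2 ⟨Finset.mem_univ _, hi.2⟩
      have h2 : t.card ≤ 2 * N.card := by
        refine Finset.card_le_mul_card_image_of_maps_to (f := p₀)
          (fun c hc => (Finset.mem_filter.1 hc).2) 2 fun i _ => ?_
        exact le_trans (Finset.card_le_card (Finset.filter_subset_filter _
          (Finset.subset_univ _))) (card_ends_le hend i)
      have h3 : s.card * (2 * (k - 1)) ≤ N.card * (2 * (k - 1)) := by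
        have : 2 * k - 2 = 2 * (k - 1) := by omega
        rw [← this]
        calc _ ≤ _ := h1
          _ ≤ 2 * N.card * (k - 1) := Nat.mul_le_mul_right _ h2
          _ = N.card * (2 * (k - 1)) := by ring
          _ = N.card * (2 * k - 2) := by rw [this]
      exact Nat.le_of_mul_le_mul_right h3 (by omega)
  refine ⟨π, hπ, fun i => ?_⟩
  obtain ⟨c, hc, hci⟩ := Finset.mem_image.1 (hπA i)
  simp only [A, Finset.mem_filter, List.mem_toFinset] at hc
  exact ⟨hci ▸ hc.2, c, hci, hc.1⟩

/-- Paths of length `2 * k - 1` that cover all edges outside a perfect matching, such that every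
vertex is an end of exactly one path, can be changed into paths that cover all edges. -/
theorem exists_pathSystem (hk : 3 ≤ k) (hg : ((2 * k - 2 : ℕ) : ℕ∞) ≤ G.egirth)
    (hreg : G.IsRegularOfDegree (2 * k)) (hm : ∀ x, m (m x) = x) (hm' : ∀ x, m x ≠ x)
    (hnd : ∀ i, (l₀ i).Nodup) (hlen : ∀ i, (l₀ i).length = 2 * k)
    (hend : ∀ x i, IsEnd x (l₀ i) ↔ p₀ x = i)
    (hE : ∑ i, pathEdges (l₀ i) + matchEdges m Finset.univ = G.edgeFinset.val) :
    ∃ (l : ι → List V) (p : V → ι), PathSystem G k m l ∅ p := by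
  obtain ⟨π, hπ, hπm⟩ := exists_injective_meet hk hreg hnd hlen hend hE
  let U : Finset ι := Finset.univ.filter fun i => ∃ a, p₀ a = i ∧ p₀ (m a) = i
  have hU : ∀ {i}, i ∈ U ↔ ∃ a, p₀ a = i ∧ p₀ (m a) = i := by simp [U]
  obtain ⟨Γ, hΓ, hform, hcov⟩ := exists_groups hπ U fun i _ => (hπm i).1
  have hmeet : ∀ i, ∃ c, c ∈ l₀ i ∧ c ∈ l₀ (π i) := fun i => by
    obtain ⟨c, hc, hci⟩ := (hπm i).2
    exact ⟨c, hci, ((hend c _).2 hc).mem⟩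
  have hstep : ∀ Γ : List (List ι), Γ.flatten.Nodup → (∀ g ∈ Γ, (∃ T ∈ U, g = [T, π T]) ∨
      ∃ T, T ∈ U ∧ π T ∈ U ∧ π (π T) ∈ U ∧ g = [T, π T, π (π T)]) →
      ∃ l L p, LoopFree G k m l₀ p₀ Γ.flatten.toFinset l L p := by
    intro Γ
    induction Γ with
    | nil =>
      intro _ _
      refine ⟨l₀, Finset.univ, p₀, ⟨hnd, fun i => (hlen i).ge, fun i => ?_,
        fun x _ => (hend x _).2 rfl, fun _ _ => Finset.mem_univ _, hE⟩, fun _ _ => rfl,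
        fun x _ => ⟨Finset.mem_univ x, rfl⟩, fun x _ hx => by simp at hx, fun x _ hx => by simp at hx⟩
      rw [hlen]
      exact Nat.add_le_add_left (card_ends_le hend i) _
    | cons g Γ ih =>
      intro hnd' hform
      rw [List.flatten_cons, List.nodup_append] at hnd'
      obtain ⟨l, L, p, h⟩ := ih hnd'.2.1 fun g hg => hform g (List.mem_cons_of_mem _ hg)
      have hg' : ∀ i ∈ g, i ∉ Γ.flatten.toFinset := fun i hi hi' =>
        hnd'.2.2 i hi i (List.mem_toFinset.1 hi') rfl
      rw [List.flatten_cons, List.toFinset_append, Finset.union_comm]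
      rcases hform g List.mem_cons_self with ⟨T, hT, rfl⟩ | ⟨T, h1, h2, h3, rfl⟩
      · have := h.pair hk hg hm hm' hnd hlen hend hE (T := T) (U := π T) (hπm T).1.symm
          (hg' _ (by simp)) (hg' _ (by simp)) (hU.1 hT) (hπm T).2
        simpa using this
      · have hn := hnd'.1
        simp only [List.nodup_cons, List.mem_cons, List.not_mem_nil, or_false, not_or] at hn
        have := h.triple hk hg hm hm' hnd hlen hend hE (T := T) (U := π T) (W := π (π T))
          hn.1.1 hn.1.2 hn.2.1 (hg' _ (by simp)) (hg' _ (by simp)) (hg' _ (by simp)) (hU.1 h1)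
          (hU.1 h2) (hU.1 h3) (hmeet T) (hmeet (π T))
        simpa using this
  obtain ⟨l, L, p, h⟩ := hstep Γ hΓ hform
  obtain ⟨l', hl'⟩ := h.sys.complete hk hg hm fun x hx hpx => by
    by_cases hxS : p₀ x ∈ Γ.flatten.toFinset
    · exact h.ne x hx hxS hpx
    rw [(h.live x hxS).2] at hpx
    by_cases hmS : p₀ (m x) ∈ Γ.flatten.toFinset
    · exact hxS (hpx ▸ h.mem _ (h.sys.matched x hx) hmS)
    · rw [(h.live _ hmS).2] at hpx
      exact hxS (List.mem_toFinset.2 (hcov _ (hU.2 ⟨x, rfl, hpx⟩)))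
  exact ⟨l', p, hl'⟩

end Loops


/-! ### Pairs of permutations -/

section Arcs

open Equiv

variable {V : Type*} [Fintype V] {G : SimpleGraph V}

theorem apply_apply_ne_of_sameCycle {V : Type*} {f : Perm V} {u v : V} (h : f.SameCycle u v)
    (hu : f (f u) ≠ u) : f (f v) ≠ v := by
  obtain ⟨i, rfl⟩ := h
  have h1 : ∀ x, f ((f ^ i) x) = (f ^ i) (f x) := fun x =>
    DFunLike.congr_fun ((Commute.refl f).zpow_right i).eq x
  rw [h1, h1]
  exact fun h2 => hu ((f ^ i).injective h2)

theorem sum_singleton_eq_map {α : Type*} (f : V → α) :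
    (∑ v, {f v} : Multiset α) = Finset.univ.val.map f := by
  rw [Finset.sum_eq_multiset_sum, ← Multiset.sum_map_singleton (Finset.univ.val.map f),
    Multiset.map_map]
  rfl

/-- The edges `v (h v)` and `v (g v)`. -/
def arcs (h g : Perm V) : Multiset (Sym2 V) := ∑ v, ({s(v, h v)} + {s(v, g v)})

variable {τ h g : Perm V}

theorem arcs_eq_add : arcs h g = ∑ v, {s(v, h v)} + ∑ v, {s(v, g v)} := Finset.sum_add_distrib

theorem arcs_comm : arcs h g = arcs g h := by
  rw [arcs_eq_add, arcs_eq_add, add_comm]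

theorem mem_arcs {e : Sym2 V} : e ∈ arcs h g ↔ ∃ v, e = s(v, h v) ∨ e = s(v, g v) := by
  simp [arcs, Multiset.mem_sum]

theorem EdgeDistinct.adj_arc (hs : EdgeDistinct G (arcs h g)) (v : V) : G.Adj v (h v) :=
  hs.2 _ (mem_arcs.2 ⟨v, Or.inl rfl⟩)

theorem EdgeDistinct.arc_injective (hs : EdgeDistinct G (arcs h g)) :
    Function.Injective fun v => s(v, h v) := by
  have h1 := hs.1
  rw [arcs_eq_add] at h1
  have h2 := (Multiset.nodup_add.1 h1).1
  rw [sum_singleton_eq_map] at h2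
  intro v w hvw
  exact Multiset.inj_on_of_nodup_map h2 v (Finset.mem_univ v) w (Finset.mem_univ w) hvw

theorem EdgeDistinct.arc_arc_ne (hs : EdgeDistinct G (arcs h g)) (v : V) : h (h v) ≠ v := by
  intro hv
  have : h v = v := hs.arc_injective (by simp only [hv]; exact Sym2.eq_swap)
  exact (hs.adj_arc v).ne this.symm

theorem EdgeDistinct.arc_ne_arc (hs : EdgeDistinct G (arcs h g)) {v w : V} :
    s(v, h v) ≠ s(w, g w) := by
  intro hv
  have h1 := hs.1
  rw [arcs_eq_add] at h1
  have h2 := (Multiset.nodup_add.1 h1).2.2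
  rw [Multiset.disjoint_left] at h2
  exact h2 (a := s(v, h v)) (Multiset.mem_sum.2 ⟨v, Finset.mem_univ v, by simp⟩)
    (Multiset.mem_sum.2 ⟨w, Finset.mem_univ w, by simp [hv]⟩)

variable [DecidableEq V]

/-- Consider a trail with ends `v` and `τ v` that is to be prolonged by `h` and `g` at both ends. The
vertex `v` is bad if the continuation `h (τ v), g (h (τ v))` at `τ v` ends in the first vertex `h v`
of the continuation at `v`. -/
def IsBad (τ h g : Perm V) (v : V) : Prop := g (h (τ v)) = h v

instance : DecidablePred (IsBad τ h g) := fun _ => inferInstanceAs (Decidable (_ = _))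

/-- The number of bad vertices. -/
def badCard (τ h g : Perm V) : ℕ := (Finset.univ.filter (IsBad τ h g)).card

/-- Let `O` be a union of cycles of length at least three of `φ = h ∘ τ` all of whose vertices are
bad. If `φ y = v` for `y` in `O`, then `g v = h y`; hence `h` and `g` have the same image on `O`.
Exchanging `h` and `g` on `O` decreases the number of bad vertices, unless
`g (g w) = φ w` for all `w` in `O`. -/
theorem exists_badCard_lt_or (hτ : ∀ x, τ (τ x) = x) (hs : EdgeDistinct G (arcs h g))
    {O : Finset V} (hO : ∀ v, h (τ v) ∈ O ↔ v ∈ O) (hbad : ∀ v ∈ O, IsBad τ h g v)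
    (h2 : ∀ v ∈ O, h (τ (h (τ v))) ≠ v) :
    (∃ h' g' : Perm V, arcs h' g' = arcs h g ∧ badCard τ h' g' < badCard τ h g) ∨
      ∀ w ∈ O, g w ∉ O ∧ g (g w) = h (τ w) := by
  by_cases hall : ∀ w ∈ O, g w ∉ O ∧ g (g w) = h (τ w)
  · exact Or.inr hall
  left
  push Not at hall
  obtain ⟨w, hw, hwO⟩ := hall
  have hs' : EdgeDistinct G (arcs g h) := arcs_comm (h := h) ▸ hs
  have hR : ∀ v ∈ O, τ v ∉ O := by
    intro v hv hv'
    have h3 : g (h (τ v)) = h v := hbad v hv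
    have h4 : g (h (τ (τ v))) = h (τ v) := hbad _ hv'
    rw [hτ] at h4
    exact hs'.arc_arc_ne (h v) (by rw [h4, h3])
  have hpre : ∀ v ∈ O, ∃ y ∈ O, h (τ y) = v ∧ g v = h y := by
    intro v hv
    obtain ⟨y, hy⟩ : ∃ y, h (τ y) = v := (τ.trans h).surjective v
    have hyO : y ∈ O := by rw [← hO, hy]; exact hv
    refine ⟨y, hyO, hy, ?_⟩
    rw [← hy]
    exact hbad y hyO
  have hgh : ∀ v ∈ O, ∀ x ∉ O, g v ≠ h x := by
    intro v hv x hx hvx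
    obtain ⟨y, hy, -, hgy⟩ := hpre v hv
    rw [hgy] at hvx
    exact hx (h.injective hvx ▸ hy)
  have hhg : ∀ v ∈ O, ∀ x ∉ O, h v ≠ g x := by
    intro v hv x hx hvx
    have h3 : g (h (τ v)) = h v := hbad v hv
    rw [← h3] at hvx
    exact hx (g.injective hvx ▸ (hO v).2 hv)
  have hinj : ∀ {h g : Perm V}, (∀ v ∈ O, ∀ x ∉ O, g v ≠ h x) →
      Function.Injective fun v => if v ∈ O then g v else h v := by
    intro h g hgh v x hvx
    by_cases hv : v ∈ O <;> by_cases hx : x ∈ O <;> simp only [hv, hx, if_true, if_false] at hvx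
    · exact g.injective hvx
    · exact absurd hvx (hgh v hv x hx)
    · exact absurd hvx.symm (hgh x hx v hv)
    · exact h.injective hvx
  -- after the exchange, no vertex of `O` is bad, and only vertices `τ v` with `v ∈ O` become bad
  let h' : Perm V := Equiv.ofBijective _ (Finite.injective_iff_bijective.1 (hinj hgh))
  let g' : Perm V := Equiv.ofBijective _ (Finite.injective_iff_bijective.1 (hinj hhg))
  have h'1 : ∀ v ∈ O, h' v = g v := fun v hv => if_pos hv
  have h'0 : ∀ v ∉ O, h' v = h v := fun v hv => if_neg hv
  have g'1 : ∀ v ∈ O, g' v = h v := fun v hv => if_pos hv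
  have g'0 : ∀ v ∉ O, g' v = g v := fun v hv => if_neg hv
  refine ⟨h', g', Finset.sum_congr rfl fun v _ => ?_, ?_⟩
  · by_cases hv : v ∈ O
    · rw [h'1 v hv, g'1 v hv, add_comm]
    · rw [h'0 v hv, g'0 v hv]
  have hsub : Finset.univ.filter (IsBad τ h' g') ⊆
      (Finset.univ.filter (IsBad τ h g) \ O) ∪ ((O.erase w).image τ) := by
    intro v hv
    have hv : g' (h' (τ v)) = h' v := (Finset.mem_filter.1 hv).2
    simp only [Finset.mem_union, Finset.mem_sdiff, Finset.mem_filter, Finset.mem_univ, true_and,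
      Finset.mem_image, Finset.mem_erase]
    by_cases hvO : v ∈ O
    · exfalso
      rw [h'0 _ (hR v hvO), g'1 _ ((hO v).2 hvO), h'1 v hvO] at hv
      obtain ⟨y, hy, hyv, hgy⟩ := hpre v hvO
      rw [hgy] at hv
      exact h2 y hy (by rw [hyv]; exact h.injective hv)
    by_cases hvR : τ v ∈ O
    · right
      refine ⟨τ v, ⟨?_, hvR⟩, hτ v⟩
      rintro rfl
      rw [h'1 _ hvR, h'0 v hvO] at hv
      by_cases hg : g (τ v) ∈ O
      · rw [g'1 _ hg] at hv
        rw [h.injective hv] at hg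
        exact hvO hg
      · rw [g'0 _ hg] at hv
        refine hwO hg ?_
        rw [hv, hτ]
    · left
      rw [h'0 _ hvR, g'0 _ (fun hc => hvO ((hO v).1 hc)), h'0 v hvO] at hv
      exact ⟨hv, hvO⟩
  have hOB : O ⊆ Finset.univ.filter (IsBad τ h g) := fun v hv =>
    Finset.mem_filter.2 ⟨Finset.mem_univ v, hbad v hv⟩
  calc badCard τ h' g' ≤ _ := Finset.card_le_card hsub
    _ ≤ _ := Finset.card_union_le _ _
    _ ≤ (badCard τ h g - O.card) + (O.card - 1) := by
      refine add_le_add ?_ ?_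
      · rw [Finset.card_sdiff_of_subset hOB]; rfl
      · rw [← Finset.card_erase_of_mem hw]; exact Finset.card_image_le
    _ < badCard τ h g := by
      have h3 : O.card ≤ badCard τ h g := Finset.card_le_card hOB
      have h4 : 0 < O.card := Finset.card_pos.2 ⟨w, hw⟩
      omega

/-- The vertices on the cycles of `φ = h ∘ τ` of length at least three that consist of bad vertices.
-/
def longBad (τ h g : Perm V) : Set V :=
  {v | (∀ w, (h * τ).SameCycle v w → IsBad τ h g w) ∧ h (τ (h (τ v))) ≠ v}

open Classical in
/-- If some cycle of length at least three of `φ = h ∘ τ` consists of bad vertices, then `h` and `g`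
can be changed to decrease the number of bad vertices, or else to decrease the size of `longBad`
without increasing the number of bad vertices. If exchanging `h` and `g` on the cycle `O` is of no
use, then `g (g w) = φ w` for `w` in `O`, so that `O` and its image under `g` alternate on cycles of
`g`; the second change consists in reversing these cycles. -/
theorem exists_longBad_lt (hτ : ∀ x, τ (τ x) = x) (hs : EdgeDistinct G (arcs h g))
    {u : V} (hu : u ∈ longBad τ h g) :
    ∃ h' g' : Perm V, arcs h' g' = arcs h g ∧ (badCard τ h' g' < badCard τ h g ∨
      badCard τ h' g' ≤ badCard τ h g ∧ (longBad τ h' g').ncard < (longBad τ h g).ncard) := by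
  -- the swap on the cycle of a vertex, in the form needed twice below
  have key : ∀ {g : Perm V} {u : V}, EdgeDistinct G (arcs h g) → u ∈ longBad τ h g →
      (∃ h' g' : Perm V, arcs h' g' = arcs h g ∧ badCard τ h' g' < badCard τ h g) ∨
      ∀ w, (h * τ).SameCycle u w → ¬ (h * τ).SameCycle u (g w) ∧ g (g w) = h (τ w) := by
    intro g u hs hu
    have h2 : ∀ v, (h * τ).SameCycle u v → h (τ (h (τ v))) ≠ v := fun v hv =>
      apply_apply_ne_of_sameCycle hv hu.2
    have := exists_badCard_lt_or hτ hs (O := Finset.univ.filter fun w => (h * τ).SameCycle u w)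
      (fun v => by
        simp only [Finset.mem_filter, Finset.mem_univ, true_and]
        exact Perm.sameCycle_apply_right (f := h * τ))
      (fun v hv => hu.1 v (by simpa using hv)) (fun v hv => h2 v (by simpa using hv))
    simpa using this
  rcases key hs hu with ⟨h', g', ha, hb⟩ | hO
  · exact ⟨h', g', ha, Or.inl hb⟩
  set O : V → Prop := fun w => (h * τ).SameCycle u w with hOdef
  have hOφ : ∀ v, O (h (τ v)) ↔ O v := fun v => Perm.sameCycle_apply_right (f := h * τ)
  have hbad : ∀ v, O v → g (h (τ v)) = h v := fun v hv => hu.1 v hv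
  -- the cycles of `g` through the vertices of `O` alternate between `O` and `g '' O`
  set C : V → Prop := fun v => O v ∨ O (g.symm v) with hCdef
  have hC : ∀ v, C (g v) ↔ C v := by
    intro v
    simp only [hCdef, Equiv.symm_apply_apply]
    constructor
    · rintro (h1 | h1)
      · right
        obtain ⟨y, hy⟩ : ∃ y, h (τ y) = g v := (τ.trans h).surjective _
        have hyO : O y := by rw [← hOφ, hy]; exact h1
        have := (hO y hyO).2
        rw [hy] at this
        rw [← g.injective this, Equiv.symm_apply_apply]
        exact hyO
      · exact Or.inl h1
    · rintro (h1 | h1)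
      · exact Or.inr h1
      · left
        have := (hO _ h1).2
        rw [Equiv.apply_symm_apply] at this
        rw [this, hOφ]
        exact h1
  have hinj : Function.Injective fun v => if C v then g.symm v else g v := by
    have hC' : ∀ v, C (g.symm v) ↔ C v := fun v => by
      rw [← hC, Equiv.apply_symm_apply]
    intro v x hvx
    by_cases hv : C v <;> by_cases hx : C x <;> simp only [hv, hx, if_true, if_false] at hvx
    · exact g.symm.injective hvx
    · exact absurd ((hC x).1 (hvx ▸ (hC' v).2 hv)) hx
    · exact absurd ((hC v).1 (hvx ▸ (hC' x).2 hx)) hv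
    · exact g.injective hvx
  let g' : Perm V := Equiv.ofBijective _ (Finite.injective_iff_bijective.1 hinj)
  have g'1 : ∀ v, C v → g' v = g.symm v := fun v hv => if_pos hv
  have g'0 : ∀ v, ¬ C v → g' v = g v := fun v hv => if_neg hv
  have ha : arcs h g' = arcs h g := by
    rw [arcs_eq_add, arcs_eq_add]
    congr 1
    rw [← Finset.sum_filter_add_sum_filter_not _ C,
      ← Finset.sum_filter_add_sum_filter_not (s := Finset.univ) (p := C)
        (f := fun v => ({s(v, g v)} : Multiset (Sym2 V)))]
    congr 1
    · symm
      refine Finset.sum_equiv g (by simp [hC]) fun v hv => ?_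
      rw [g'1 _ ((hC v).2 (Finset.mem_filter.1 hv).2), Equiv.symm_apply_apply, Sym2.eq_swap]
    · refine Finset.sum_congr rfl fun v hv => ?_
      rw [g'0 _ (Finset.mem_filter.1 hv).2]
  have hs' : EdgeDistinct G (arcs h g') := ha ▸ hs
  have hnotbad : ∀ v, O v → ¬ IsBad τ h g' v := by
    intro v hv hb
    have hb : g' (h (τ v)) = h v := hb
    rw [g'1 _ (Or.inl ((hOφ v).2 hv)), ← (hO v hv).2, Equiv.symm_apply_apply] at hb
    have h3 := hbad v hv
    rw [← hb] at h3
    exact hs.arc_ne_arc (v := v) (w := v) (by rw [← hb])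
  have hbad_old : ∀ v, ¬ O (τ v) → ¬ O v → IsBad τ h g' v → IsBad τ h g v := by
    intro v hvR hvO hb
    have hb : g' (h (τ v)) = h v := hb
    rwa [g'0] at hb
    rintro (h3 | h3)
    · exact hvO ((hOφ v).1 h3)
    · obtain ⟨y, hy⟩ : ∃ y, h (τ y) = g.symm (h (τ v)) := (τ.trans h).surjective _
      have hyO : O y := by rw [← hOφ, hy]; exact h3
      have h4 := hbad y hyO
      rw [hy, Equiv.apply_symm_apply] at h4
      exact hvR (h.injective h4 ▸ hyO)
  have hle : badCard τ h g' ≤ badCard τ h g := by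
    have hsub : Finset.univ.filter (IsBad τ h g') ⊆ (Finset.univ.filter (IsBad τ h g) \
        Finset.univ.filter O) ∪ ((Finset.univ.filter O).image τ) := by
      intro v hv
      have hv := (Finset.mem_filter.1 hv).2
      simp only [Finset.mem_union, Finset.mem_sdiff, Finset.mem_filter, Finset.mem_univ, true_and,
        Finset.mem_image]
      by_cases hvR : O (τ v)
      · exact Or.inr ⟨τ v, hvR, hτ v⟩
      · have hvO : ¬ O v := fun hvO => hnotbad v hvO hv
        exact Or.inl ⟨hbad_old v hvR hvO hv, hvO⟩
    have hOB : Finset.univ.filter O ⊆ Finset.univ.filter (IsBad τ h g) := fun v hv =>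
      Finset.mem_filter.2 ⟨Finset.mem_univ v, hbad v (Finset.mem_filter.1 hv).2⟩
    have h3 : (Finset.univ.filter O).card ≤ badCard τ h g := Finset.card_le_card hOB
    calc badCard τ h g' ≤ _ := Finset.card_le_card hsub
      _ ≤ _ := Finset.card_union_le _ _
      _ ≤ (badCard τ h g - (Finset.univ.filter O).card) + (Finset.univ.filter O).card := by
        refine add_le_add ?_ Finset.card_image_le
        rw [Finset.card_sdiff_of_subset hOB]; rfl
      _ = badCard τ h g := Nat.sub_add_cancel h3
  -- the vertices that become bad must not lie on a new long cycle of bad vertices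
  by_cases hnew : ∃ v, O (τ v) ∧ v ∈ longBad τ h g'
  · obtain ⟨v, hvO, hv⟩ := hnew
    rcases key hs' hv with ⟨h'', g'', ha', hb'⟩ | hO'
    · exact ⟨h'', g'', ha'.trans ha, Or.inl (lt_of_lt_of_le hb' hle)⟩
    · exfalso
      -- `v = τ x` for a vertex `x` of `O`
      obtain ⟨x, hx, rfl⟩ : ∃ x, O x ∧ τ x = v := ⟨τ v, hvO, hτ v⟩
      have h3 := (hO' (h x) (by
        have : (h * τ).SameCycle (τ x) ((h * τ) (τ x)) :=
          Perm.sameCycle_apply_right.2 (Perm.SameCycle.refl _ _)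
        rwa [Perm.mul_apply, hτ] at this)).2
      have h4 : O (h (τ x)) := (hOφ x).2 hx
      have h5 : g' (h x) = h (τ x) := by
        rw [← hbad x hx, g'1 _ (Or.inr (by rwa [Equiv.symm_apply_apply])), Equiv.symm_apply_apply]
      have h6 : g' (h (τ x)) = g x := by
        rw [g'1 _ (Or.inl h4), ← (hO x hx).2, Equiv.symm_apply_apply]
      rw [h5, h6] at h3
      obtain ⟨y, hy⟩ : ∃ y, h (τ y) = x := (τ.trans h).surjective _
      have hyO : O y := by rw [← hOφ, hy]; exact hx
      have h7 := hbad y hyO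
      rw [hy, h3] at h7
      have h8 := h.injective h7
      refine hs.arc_arc_ne x ?_
      rw [← hτ (h x), h8, hy]
  · refine ⟨h, g', ha, Or.inr ⟨hle, ?_⟩⟩
    refine Set.ncard_lt_ncard ⟨fun v hv => ⟨fun w hw => ?_, hv.2⟩, fun hsub => ?_⟩
    · have hwl : w ∈ longBad τ h g' :=
        ⟨fun x hx => hv.1 x (hw.trans hx), apply_apply_ne_of_sameCycle hw hv.2⟩
      refine hbad_old w (fun hwO => hnew ⟨w, hwO, hwl⟩) (fun hwO => hnotbad w hwO (hv.1 w hw))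
        (hv.1 w hw)
    · exact hnotbad u (Perm.SameCycle.refl _ _) ((hsub hu).1 u (Perm.SameCycle.refl _ _))

/-- The permutations `h` and `g` can be chosen such that every cycle of `φ = h ∘ τ` that consists of
bad vertices has length two. -/
theorem exists_longBad_eq_empty (hτ : ∀ x, τ (τ x) = x) (hs : EdgeDistinct G (arcs h g)) :
    ∃ h' g' : Perm V, arcs h' g' = arcs h g ∧ longBad τ h' g' = ∅ := by
  induction hn : badCard τ h g * (Fintype.card V + 1) + (longBad τ h g).ncard using
    Nat.strong_induction_on generalizing h g with
  | _ n ih =>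
  subst hn
  rcases (longBad τ h g).eq_empty_or_nonempty with h0 | ⟨u, hu⟩
  · exact ⟨h, g, rfl, h0⟩
  have hcard : ∀ s : Set V, s.ncard ≤ Fintype.card V := fun s => by
    rw [← Nat.card_eq_fintype_card]; exact Set.ncard_le_card s
  obtain ⟨h', g', ha, hlt⟩ := exists_longBad_lt hτ hs hu
  obtain ⟨h'', g'', ha', hl⟩ := ih _ (by
    rcases hlt with hlt | ⟨hle, hlt⟩
    · have h1 := hcard (longBad τ h' g')
      have h2 : (badCard τ h' g' + 1) * (Fintype.card V + 1) ≤
        badCard τ h g * (Fintype.card V + 1) := Nat.mul_le_mul_right _ hlt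
      rw [add_mul] at h2
      omega
    · have h2 : badCard τ h' g' * (Fintype.card V + 1) ≤
        badCard τ h g * (Fintype.card V + 1) := Nat.mul_le_mul_right _ hle
      omega) (ha ▸ hs) rfl
  exact ⟨h'', g'', ha'.trans ha, hl⟩

/-- If every cycle of `φ = h ∘ τ` that consists of bad vertices has length two, then some set
of bad vertices contains no two vertices `u` and `φ u`, but `u` or `φ u` for every bad vertex `u`. The
cycles of `φ` are cut into runs of bad vertices, of which every other vertex is taken. -/
theorem exists_bad_selection_of_longBad_eq_empty (hs : EdgeDistinct G (arcs h g))
    (hl : longBad τ h g = ∅) : ∃ A : Set V, (∀ u ∈ A, IsBad τ h g u ∧ h (τ u) ∉ A) ∧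
      ∀ u, IsBad τ h g u → u ∈ A ∨ h (τ u) ∈ A := by
  obtain ⟨e⟩ : Nonempty (V ≃ Fin (Fintype.card V)) := ⟨Fintype.equivFin V⟩
  -- bad vertices are selected alternately, going back from the first vertex that is not bad
  let T : ℕ → V → Prop := fun n u => (∀ j < n, IsBad τ h g (((h * τ) ^ j) u)) ∧
    ¬ IsBad τ h g (((h * τ) ^ n) u)
  have hTs : ∀ n u, T (n + 1) u ↔ IsBad τ h g u ∧ T n (h (τ u)) := by
    intro n u
    have h1 : ∀ j, ((h * τ) ^ (j + 1)) u = ((h * τ) ^ j) (h (τ u)) := fun j => by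
      rw [pow_succ]; rfl
    simp only [T, h1, Nat.forall_lt_succ_left, pow_zero, Perm.one_apply, and_assoc]
  have hTu : ∀ n n' u, T n u → T n' u → n = n' := by
    intro n n' u h1 h2
    rcases lt_trichotomy n n' with h3 | h3 | h3
    · exact absurd (h2.1 n h3) h1.2
    · exact h3
    · exact absurd (h1.1 n' h3) h2.2
  let F : V → Prop := fun u => ∀ w, (h * τ).SameCycle u w → IsBad τ h g w
  have hTF : ∀ u, F u ∨ ∃ n, T n u := by
    intro u
    by_cases hF : F u
    · exact Or.inl hF
    · right
      simp only [F] at hF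
      push Not at hF
      obtain ⟨w, hw, hwb⟩ := hF
      obtain ⟨n, rfl⟩ := hw.exists_nat_pow_eq
      have hex : ∃ n, ¬ IsBad τ h g (((h * τ) ^ n) u) := ⟨n, hwb⟩
      classical
      exact ⟨Nat.find hex, fun j hj => not_not.1 (Nat.find_min hex hj), Nat.find_spec hex⟩
  have hFT : ∀ u, F u → ∀ n, ¬ T n u := fun u hu n hn => hn.2 (hu _ ⟨n, by simp⟩)
  have hFφ : ∀ u, F (h (τ u)) ↔ F u := fun u =>
    forall_congr' fun w => by
      rw [show h (τ u) = (h * τ) u from rfl, Perm.sameCycle_apply_left]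
  have hF2 : ∀ u, F u → h (τ (h (τ u))) = u := by
    intro u hu
    by_contra hne
    exact Set.eq_empty_iff_forall_notMem.1 hl u ⟨hu, hne⟩
  have hFne : ∀ u, F u → h (τ u) ≠ u := by
    intro u hu hφ
    have h1 : g (h (τ u)) = h u := hu u (Perm.SameCycle.refl _ _)
    rw [hφ] at h1
    exact hs.arc_ne_arc (v := u) (w := u) (by rw [h1])
  refine ⟨{u | (∃ n, Odd n ∧ T n u) ∨ (F u ∧ e u < e (h (τ u)))}, ?_, ?_⟩
  · rintro u (⟨n, hn, hT⟩ | ⟨hF, hlt⟩)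
    · obtain ⟨n, rfl⟩ : ∃ n', n = n' + 1 := ⟨n - 1, by have := hn.pos; omega⟩
      have h1 := (hTs n u).1 hT
      refine ⟨h1.1, ?_⟩
      rintro (⟨n', hn', hT'⟩ | ⟨hF, -⟩)
      · rw [hTu _ _ _ hT' h1.2] at hn'
        exact (Nat.even_or_odd n).elim (fun h2 => (Nat.not_even_iff_odd.2 hn') h2)
          fun h2 => (Nat.not_even_iff_odd.2 hn) h2.add_one
      · exact hFT _ hF _ h1.2
    · refine ⟨hF u (Perm.SameCycle.refl _ _), ?_⟩
      rintro (⟨n', hn', hT'⟩ | ⟨hF', hlt'⟩)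
      · exact hFT _ ((hFφ u).2 hF) _ hT'
      · rw [hF2 u hF] at hlt'
        exact lt_asymm hlt hlt'
  · intro u hu
    rcases hTF u with hF | ⟨n, hT⟩
    · rcases lt_or_gt_of_ne (fun h1 : e (h (τ u)) = e u => hFne u hF (e.injective h1)) with h1 | h1
      · right; right
        exact ⟨(hFφ u).2 hF, by rwa [hF2 u hF]⟩
      · left; right
        exact ⟨hF, h1⟩
    · rcases Nat.even_or_odd n with h1 | h1
      · cases n with
        | zero => exact absurd hu hT.2
        | succ n =>
          right; left
          refine ⟨n, ?_, ((hTs n u).1 hT).2⟩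
          by_contra h2
          exact (Nat.not_even_iff_odd.2 (Nat.not_odd_iff_even.1 h2).add_one) h1
      · left; left
        exact ⟨n, h1, hT⟩

/-- The permutations `h` and `g` can be chosen such that there is a set `A` of bad vertices that
contains no two vertices `u` and `φ u`, where `φ = h ∘ τ`, but contains `u` or `φ u` for every bad
vertex `u`. -/
theorem exists_bad_selection (hτ : ∀ x, τ (τ x) = x) (hs : EdgeDistinct G (arcs h g)) :
    ∃ h' g' : Perm V, arcs h' g' = arcs h g ∧ ∃ A : Set V,
      (∀ u ∈ A, IsBad τ h' g' u ∧ h' (τ u) ∉ A) ∧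
      ∀ u, IsBad τ h' g' u → u ∈ A ∨ h' (τ u) ∈ A := by
  obtain ⟨h', g', ha, hl⟩ := exists_longBad_eq_empty hτ hs
  exact ⟨h', g', ha, exists_bad_selection_of_longBad_eq_empty (ha ▸ hs) hl⟩

end Arcs


/-! ### Factorization into permutations -/

section Factorization

open Equiv

variable {V : Type*} [Fintype V] [DecidableEq V]

/-- A multiset of arcs in which every vertex is the tail of `r` arcs and the head of `r` arcs is the
union of `r` permutations, by Hall's theorem. -/
theorem exists_perms_of_arcs (r : ℕ) (M : Multiset (V × V))
    (h1 : ∀ v, M.countP (fun p => p.1 = v) = r) (h2 : ∀ v, M.countP (fun p => p.2 = v) = r) :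
    ∃ f : Fin r → Perm V, M = ∑ j, Finset.univ.val.map fun v => (v, f j v) := by
  induction r generalizing M with
  | zero =>
    refine ⟨fun j => j.elim0, ?_⟩
    rw [Finset.univ_eq_empty, Finset.sum_empty]
    refine Multiset.eq_zero_of_forall_notMem fun p hp => ?_
    exact (Multiset.countP_eq_zero.1 (h1 p.1)) p hp rfl
  | succ r ih =>
    have hsum : ∀ (M : Multiset (V × V)) (q : V × V → V) (s : Finset V),
        M.countP (fun p => q p ∈ s) = ∑ v ∈ s, M.countP (fun p => q p = v) := by
      intro M q s
      induction s using Finset.induction_on with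
      | empty => simp
      | insert v s hv ih =>
        rw [Finset.sum_insert hv, ← ih]
        clear ih
        induction M using Multiset.induction_on with
        | empty => simp
        | cons p M ihM =>
          simp only [Finset.mem_insert] at ihM
          simp only [Multiset.countP_cons, ihM, Finset.mem_insert]
          by_cases hp : q p = v
          · simp [hp, hv]; omega
          · simp [hp]; omega
    obtain ⟨f, hf, hfM⟩ := (Finset.all_card_le_biUnion_card_iff_exists_injective
      fun v => Finset.univ.filter fun w => (v, w) ∈ M).1 fun s => by
        set N := s.biUnion fun v => Finset.univ.filter fun w => (v, w) ∈ M
        have h3 : M.countP (fun p => p.1 ∈ s) ≤ M.countP (fun p => p.2 ∈ N) := by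
          rw [Multiset.countP_eq_card_filter, Multiset.countP_eq_card_filter]
          refine Multiset.card_le_card (Multiset.le_filter.2 ⟨Multiset.filter_le _ _, ?_⟩)
          rintro ⟨v, w⟩ hp
          rw [Multiset.mem_filter] at hp
          exact Finset.mem_biUnion.2 ⟨v, hp.2, by simpa using hp.1⟩
        rw [hsum, hsum, Finset.sum_congr rfl fun v _ => h1 v, Finset.sum_congr rfl fun v _ => h2 v,
          Finset.sum_const, Finset.sum_const, smul_eq_mul, smul_eq_mul] at h3
        exact Nat.le_of_mul_le_mul_right h3 r.succ_pos
    let σ : Perm V := Equiv.ofBijective f (Finite.injective_iff_bijective.1 hf)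
    have hle : (Finset.univ.val.map fun v => (v, σ v)) ≤ M := by
      refine (Multiset.le_iff_subset ?_).2 fun p hp => ?_
      · exact Multiset.Nodup.map (fun v w hvw => (Prod.mk.inj hvw).1) Finset.univ.nodup
      · obtain ⟨v, -, rfl⟩ := Multiset.mem_map.1 hp
        exact (Finset.mem_filter.1 (hfM v)).2
    obtain ⟨M', rfl⟩ := Multiset.le_iff_exists_add.1 hle
    have hc1 : ∀ v, (Finset.univ.val.map fun v => (v, σ v)).countP (fun p => p.1 = v) = 1 := by
      intro v
      rw [Multiset.countP_map, ← Finset.filter_val, Finset.card_val, Finset.card_eq_one]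
      exact ⟨v, by ext; simp⟩
    have hc2 : ∀ v, (Finset.univ.val.map fun v => (v, σ v)).countP (fun p => p.2 = v) = 1 := by
      intro v
      rw [Multiset.countP_map, ← Finset.filter_val, Finset.card_val, Finset.card_eq_one]
      exact ⟨σ.symm v, by ext; simp [Equiv.eq_symm_apply]⟩
    obtain ⟨f', hf'⟩ := ih M'
      (fun v => by have := h1 v; rw [Multiset.countP_add, hc1] at this; omega)
      (fun v => by have := h2 v; rw [Multiset.countP_add, hc2] at this; omega)
    refine ⟨Fin.cons σ f', ?_⟩
    rw [Fin.sum_univ_succ, hf']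
    rfl

/-- Petersen's theorem: the edges of a `2 * r`-regular graph are the arcs of `r` permutations. The
edges are oriented by an assignment of edges to incident vertices that uses every vertex exactly
`r` times. -/
theorem exists_perms (r : ℕ) (F : Finset (Sym2 V)) (hF : ∀ e ∈ F, ¬ e.IsDiag)
    (hdeg : ∀ v, (F.filter fun e => v ∈ e).card = 2 * r) :
    ∃ f : Fin r → Perm V, F.val = ∑ j, ∑ v, {s(v, f j v)} := by
  have hends : ∀ e ∈ F, (Finset.univ.filter fun v => v ∈ e).card = 2 := by
    intro e he
    induction e using Sym2.ind with
    | _ a b =>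
      have hab : a ≠ b := fun h => hF _ he (by simpa using h)
      rw [show (Finset.univ.filter fun v => v ∈ s(a, b)) = {a, b} by ext; simp,
        Finset.card_pair hab]
  obtain ⟨c, hc, hcF⟩ := (Finset.all_card_le_biUnion_card_iff_exists_injective
    fun e : F => (Finset.univ.filter fun v => v ∈ e.1) ×ˢ (Finset.univ : Finset (Fin r))).1 fun S => by
      let N := S.biUnion fun e : F => Finset.univ.filter fun v => v ∈ e.1
      have h1 : S.card * 2 ≤ N.card * (2 * r) := by
        refine Finset.card_mul_le_card_mul (fun (e : F) v => v ∈ e.1) (fun e he => ?_) fun v _ => ?_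
        · rw [← hends e.1 e.2]
          refine Finset.card_le_card fun v hv => ?_
          rw [Finset.mem_bipartiteAbove]
          exact ⟨Finset.mem_biUnion.2 ⟨e, he, hv⟩, (Finset.mem_filter.1 hv).2⟩
        · rw [← hdeg v, ← Finset.card_map (Function.Embedding.subtype _)]
          refine Finset.card_le_card fun e he => ?_
          obtain ⟨e, hev, rfl⟩ := Finset.mem_map.1 he
          rw [Finset.mem_bipartiteBelow] at hev
          exact Finset.mem_filter.2 ⟨e.2, hev.2⟩
      have h2 : (S.biUnion fun e : F => (Finset.univ.filter fun v => v ∈ e.1) ×ˢ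
          (Finset.univ : Finset (Fin r))) = N ×ˢ Finset.univ := by
        ext ⟨v, j⟩
        simp [N]
      rw [h2, Finset.card_product, Finset.card_univ, Fintype.card_fin]
      have h3 : N.card * (2 * r) = (N.card * r) * 2 := by ring
      omega
  have hcard : Fintype.card F = Fintype.card (V × Fin r) := by
    have h1 : ∑ e ∈ F, (Finset.univ.filter fun v => v ∈ e).card =
        ∑ v, (F.filter fun e => v ∈ e).card :=
      Finset.sum_card_bipartiteAbove_eq_sum_card_bipartiteBelow fun e v => v ∈ e
    rw [Finset.sum_congr rfl hends, Finset.sum_congr rfl fun v _ => hdeg v, Finset.sum_const,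
      Finset.sum_const, smul_eq_mul, smul_eq_mul, Finset.card_univ] at h1
    rw [Fintype.card_coe, Fintype.card_prod, Fintype.card_fin]
    have h3 : Fintype.card V * (2 * r) = (Fintype.card V * r) * 2 := by ring
    omega
  let ε : (V × Fin r) ≃ F :=
    (Equiv.ofBijective c ((Fintype.bijective_iff_injective_and_card c).2 ⟨hc, hcard⟩)).symm
  have hε : ∀ p, p.1 ∈ (ε p).1 := by
    intro p
    have h1 : c (ε p) = p := (Equiv.ofBijective c _).apply_symm_apply p
    have h2 := hcF (ε p)
    rw [h1] at h2
    simpa using h2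
  choose w hw using hε
  have hval : F.val = Finset.univ.val.map fun p => s(p.1, w p) := by
    have h1 : (Finset.univ.map (ε.toEmbedding.trans (Function.Embedding.subtype (· ∈ F)))) = F := by
      ext e
      simp only [Finset.mem_map, Finset.mem_univ, true_and]
      constructor
      · rintro ⟨p, rfl⟩; exact (ε p).2
      · intro he; exact ⟨ε.symm ⟨e, he⟩, by simp⟩
    conv_lhs => rw [← h1, Finset.map_val]
    exact Multiset.map_congr rfl fun p _ => hw p
  let M : Multiset (V × V) := Finset.univ.val.map fun p : V × Fin r => (p.1, w p)
  have hM1 : ∀ v, M.countP (fun p => p.1 = v) = r := by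
    intro v
    rw [Multiset.countP_map, ← Finset.filter_val, Finset.card_val]
    have : (Finset.univ.filter fun p : V × Fin r => p.1 = v) = {v} ×ˢ Finset.univ := by
      ext; rw [Finset.mem_product, Finset.mem_filter, Finset.mem_singleton]; simp
    rw [this, Finset.card_product, Finset.card_univ, Fintype.card_fin, Finset.card_singleton,
      one_mul]
  have hne : ∀ p, p.1 ≠ w p := fun p h => hF _ (ε p).2 (by rw [hw p]; exact h)
  have hM : ∀ v, M.countP (fun p => p.1 = v) + M.countP (fun p => p.2 = v) = 2 * r := by
    intro v
    have h1 : F.val.countP (fun e => v ∈ e) = 2 * r := by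
      rw [← hdeg v, Finset.card, Finset.filter_val, Multiset.countP_eq_card_filter]
    rw [hval, Multiset.countP_map] at h1
    rw [Multiset.countP_map, Multiset.countP_map, ← Multiset.card_add, ← h1]
    simp only [← Finset.filter_val, Finset.card_val, Multiset.card_add]
    rw [← Finset.card_union_of_disjoint]
    · congr 1
      ext p
      simp [eq_comm]
    · rw [Finset.disjoint_filter]
      exact fun p _ h1 h2 => hne p (h1.trans h2.symm)
  obtain ⟨f, hf⟩ := exists_perms_of_arcs r M hM1 fun v => by
    have h1 := hM1 v
    have h2 := hM v
    omega
  refine ⟨f, ?_⟩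
  have h1 : F.val = M.map fun p => s(p.1, p.2) := by
    rw [hval, Multiset.map_map]; rfl
  have h2 : ∀ N : Fin r → Multiset (V × V), (∑ j, N j).map (fun p => s(p.1, p.2)) =
      ∑ j, (N j).map (fun p => s(p.1, p.2)) :=
    fun N => map_sum (Multiset.mapAddMonoidHom fun p : V × V => s(p.1, p.2)) _ _
  rw [h1, hf, h2]
  refine Finset.sum_congr rfl fun j _ => ?_
  rw [sum_singleton_eq_map, Multiset.map_map]
  rfl

end Factorization


/-! ### Paths that start and end at every vertex once -/

section Rays

open Equiv

variable {V : Type*}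

/-- The vertex list that starts in `x` and follows the given permutations one after the other. -/
def ray : List (Perm V) → V → List V
  | [], x => [x]
  | f :: fs, x => x :: ray fs (f x)

/-- The permutation that maps the first vertex of a ray to its last vertex. -/
def rayPerm : List (Perm V) → Perm V
  | [] => 1
  | f :: fs => rayPerm fs * f

theorem length_ray (fs : List (Perm V)) (x : V) : (ray fs x).length = fs.length + 1 := by
  induction fs generalizing x with
  | nil => rfl
  | cons f fs ih => simp [ray, ih]

theorem ray_eq_cons (fs : List (Perm V)) (x : V) : ∃ l, ray fs x = x :: l := by
  cases fs <;> exact ⟨_, rfl⟩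

theorem ray_eq_append (fs : List (Perm V)) (x : V) : ∃ l, ray fs x = l ++ [rayPerm fs x] := by
  induction fs generalizing x with
  | nil => exact ⟨[], rfl⟩
  | cons f fs ih =>
    obtain ⟨l, hl⟩ := ih (f x)
    exact ⟨x :: l, by rw [ray, hl]; rfl⟩

theorem sum_pathEdges_ray [Fintype V] (fs : List (Perm V)) :
    ∑ x, pathEdges (ray fs x) = (fs.map fun f => ∑ v, ({s(v, f v)} : Multiset (Sym2 V))).sum := by
  induction fs with
  | nil => simp [ray]
  | cons f fs ih =>
    rw [List.map_cons, List.sum_cons, ← ih, ← Equiv.sum_comp f (fun x => pathEdges (ray fs x)),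
      ← Finset.sum_add_distrib]
    refine Finset.sum_congr rfl fun x _ => ?_
    obtain ⟨l, hl⟩ := ray_eq_cons fs (f x)
    rw [ray, hl, pathEdges_cons_cons, Multiset.singleton_add]

end Rays

section Halves

open Equiv

variable {V : Type*} {G : SimpleGraph V} {k : ℕ}

/-- A trail of length `2 * k - 1` in a graph of girth at least `2 * k - 2` is a path, provided that it
does not repeat a vertex close to its ends. -/
theorem nodup_of_edgeDistinct (hg : ((2 * k - 2 : ℕ) : ℕ∞) ≤ G.egirth) {a b c d : V} {l : List V}
    (h : EdgeDistinct G (pathEdges (a :: b :: (l ++ [c, d])))) (hl : l.length + 4 = 2 * k)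
    (hac : a ≠ c) (hbd : b ≠ d) (had : a ≠ d) : (a :: b :: (l ++ [c, d])).Nodup := by
  by_contra hnd
  obtain ⟨p, x, q, r, he⟩ := exists_eq_append_of_not_nodup hnd
  rw [he] at h
  have h1 := le_length_of_trail hg h
  have h2 := congrArg List.length he
  simp only [List.length_cons, List.length_append, List.length_nil] at h2
  have hlast : (a :: b :: (l ++ [c, d])).reverse = d :: c :: (l.reverse ++ [b, a]) := by simp
  have hlast' := congrArg List.reverse he
  rw [hlast] at hlast'
  simp only [List.append_assoc, List.cons_append, List.reverse_append, List.reverse_cons] at hlast'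
  rcases p with _ | ⟨y, p⟩
  · simp only [List.nil_append, List.cons_append, List.cons.injEq] at he
    rcases r with _ | ⟨z, r⟩
    · simp at hlast'
      exact had (he.1.trans hlast'.1.symm)
    · simp only [List.length_cons, List.length_nil] at h2
      obtain rfl : r = [] := List.eq_nil_of_length_eq_zero (by omega)
      simp at hlast'
      exact hac (he.1.trans hlast'.2.1.symm)
  · simp only [List.length_cons] at h2
    obtain rfl : p = [] := List.eq_nil_of_length_eq_zero (by omega)
    obtain rfl : r = [] := List.eq_nil_of_length_eq_zero (by omega)
    simp only [List.nil_append, List.cons_append, List.cons.injEq] at he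
    simp at hlast'
    exact hbd (he.2.1.trans hlast'.1.symm)

variable (τ h g : Perm V) (A : Set V)

open Classical in
/-- The continuation of an arc `c`: usually it follows `g`, but the roles of `h` and `g` are exchanged
at the vertices of `A`. -/
noncomputable def next (c : V) : V := if c ∈ A then h c else g c

open Classical in
/-- The continuation of a path at its end `s`. If `s` is in `A`, the path is continued by one vertex
at this end and by three vertices at its other end `τ s`; by two vertices at each end if neither of
the two ends is in `A`. -/
noncomputable def half (s : V) : List V :=
  if s ∈ A then [g s] else
    if τ s ∈ A then [h s, h (τ s), next h g A (h (τ s))] else [h s, next h g A (h s)]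

open Classical in
/-- The last vertex of the continuation at `s`. -/
noncomputable def tip (s : V) : V :=
  if s ∈ A then g s else if τ s ∈ A then next h g A (h (τ s)) else next h g A (h s)

open Classical in
/-- The vertex before the last one of the continuation at `s`. -/
noncomputable def neck (s : V) : V := if s ∈ A then s else if τ s ∈ A then h (τ s) else h s

variable {τ h g A}

open Classical in
theorem cons_half_eq (s : V) : ∃ l, s :: half τ h g A s = l ++ [neck τ h A s, tip τ h g A s] ∧
    (l.length = if s ∈ A then 0 else if τ s ∈ A then 2 else 1) := by
  unfold half neck tip
  split_ifs
  · exact ⟨[], rfl, rfl⟩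
  · exact ⟨[s, h s], rfl, rfl⟩
  · exact ⟨[s], rfl, rfl⟩

variable [Fintype V]

theorem notMem_of_mem (hτ : ∀ x, τ (τ x) = x) (hs : EdgeDistinct G (arcs h g))
    (hA : ∀ u ∈ A, IsBad τ h g u ∧ h (τ u) ∉ A) {s : V} (h1 : s ∈ A) : τ s ∉ A := by
  intro h2
  have h3 : g (h (τ s)) = h s := (hA s h1).1
  have h4 : g (h (τ (τ s))) = h (τ s) := (hA _ h2).1
  rw [hτ] at h4
  rw [arcs_comm] at hs
  exact hs.arc_arc_ne (h s) (by rw [h4, h3])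

/-- The continuation at one end does not run into the last but one vertex at the other end. This is
what the choice of `A` is for. -/
theorem tip_ne_neck (hτ : ∀ x, τ (τ x) = x) (hs : EdgeDistinct G (arcs h g))
    (hA : ∀ u ∈ A, IsBad τ h g u ∧ h (τ u) ∉ A)
    (hA' : ∀ u, IsBad τ h g u → u ∈ A ∨ h (τ u) ∈ A) (s : V) :
    tip τ h g A (τ s) ≠ neck τ h A s := by
  by_cases h1 : s ∈ A
  · have h2 := notMem_of_mem hτ hs hA h1
    simp only [tip, neck, h1, h2, hτ, if_true, if_false, next]
    split_ifs with h3
    · exact hs.arc_arc_ne s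
    · intro h4
      exact hs.arc_ne_arc (v := s) (w := h s) (by rw [h4]; exact Sym2.eq_swap)
  by_cases h2 : τ s ∈ A
  · simp only [tip, neck, h1, h2, if_true, if_false]
    intro h4
    exact hs.arc_ne_arc (v := τ s) (w := τ s) (by rw [h4])
  · simp only [tip, neck, h1, h2, hτ, if_false, next]
    split_ifs with h3
    · intro h4
      have h5 := h.injective h4
      exact h1 (h5 ▸ h3)
    · intro h4
      exact (hA' s h4).elim h1 h3

/-- Every vertex is the tip of exactly one continuation. -/
theorem bijective_tip (hτ : ∀ x, τ (τ x) = x)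
    (hA : ∀ u ∈ A, IsBad τ h g u ∧ h (τ u) ∉ A) : Function.Bijective (tip τ h g A) := by
  refine Finite.surjective_iff_bijective.1 fun y => ?_
  have key : ∀ c, (∀ s ∈ A, c ≠ h (τ s)) → ∃ s, tip τ h g A s = next h g A c := by
    intro c hc
    obtain ⟨t, rfl⟩ := h.surjective c
    have h2 : τ t ∉ A := fun h2 => hc _ h2 (by rw [hτ])
    by_cases h1 : t ∈ A
    · exact ⟨τ t, by simp only [tip, h2, hτ, h1, if_true, if_false]⟩
    · exact ⟨t, by simp only [tip, h1, h2, if_false]⟩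
  obtain ⟨c, rfl⟩ := g.surjective y
  by_cases hc : ∃ s ∈ A, c = h (τ s)
  · obtain ⟨s, hs', rfl⟩ := hc
    obtain ⟨t, ht⟩ := key s fun s' hs'' h1 => (hA s' hs'').2 (h1 ▸ hs')
    refine ⟨t, ht.trans ?_⟩
    rw [next, if_pos hs']
    exact (hA s hs').1.symm
  · push Not at hc
    by_cases h1 : c ∈ A
    · exact ⟨c, by rw [tip, if_pos h1]⟩
    · obtain ⟨t, ht⟩ := key c hc
      exact ⟨t, ht.trans (by rw [next, if_neg h1])⟩

/-- The continuations use the arcs of `h` and `g`. -/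
theorem sum_pathEdges_half (hτ : ∀ x, τ (τ x) = x) (hs : EdgeDistinct G (arcs h g))
    (hA : ∀ u ∈ A, IsBad τ h g u ∧ h (τ u) ∉ A) :
    ∑ s, pathEdges (s :: half τ h g A s) = arcs h g := by
  classical
  -- every arc `s (h s)` or `s (g s)` is either the first arc `a s` of the continuation at `s`, or the
  -- arc `X s`; for `s` in `A`, the arc `X (h s)` is used by the continuation at `τ s`
  let X : V → Multiset (Sym2 V) := fun c => {s(c, next h g A c)}
  let a : V → Multiset (Sym2 V) := fun s => {s(s, if s ∈ A then g s else h s)}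
  let d : V → Multiset (Sym2 V) := fun s => if s ∈ A then X (h s) else 0
  have h1 : ∀ s, pathEdges (s :: half τ h g A s) + d s = a s + X (h s) + d (τ s) := by
    intro s
    have hpe2 : ∀ x y : V, pathEdges [x, y] = {s(x, y)} := fun _ _ => rfl
    by_cases h1 : s ∈ A
    · have h2 := notMem_of_mem hτ hs hA h1
      simp only [half, d, a, h1, h2, if_true, if_false, add_zero, hpe2]
    by_cases h2 : τ s ∈ A
    · have h3 := hA _ h2
      have h4 : g (h (τ (τ s))) = h (τ s) := h3.1
      have h5 := h3.2
      rw [hτ] at h4 h5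
      simp only [half, d, a, X, h1, h2, if_true, if_false, add_zero]
      rw [pathEdges_cons_cons, pathEdges_cons_cons, hpe2, ← Multiset.singleton_add,
        ← Multiset.singleton_add, show next h g A (h s) = h (τ s) by rw [next, if_neg h5, h4],
        add_assoc]
    · simp only [half, d, a, X, h1, h2, if_false, add_zero]
      rw [pathEdges_cons_cons, hpe2, ← Multiset.singleton_add]
  have h2 := Finset.sum_congr (rfl : (Finset.univ : Finset V) = Finset.univ) fun s _ => h1 s
  simp only [Finset.sum_add_distrib] at h2
  rw [Equiv.sum_comp τ d, Equiv.sum_comp h X] at h2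
  rw [add_right_cancel h2, ← Finset.sum_add_distrib]
  refine Finset.sum_congr rfl fun c _ => ?_
  simp only [a, X, next]
  split_ifs
  · rw [add_comm]
  · rfl

end Halves


/-! ### The initial paths -/

section Initial

open Equiv

variable {V : Type*}

theorem pathEdges_reverse_append (x y : V) (A B : List V) :
    pathEdges ((y :: B).reverse ++ x :: A) =
      pathEdges (y :: B) + pathEdges (x :: A) + {s(y, x)} := by
  rw [List.reverse_cons, List.append_assoc, List.cons_append, List.nil_append,
    pathEdges_append_cons, pathEdges_cons_cons, ← List.reverse_cons, pathEdges_reverse,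
    ← Multiset.singleton_add, add_comm {s(y, x)}, add_assoc]

variable [Fintype V]

/-- The pairs of a fixed-point-free involution have a system of representatives. -/
theorem exists_representatives {σ : V → V} (hσ : ∀ x, σ (σ x) = x) (hσ' : ∀ x, σ x ≠ x) :
    ∃ R : Finset V, ∀ x, σ x ∈ R ↔ x ∉ R := by
  classical
  obtain ⟨e⟩ : Nonempty (V ≃ Fin (Fintype.card V)) := ⟨Fintype.equivFin V⟩
  refine ⟨Finset.univ.filter fun x => e x < e (σ x), fun x => ?_⟩
  simp only [Finset.mem_filter, Finset.mem_univ, true_and, hσ, not_lt]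
  exact ⟨le_of_lt, fun h => lt_of_le_of_ne h fun h1 => hσ' x (e.injective h1)⟩

variable [DecidableEq V]

theorem sum_representatives {α : Type*} [AddCommMonoid α] {σ : V → V} (hσ : ∀ x, σ (σ x) = x)
    {R : Finset V} (hR : ∀ x, σ x ∈ R ↔ x ∉ R) (f : V → α) :
    ∑ x ∈ R, (f (σ x) + f x) = ∑ x, f x := by
  rw [Finset.sum_add_distrib, ← Finset.sum_compl_add_sum R f]
  congr 1
  refine Finset.sum_bij' (fun x _ => σ x) (fun x _ => σ x) ?_ ?_ (fun x _ => hσ x) (fun x _ => hσ x)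
    (fun x _ => rfl)
  · intro x hx
    rw [Finset.mem_compl, hR, not_not]
    exact hx
  · intro x hx
    rw [hR]
    exact Finset.mem_compl.1 hx

theorem sum_representatives_matchEdges {σ : V → V} (hσ : ∀ x, σ (σ x) = x)
    {R : Finset V} (hR : ∀ x, σ x ∈ R ↔ x ∉ R) :
    ∑ x ∈ R, {s(σ x, x)} = matchEdges σ Finset.univ := by
  have h1 : (Finset.univ.image fun x => s(x, σ x)) = R.image fun x => s(σ x, x) := by
    ext e
    simp only [Finset.mem_image, Finset.mem_univ, true_and]
    constructor
    · rintro ⟨x, rfl⟩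
      by_cases hx : x ∈ R
      · exact ⟨x, hx, Sym2.eq_swap⟩
      · exact ⟨σ x, (hR x).2 hx, by rw [hσ]⟩
    · rintro ⟨x, -, rfl⟩
      exact ⟨x, Sym2.eq_swap⟩
  rw [matchEdges, h1, Finset.image_val_of_injOn]
  · rw [← Multiset.sum_map_singleton (R.val.map _), Multiset.map_map]
    rfl
  · intro x hx y hy hxy
    rcases Sym2.eq_iff.1 hxy with h2 | h2
    · exact h2.2
    · exact absurd (Finset.mem_coe.1 hx) ((hR x).1 (h2.1 ▸ hy))

variable {G : SimpleGraph V} [DecidableRel G.Adj] {k : ℕ} {m σ : V → V}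

/-- If all edges are covered by `k - 1` permutations and two matchings, then all edges outside one of
the matchings can be covered by paths of length `2 * k - 1`, such that every vertex is an end of
exactly one path. The paths pass through the edges of the other matching. -/
theorem exists_paths_of_perms (hg : ((2 * k - 2 : ℕ) : ℕ∞) ≤ G.egirth) (hσ : ∀ x, σ (σ x) = x)
    (hσ' : ∀ x, σ x ≠ x) {fs : List (Perm V)} (hfs : fs.length + 3 = k) {h g : Perm V}
    (hE : (fs.map fun f => ∑ v, ({s(v, f v)} : Multiset (Sym2 V))).sum + arcs h g +
      matchEdges σ Finset.univ + matchEdges m Finset.univ = G.edgeFinset.val) :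
    ∃ (R : Finset V) (l : R → List V) (p : V → R), 2 * R.card = Fintype.card V ∧
      (∀ i, (l i).Nodup) ∧ (∀ i, (l i).length = 2 * k) ∧ (∀ x i, IsEnd x (l i) ↔ p x = i) ∧
      ∑ i, pathEdges (l i) + matchEdges m Finset.univ = G.edgeFinset.val := by
  have hs : EdgeDistinct G (arcs h g) := edgeDistinct_edgeFinset.mono (by
    rw [← hE]
    exact ((Multiset.le_add_left _ _).trans (Multiset.le_add_right _ _)).trans
      (Multiset.le_add_right _ _))
  let σ' : Perm V := Function.Involutive.toPerm σ hσ
  let φ : Perm V := rayPerm fs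
  let τ : Perm V := φ * σ' * φ⁻¹
  have hτφ : ∀ x, τ (φ x) = φ (σ x) := fun x => by
    change φ (σ (φ.symm (φ x))) = _
    rw [Equiv.symm_apply_apply]
  have hτ : ∀ x, τ (τ x) = x := fun x => by
    obtain ⟨x, rfl⟩ := φ.surjective x
    rw [hτφ, hτφ, hσ]
  obtain ⟨h', g', ha, A, hA, hA'⟩ := exists_bad_selection hτ hs
  rw [← ha] at hE hs
  clear ha
  let arm : V → List V := fun x => ray fs x ++ half τ h' g' A (φ x)
  let trail : V → List V := fun x => (arm (σ x)).reverse ++ arm x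
  have harm : ∀ x, ∃ B, arm x = x :: B := fun x => by
    obtain ⟨B, hB⟩ := ray_eq_cons fs x
    exact ⟨B ++ half τ h' g' A (φ x), by simp only [arm, hB, List.cons_append]⟩
  classical
  have harm' : ∀ x, ∃ B, arm x = B ++ [neck τ h' A (φ x), tip τ h' g' A (φ x)] ∧
      B.length = fs.length + if φ x ∈ A then 0 else if τ (φ x) ∈ A then 2 else 1 := fun x => by
    obtain ⟨B, hB⟩ := ray_eq_append fs x
    obtain ⟨C, hC, hCl⟩ := cons_half_eq (τ := τ) (h := h') (g := g') (A := A) (φ x)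
    refine ⟨B ++ C, ?_, ?_⟩
    · simp only [arm, hB]
      rw [List.append_assoc, List.cons_append, List.nil_append, hC, List.append_assoc]
    · have := congrArg List.length hB
      rw [length_ray, List.length_append, List.length_singleton] at this
      rw [List.length_append, hCl]
      omega
  have hpe : ∀ x, pathEdges (trail x) =
      pathEdges (arm (σ x)) + pathEdges (arm x) + {s(σ x, x)} := fun x => by
    obtain ⟨B, hB⟩ := harm x
    obtain ⟨C, hC⟩ := harm (σ x)
    simp only [trail, hB, hC]
    exact pathEdges_reverse_append _ _ _ _
  have hpa : ∑ x, pathEdges (arm x) =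
      (fs.map fun f => ∑ v, ({s(v, f v)} : Multiset (Sym2 V))).sum + arcs h' g' := by
    rw [← sum_pathEdges_ray, ← sum_pathEdges_half hτ hs hA,
      ← Equiv.sum_comp φ fun s => pathEdges (s :: half τ h' g' A s), ← Finset.sum_add_distrib]
    refine Finset.sum_congr rfl fun x _ => ?_
    obtain ⟨B, hB⟩ := ray_eq_append fs x
    simp only [arm, hB]
    rw [List.append_assoc, List.cons_append, List.nil_append, pathEdges_append_cons]
  obtain ⟨R, hR⟩ := exists_representatives hσ hσ'
  -- there is one path for every edge `x (σ x)`
  have hsum : ∑ x ∈ R, pathEdges (trail x) + matchEdges m Finset.univ = G.edgeFinset.val := by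
    rw [← hE, ← hpa, Finset.sum_congr rfl fun x _ => hpe x, Finset.sum_add_distrib,
      sum_representatives hσ hR fun x => pathEdges (arm x), sum_representatives_matchEdges hσ hR]
  have hshape : ∀ x, ∃ B, trail x = tip τ h' g' A (φ (σ x)) :: neck τ h' A (φ (σ x)) ::
      (B ++ [neck τ h' A (φ x), tip τ h' g' A (φ x)]) ∧ B.length + 4 = 2 * k := fun x => by
    obtain ⟨B, hB, hBl⟩ := harm' x
    obtain ⟨C, hC, hCl⟩ := harm' (σ x)
    refine ⟨C.reverse ++ B, by simp only [trail, hB, hC]; simp, ?_⟩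
    rw [hτφ] at hBl hCl
    rw [hσ] at hCl
    have h1 : φ x ∈ A → φ (σ x) ∉ A := fun h1 => by
      rw [← hτφ]; exact notMem_of_mem hτ hs hA h1
    rw [List.length_append, List.length_reverse, hBl, hCl]
    by_cases h2 : φ x ∈ A <;> by_cases h3 : φ (σ x) ∈ A <;> simp only [h2, h3, if_true, if_false]
    · exact absurd h3 (h1 h2)
    all_goals omega
  have hnd : ∀ x ∈ R, (trail x).Nodup := fun x hx => by
    obtain ⟨B, hB, hBl⟩ := hshape x
    have hed : EdgeDistinct G (pathEdges (trail x)) := edgeDistinct_edgeFinset.mono (by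
      rw [← hsum]
      exact (Finset.single_le_sum_of_canonicallyOrdered (f := fun x => pathEdges (trail x)) hx).trans
        (Multiset.le_add_right _ _))
    rw [hB] at hed ⊢
    refine nodup_of_edgeDistinct hg hed hBl ?_ ?_ ?_
    · rw [← hτφ]; exact tip_ne_neck hτ hs hA hA' _
    · have := tip_ne_neck hτ hs hA hA' (φ (σ x))
      rw [hτφ, hσ] at this
      exact this.symm
    · intro h1
      exact hσ' x (φ.injective ((bijective_tip hτ hA).1 h1))
  let t : V ≃ V := Equiv.ofBijective _ (bijective_tip hτ hA)
  let rep : V → R := fun x => if hx : x ∈ R then ⟨x, hx⟩ else ⟨σ x, (hR x).2 hx⟩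
  have hrep : ∀ x (i : R), rep x = i ↔ x = σ i ∨ x = i := fun x i => by
    simp only [rep]
    split_ifs with hx
    · constructor
      · rintro rfl; exact Or.inr rfl
      · rintro (h1 | h1)
        · exact absurd i.2 ((hR i.1).1 (h1 ▸ hx))
        · exact Subtype.ext h1
    · constructor
      · rintro rfl; exact Or.inl (hσ x).symm
      · rintro (h1 | h1)
        · exact Subtype.ext ((congrArg σ h1).trans (hσ _))
        · exact absurd i.2 (h1 ▸ hx)
  refine ⟨R, fun i => trail i, fun y => rep (φ.symm (t.symm y)), ?_, fun i => hnd i i.2,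
    fun i => ?_, fun y i => ?_, ?_⟩
  · have := sum_representatives hσ hR fun _ => 1
    simp only [Finset.sum_const, smul_eq_mul, mul_one, Finset.card_univ] at this
    omega
  · obtain ⟨B, hB, hBl⟩ := hshape i
    change (trail i).length = 2 * k
    rw [hB]
    simp only [List.length_cons, List.length_append, List.length_nil]
    omega
  · obtain ⟨B, hB, hBl⟩ := hshape i
    change IsEnd y (trail i) ↔ _
    rw [hrep, Equiv.symm_apply_eq, Equiv.symm_apply_eq, Equiv.symm_apply_eq, Equiv.symm_apply_eq, hB]
    have h1 : (tip τ h' g' A (φ (σ i)) :: neck τ h' A (φ (σ i)) ::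
        (B ++ [neck τ h' A (φ i), tip τ h' g' A (φ i)])).getLast? = some (tip τ h' g' A (φ i)) := by
      simp [List.getLast?_cons]
    rw [IsEnd, h1, List.head?_cons, Option.some.injEq, Option.some.injEq, eq_comm,
      @eq_comm _ (tip τ h' g' A (φ i)) y]
    rfl
  · rw [Finset.sum_coe_sort R fun x => pathEdges (trail x)]
    exact hsum

theorem countP_matchEdges_univ (hm : ∀ x, m (m x) = x) (v : V) :
    (matchEdges m Finset.univ).countP (fun e => v ∈ e) = 1 := by
  rw [matchEdges_eq_cons hm (Finset.mem_univ v),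
    Multiset.countP_cons_of_pos (p := fun e => v ∈ e) _ (Sym2.mem_mk_left v (m v)),
    Multiset.countP_eq_zero.2]
  intro e he hv
  obtain ⟨x, hx, rfl⟩ := Finset.mem_image.1 he
  simp only [Finset.mem_sdiff, Finset.mem_univ, Finset.mem_insert, Finset.mem_singleton, true_and,
    not_or] at hx
  rcases Sym2.mem_iff.1 hv with rfl | rfl
  · exact hx.1 rfl
  · exact hx.2 (hm x).symm

/-- All edges outside one of two disjoint perfect matchings can be covered by paths of length
`2 * k - 1`, such that every vertex is an end of exactly one path. -/
theorem exists_initial_paths (hk : 3 ≤ k) (hg : ((2 * k - 2 : ℕ) : ℕ∞) ≤ G.egirth)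
    (hreg : G.IsRegularOfDegree (2 * k)) (hm : ∀ x, m (m x) = x) (hσ : ∀ x, σ (σ x) = x)
    (hmG : ∀ x, G.Adj x (m x)) (hσG : ∀ x, G.Adj x (σ x)) (hmσ : ∀ x, m x ≠ σ x) :
    ∃ (R : Finset V) (l : R → List V) (p : V → R), 2 * R.card = Fintype.card V ∧
      (∀ i, (l i).Nodup) ∧ (∀ i, (l i).length = 2 * k) ∧ (∀ x i, IsEnd x (l i) ↔ p x = i) ∧
      ∑ i, pathEdges (l i) + matchEdges m Finset.univ = G.edgeFinset.val := by
  obtain ⟨n, rfl⟩ : ∃ n, k = n + 3 := ⟨k - 3, by omega⟩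
  let I := Finset.univ.image fun x => s(x, σ x)
  let J := Finset.univ.image fun x => s(x, m x)
  have hdis : Disjoint I J := by
    rw [Finset.disjoint_left]
    intro e hI hJ
    obtain ⟨x, -, rfl⟩ := Finset.mem_image.1 hI
    obtain ⟨y, -, hxy⟩ := Finset.mem_image.1 hJ
    rcases Sym2.eq_iff.1 hxy with ⟨rfl, h1⟩ | ⟨rfl, h1⟩
    · exact hmσ _ h1
    · exact hmσ _ (by rw [h1, hσ])
  have hsub : I.disjUnion J hdis ⊆ G.edgeFinset := by
    intro e he
    rw [Finset.disjUnion_eq_union, Finset.mem_union] at he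
    rcases he with he | he <;> obtain ⟨x, -, rfl⟩ := Finset.mem_image.1 he
    · simpa using hσG x
    · simpa using hmG x
  have hE : (G.edgeFinset \ I.disjUnion J hdis).val + matchEdges σ Finset.univ +
      matchEdges m Finset.univ = G.edgeFinset.val := by
    rw [Finset.sdiff_val, add_assoc]
    exact tsub_add_cancel_of_le (Finset.val_le_iff.2 hsub)
  obtain ⟨f, hf⟩ := exists_perms (n + 2) (G.edgeFinset \ I.disjUnion J hdis)
    (fun e he => G.not_isDiag_of_mem_edgeFinset (Finset.mem_sdiff.1 he).1) fun v => by
      have h1 := countP_mem_edgeFinset (G := G) v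
      rw [← hE, Multiset.countP_add, Multiset.countP_add, countP_matchEdges_univ hσ,
        countP_matchEdges_univ hm, hreg v, Multiset.countP_eq_card_filter] at h1
      rw [Finset.card, Finset.filter_val]
      omega
  refine exists_paths_of_perms hg hσ (fun x => (hσG x).ne')
    (fs := List.ofFn fun j : Fin n => f j.castSucc.castSucc) (by simp)
    (h := f (Fin.last n).castSucc) (g := f (Fin.last (n + 1))) ?_
  rw [← hE, hf, Fin.sum_univ_castSucc, Fin.sum_univ_castSucc, List.map_ofFn, List.sum_ofFn,
    arcs_eq_add, ← add_assoc]
  rfl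

end Initial


/-! ### Decompositions into subgraphs -/

section Decomposition

variable {V : Type*} {G : SimpleGraph V}

theorem coe_edges_eq_pathEdges {u v : V} (w : G.Walk u v) :
    (w.edges : Multiset (Sym2 V)) = pathEdges w.support := by
  induction w with
  | nil => rfl
  | cons h w ih =>
    rw [SimpleGraph.Walk.support_cons, SimpleGraph.Walk.edges_cons, ← w.cons_tail_support,
      pathEdges_cons_cons, w.cons_tail_support, ← ih, Multiset.cons_coe]

theorem ncard_edgeSet_toSubgraph {u v : V} {w : G.Walk u v} (hw : w.IsPath) :
    w.toSubgraph.edgeSet.ncard = w.length := by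
  classical
  have : w.toSubgraph.edgeSet = (w.edges.toFinset : Set (Sym2 V)) := by
    ext e
    simp
  rw [this, Set.ncard_coe_finset, List.toFinset_card_of_nodup hw.isTrail.edges_nodup,
    SimpleGraph.Walk.length_edges]

/-- A vertex list of a path gives a path subgraph. Its length is determined by its edge set. -/
theorem exists_subgraph_of_list {l : List V} (hl : l ≠ []) (hnd : l.Nodup)
    (h : EdgeDistinct G (pathEdges l)) : ∃ H : G.Subgraph, (∀ e, e ∈ H.edgeSet ↔ e ∈ pathEdges l) ∧
      ∀ n, IsPathOfLength H n ↔ l.length = n + 1 := by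
  obtain ⟨a, A, rfl⟩ := List.exists_cons_of_ne_nil hl
  obtain ⟨w, hw⟩ := exists_walk_support_eq h.isChain
    (List.getLast?_eq_some_getLast (show a :: A ≠ [] by simp))
  have hp : w.IsPath := by rw [SimpleGraph.Walk.isPath_def, hw]; exact hnd
  have hlen : (a :: A).length = w.length + 1 := by
    simpa using (congrArg List.length hw).symm.trans w.length_support
  refine ⟨w.toSubgraph, fun e => ?_, fun n => ⟨?_, fun hn => ⟨_, _, w, hp, ?_, rfl⟩⟩⟩
  · rw [SimpleGraph.Walk.mem_edges_toSubgraph, ← Multiset.mem_coe, coe_edges_eq_pathEdges, hw]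
  · rintro ⟨u, v, q, hq, rfl, hH⟩
    have := ncard_edgeSet_toSubgraph hp
    rw [hH, ncard_edgeSet_toSubgraph hq] at this
    rw [hlen, this]
  · omega

/-- Lists of `2 * k` to `2 * k + 2` vertices that cover all edges give the decomposition. The average
number of vertices is `2 * k + 1`, because there are half as many lists as vertices. -/
theorem exists_decomposition {ι : Type*} [Fintype V] [Fintype ι] [DecidableRel G.Adj] {k : ℕ}
    (hk : 3 ≤ k) (hreg : G.IsRegularOfDegree (2 * k)) {l : ι → List V}
    (hcard : 2 * Fintype.card ι = Fintype.card V) (hnd : ∀ i, (l i).Nodup)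
    (hlen : ∀ i, 2 * k ≤ (l i).length ∧ (l i).length ≤ 2 * k + 2)
    (hE : ∑ i, pathEdges (l i) = G.edgeFinset.val) :
    ∃ D : Set G.Subgraph, IsDecomposition G D ∧
      (∀ H ∈ D, ∃ n ∈ ({2 * k - 1, 2 * k, 2 * k + 1} : Set ℕ), IsPathOfLength H n) ∧
      {H ∈ D | IsPathOfLength H (2 * k - 1)}.ncard =
        {H ∈ D | IsPathOfLength H (2 * k + 1)}.ncard := by
  classical
  have hle : ∀ J : Finset ι, ∑ i ∈ J, pathEdges (l i) ≤ G.edgeFinset.val := fun J => by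
    rw [← hE]
    exact Finset.sum_le_sum_of_subset (Finset.subset_univ _)
  have hed : ∀ i, EdgeDistinct G (pathEdges (l i)) := fun i =>
    edgeDistinct_edgeFinset.mono (by simpa using hle {i})
  choose H hH hHl using fun i => exists_subgraph_of_list (l := l i) (by
    intro h0
    have := (hlen i).1
    rw [h0, List.length_nil] at this
    omega) (hnd i) (hed i)
  have hdis : ∀ i j, i ≠ j → Disjoint (H i).edgeSet (H j).edgeSet := by
    intro i j hij
    rw [Set.disjoint_left]
    intro e hi hj
    have h1 := hle {i, j}
    rw [Finset.sum_pair hij] at h1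
    have h2 := (Multiset.nodup_add.1 (Multiset.nodup_of_le h1 G.edgeFinset.nodup)).2.2
    rw [Multiset.disjoint_left] at h2
    exact h2 ((hH i e).1 hi) ((hH j e).1 hj)
  have hne : ∀ i, (H i).edgeSet.Nonempty := by
    intro i
    have h1 : 0 < (pathEdges (l i)).card := by
      rw [card_pathEdges]
      have := (hlen i).1
      omega
    obtain ⟨e, he⟩ := Multiset.card_pos_iff_exists_mem.1 h1
    exact ⟨e, (hH i e).2 he⟩
  have hinj : Function.Injective H := by
    intro i j hij
    by_contra hne'
    have := hdis i j hne'
    rw [hij, disjoint_self] at this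
    exact (hne j).ne_empty this
  have hcount : ∀ n, {K ∈ Set.range H | IsPathOfLength K n}.ncard =
      (Finset.univ.filter fun i => (l i).length = n + 1).card := by
    intro n
    rw [← Set.ncard_coe_finset, ← Set.ncard_image_of_injective _ hinj]
    congr 1
    ext K
    simp only [Set.mem_ofPred_eq, Set.mem_range, Finset.coe_filter, Finset.mem_univ, true_and,
      Set.mem_image]
    constructor
    · rintro ⟨⟨i, rfl⟩, hK⟩
      exact ⟨i, (hHl i n).1 hK, rfl⟩
    · rintro ⟨i, hi, rfl⟩
      exact ⟨⟨i, rfl⟩, (hHl i n).2 hi⟩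
  refine ⟨Set.range H, ⟨?_, ?_, ?_⟩, ?_, ?_⟩
  · rintro _ ⟨i, rfl⟩
    exact hne i
  · rintro _ ⟨i, rfl⟩ _ ⟨j, rfl⟩ hij
    exact hdis i j fun h => hij (h ▸ rfl)
  · ext e
    rw [Set.biUnion_range, Set.mem_iUnion, ← SimpleGraph.mem_edgeFinset, ← Finset.mem_val, ← hE,
      Multiset.mem_sum]
    simp [hH]
  · rintro _ ⟨i, rfl⟩
    have h1 := hlen i
    refine ⟨(l i).length - 1, ?_, (hHl i _).2 (by omega)⟩
    simp only [Set.mem_insert_iff, Set.mem_singleton_iff]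
    omega
  · rw [hcount, hcount, Finset.card_filter, Finset.card_filter]
    have h1 : ∑ i, ((l i).length - 1) = G.edgeFinset.card := by
      rw [Finset.card, ← hE, Multiset.card_sum]
      exact Finset.sum_congr rfl fun i _ => (card_pathEdges _).symm
    have h2 := G.sum_degrees_eq_twice_card_edges
    rw [Finset.sum_congr rfl fun v _ => hreg v, Finset.sum_const, smul_eq_mul, Finset.card_univ,
      ← hcard, ← h1] at h2
    have h3 : ∑ i, ((l i).length - 1) + ∑ i, (if (l i).length = 2 * k - 1 + 1 then 1 else 0) =
        ∑ _i : ι, 2 * k + ∑ i, (if (l i).length = 2 * k + 1 + 1 then 1 else 0) := by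
      rw [← Finset.sum_add_distrib, ← Finset.sum_add_distrib]
      refine Finset.sum_congr rfl fun i _ => ?_
      have h4 := hlen i
      split_ifs <;> omega
    rw [Finset.sum_const, Finset.card_univ, smul_eq_mul] at h3
    rw [mul_assoc] at h2
    omega

/-- A perfect matching as an involution. -/
theorem exists_partner {M : G.Subgraph} (hM : M.IsPerfectMatching) :
    ∃ m : V → V, (∀ x, m (m x) = x) ∧ ∀ x, M.Adj x (m x) := by
  rw [SimpleGraph.Subgraph.isPerfectMatching_iff] at hM
  choose m hm huniq using hM
  exact ⟨m, fun x => (huniq (m x) x (hm x).symm).symm, hm⟩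

end Decomposition

end PathDecomp

theorem theorem2 {V : Type*} [Fintype V] (G : SimpleGraph V) [DecidableRel G.Adj]
    (k : ℕ) (hk : 3 ≤ k) (hG : PathDecomp.InClass G k) :
    ∃ D : Set G.Subgraph, PathDecomp.IsDecomposition G D ∧
      (∀ H ∈ D, ∃ l ∈ ({2 * k - 1, 2 * k, 2 * k + 1} : Set ℕ), PathDecomp.IsPathOfLength H l) ∧
      {H ∈ D | PathDecomp.IsPathOfLength H (2 * k - 1)}.ncard =
        {H ∈ D | PathDecomp.IsPathOfLength H (2 * k + 1)}.ncard := by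
  classical
  obtain ⟨M₁, M₂, hM₁, hM₂, hdis⟩ := hG.matchings
  obtain ⟨σ, hσ, hσM⟩ := PathDecomp.exists_partner hM₁
  obtain ⟨m, hm, hmM⟩ := PathDecomp.exists_partner hM₂
  obtain ⟨R, l₀, p₀, hcard, hnd, hlen, hend, hE⟩ := PathDecomp.exists_initial_paths hk hG.girth
    hG.regular hm hσ (fun x => (hmM x).adj_sub) (fun x => (hσM x).adj_sub) fun x hx =>
      Set.disjoint_left.1 hdis (SimpleGraph.Subgraph.mem_edgeSet.2 (hσM x))
        (SimpleGraph.Subgraph.mem_edgeSet.2 (hx ▸ hmM x))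
  obtain ⟨l, p, h⟩ := PathDecomp.exists_pathSystem hk hG.girth hG.regular hm
    (fun x => (hmM x).adj_sub.ne') hnd hlen hend hE
  have hedges := h.edges
  rw [PathDecomp.matchEdges_empty, add_zero] at hedges
  exact PathDecomp.exists_decomposition hk hG.regular (by rwa [Fintype.card_coe]) h.nodup
    (fun i => ⟨h.le_length i, by simpa using h.length_le i⟩) hedges
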